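/- **Setting.** Let $H$ be a self-adjoint, translation-invariant operator of range $1$ on $\ell^2(\mathbb Z^2,\mathbb C^n)$, i.e. $(H\psi)(p)=\sum_q H(p,q)\psi(q)$ with $n\times n$ matrices satisfying $H(q,p)=H(p,q)^*$, $H(p+v,q+v)=H(p,q)$ for all $v\in\mathbb Z^2$, and $H(p,q)=0$ when $|p-q|_\infty>1$. With the Fourier convention $\hat\psi(k)=\sum_p e^{ik\cdot p}\psi(p)$, $H$ becomes multiplication by $$H(k_x,k_y)=\sum_{|r|_\infty\le 1}e^{i(k_xr_1+k_yr_2)}H(r,0).$$ Assume that $H(k_x,k_y)$ has $n$ distinct eigenvalues $E_1(k_x,k_y)<\dots<E_n(k_x,k_y)$, that for each $1\le j<n$ there is a number $e_j$ with $E_j(k_x,k_y)<e_j<E_{j+1}(k_x,k_y)$ for all $k_x,k_y$, and that for some $0\le N\le n$ and all $k_x,k_y$ one has $E_j(k_x,k_y)<0$ for $j\le N$ and $E_j(k_x,k_y)>0$ for $j>N$ (Fermi level $0$; the bands $1,\dots,N$ are occupied). **Chern numbers.** Choose a continuous normalized eigenvector $\varphi_j(k_x,k_y)$ of $H(k_x,k_y)$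 for $E_j(k_x,k_y)$ on $[0,2\pi]^2$ with $\varphi_j(k_x,2\pi)=\varphi_j(k_x,0)$ and $\varphi_j(2\pi,k_y)=e^{i\theta_j(k_y)}\varphi_j(0,k_y)$, $\theta_j$ continuous. The Chern number of band $j$ is the integer $c_j=\frac1{2\pi}(\theta_j(2\pi)-\theta_j(0))$. The Hall conductance is $\kappa=\sum_{j=1}^N c_j$. **Edge operator.** Write $H=\sum_{x\in\mathbb Z}H_x$, where $H_x$ consists of all terms of $H$ within the column $x$ and all terms between the columns $x$ and $x+1$. Put $\widetilde H=\sum_x xH_x$ and let $\widetilde H_{\mathrm{edge}}$ be its restriction to $\ell^2(\{x\ge1\}\times\mathbb Z,\mathbb C^n)$. Let $\widetilde H_{\mathrm{edge}}(k_y)$ be its fibers under the partial Fourier transform $\hat\psi(k_y)=\sum_y e^{ik_yy}\psi(y)$; they are unbounded operators on $\ell^2(\{x\ge 1\},\mathbb C^n)$ with domain $\{\psi:\sum_x x^2\|\psi(x)\|^2<\infty\}$. **Theorem.** For every $k_y\in\mathbb R$ the operator $\widetilde H_{\mathrm{edge}}(k_y)$ is self-adjoint and its spectrum is discrete: it consists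 of isolated eigenvalues of finite multiplicity. The Chern numbers $c_1,\dots,c_n$ exist and are uniquely determined. For every fiducial energy $e\in\mathbb R$, the spectral flow of $k_y\mapsto\widetilde H_{\mathrm{edge}}(k_y)$, $k_y\in[0,2\pi]$, through $e$ (the number of eigenvalue branches crossing $e$ upwards minus the number crossing it downwards, counted with multiplicity) is well defined and equals the Hall conductance, $$\mathrm{sf}\big(\widetilde H_{\mathrm{edge}}(\cdot)\big)=\kappa=\sum_{j=1}^N c_j .$$ Here the spectral flow is defined as follows: subdivide $0=t_0\le t_1\le\dots\le t_M=2\pi$ and choose levels $a_i\ge e$ such that $a_i$ is not in the spectrum of $\widetilde H_{\mathrm{edge}}(t)$ for any $t\in[t_i,t_{i+1}]$; the spectral flow is $\sum_{i<M}\big(n_i(t_{i+1})-n_i(t_i)\big)$, where $n_i(t)$ is the number of eigenvalues of $\widetilde H_{\mathrm{edge}}(t)$ in $[e,a_i)$, counted with multiplicity. Such a subdivision exists and the value does not depend on the choices. -/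

import Mathlib

open Real Set
open scoped Matrix

noncomputable section

namespace KitaevEdge

/-! ### Unbounded operators: spectrum, discreteness, spectral flow -/

section Operators

variable {F : Type*} [NormedAddCommGroup F] [InnerProductSpace ℂ F]

/-- `z` lies in the resolvent set of the partially defined operator `T` when `T - z` is a bijection
from the domain of `T` onto the whole space, with bounded inverse `R`. -/
def resolventSet (T : F →ₗ.[ℂ] F) : Set ℂ :=
  {z | ∃ R : F →L[ℂ] F,
    (∀ f : F, ∃ h : R f ∈ T.domain, T ⟨R f, h⟩ - z • R f = f) ∧
    (∀ u : T.domain, R (T u - z • (u : F)) = u)}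

/-- The spectrum of a partially defined operator. -/
def spectrum (T : F →ₗ.[ℂ] F) : Set ℂ := (resolventSet T)ᶜ

/-- The eigenspace `{u ∈ dom T | T u = z u}`. -/
def eigenspace (T : F →ₗ.[ℂ] F) (z : ℂ) : Submodule ℂ F :=
  (LinearMap.ker (T.toFun - z • T.domain.subtype)).map T.domain.subtype

/-- The spectrum is discrete: every spectral point is isolated in the spectrum and is an
eigenvalue of finite multiplicity. -/
def HasDiscreteSpectrum (T : F →ₗ.[ℂ] F) : Prop :=
  ∀ z ∈ spectrum T,
    (∃ ε > 0, ∀ w ∈ spectrum T, dist w z < ε → w = z) ∧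
    eigenspace T z ≠ ⊥ ∧ FiniteDimensional ℂ (eigenspace T z)

/-- The number of eigenvalues of `T`, counted with multiplicity, in the interval `[a, b)`. -/
def eigenvalueCount (T : F →ₗ.[ℂ] F) (a b : ℝ) : ℕ :=
  Module.finrank ℂ (⨆ μ ∈ Ico a b, eigenspace T (μ : ℂ) : Submodule ℂ F)

/-- `s` is the spectral flow of the family `T t`, `t₀ ≤ t ≤ t₁`, through the fiducial level `e`:
the number of eigenvalue branches crossing `e` upwards minus the number crossing it downwards,
counted with multiplicity (Phillips' definition). There are a subdivision
`t₀ = t 0 ≤ ⋯ ≤ t N = t₁` and levels `a i ≥ e` such that `a i` is not in the spectrum of `T u`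
for any `u ∈ [t i, t (i+1)]`; then the net number of branches crossing `e` during
`[t i, t (i+1)]` is the change of the number of eigenvalues in `[e, a i)`. -/
def HasSpectralFlow (T : ℝ → F →ₗ.[ℂ] F) (t₀ t₁ e : ℝ) (s : ℤ) : Prop :=
  ∃ (N : ℕ) (t a : ℕ → ℝ), Monotone t ∧ t 0 = t₀ ∧ t N = t₁ ∧
    (∀ i < N, e ≤ a i ∧ ∀ u ∈ Icc (t i) (t (i + 1)), (a i : ℂ) ∉ spectrum (T u)) ∧
    s = ∑ i ∈ Finset.range N,
      ((eigenvalueCount (T (t (i + 1))) e (a i) : ℤ) - (eigenvalueCount (T (t i)) e (a i) : ℤ))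

end Operators

/-! ### The bulk Hamiltonian -/

/-- A translation-invariant one-particle Hamiltonian of range one on `ℓ²(ℤ², ℂⁿ)`, given by its
matrix kernel: `(H ψ)(p) = ∑ q, kernel p q ψ(q)`. The distance on `ℤ × ℤ` is the `ℓ^∞` one. -/
structure Hamiltonian (n : ℕ) where
  kernel : ℤ × ℤ → ℤ × ℤ → Matrix (Fin n) (Fin n) ℂ
  hermitian : ∀ p q, kernel q p = (kernel p q)ᴴ
  periodic : ∀ v p q, kernel (p + v) (q + v) = kernel p q
  range_one : ∀ p q, 1 < dist p q → kernel p q = 0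

variable {n : ℕ}

/-- The Fourier transform `H(k_x, k_y)` of `H`, for the convention
`ψ(k) = ∑ p, e^{i k·p} ψ(p)`; the sum runs over the nine sites at distance at most one from `0`. -/
def Hamiltonian.bloch (H : Hamiltonian n) (kx ky : ℝ) : Matrix (Fin n) (Fin n) ℂ :=
  ∑ r ∈ Finset.Icc (-1 : ℤ) 1 ×ˢ Finset.Icc (-1 : ℤ) 1,
    Complex.exp (Complex.I * (kx * r.1 + ky * r.2)) • H.kernel r 0

/-- `E 0 < E 1 < ⋯` are the `n` eigenvalues of `H(k_x, k_y)`, and consecutive bands are separated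
by an energy that does not depend on the momentum. -/
structure IsGappedBands (H : Hamiltonian n) (E : Fin n → ℝ → ℝ → ℝ) : Prop where
  eigenvalue : ∀ j kx ky,
    Module.End.HasEigenvalue (Matrix.toLin' (H.bloch kx ky)) (E j kx ky : ℂ)
  strictMono : ∀ kx ky, StrictMono fun j => E j kx ky
  gap : ∀ i j : Fin n, i.val + 1 = j.val → ∃ e : ℝ, ∀ kx ky, E i kx ky < e ∧ e < E j kx ky

/-- `c` is the Chern number of the band `E`: there is a continuous frame of normalized eigenvectors
over `[0, 2π]²`, periodic in `k_y`, whose two boundary values in the `k_x`-direction differ by a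
phase `e^{i θ(k_y)}` of winding number `c`. -/
def IsChernNumber (H : Hamiltonian n) (E : ℝ → ℝ → ℝ) (c : ℤ) : Prop :=
  ∃ (φ : ℝ → ℝ → EuclideanSpace ℂ (Fin n)) (θ : ℝ → ℝ),
    ContinuousOn (Function.uncurry φ) (Icc 0 (2 * π) ×ˢ Icc 0 (2 * π)) ∧
    (∀ kx ∈ Icc 0 (2 * π), ∀ ky ∈ Icc 0 (2 * π), ‖φ kx ky‖ = 1 ∧
      Matrix.toEuclideanLin (H.bloch kx ky) (φ kx ky) = (E kx ky : ℂ) • φ kx ky) ∧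
    ContinuousOn θ (Icc 0 (2 * π)) ∧
    (∀ ky ∈ Icc 0 (2 * π), φ (2 * π) ky = Complex.exp (Complex.I * θ ky) • φ 0 ky) ∧
    (∀ kx ∈ Icc 0 (2 * π), φ kx (2 * π) = φ kx 0) ∧
    θ (2 * π) - θ 0 = 2 * π * c

/-! ### The distance modulated Hamiltonian and its edge restriction -/

/-- The kernel of `H_x`: the terms of `H` within the column `x`, and those between the columns
`x` and `x + 1`. -/
def Hamiltonian.columnKernel (H : Hamiltonian n) (x : ℤ) (p q : ℤ × ℤ) :
    Matrix (Fin n) (Fin n) ℂ :=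
  if (p.1 = x ∧ q.1 = x) ∨ (p.1 = x ∧ q.1 = x + 1) ∨ (p.1 = x + 1 ∧ q.1 = x)
  then H.kernel p q else 0

/-- The kernel of `∑ x, x H_x`; for given sites at most one term of the sum is nonzero. -/
def Hamiltonian.modulatedKernel (H : Hamiltonian n) (p q : ℤ × ℤ) : Matrix (Fin n) (Fin n) ℂ :=
  ∑ᶠ x : ℤ, (x : ℂ) • H.columnKernel x p q

/-- The partial Fourier transform in the `y`-direction (convention `ψ(k_y) = ∑ y, e^{i k_y y} ψ(y)`)
of the restriction of `∑ x, x H_x` to the half-space `x ≥ 1`, as an infinite matrix of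
`n × n` blocks. The index `m : ℕ` stands for the column `x = m + 1`; kernel entries between sites
with `|y - y'| > 1` vanish. -/
def Hamiltonian.edgeBlock (H : Hamiltonian n) (ky : ℝ) (m j : ℕ) : Matrix (Fin n) (Fin n) ℂ :=
  ∑ y ∈ Finset.Icc (-1 : ℤ) 1,
    Complex.exp (Complex.I * (ky * y)) • H.modulatedKernel ((m : ℤ) + 1, y) ((j : ℤ) + 1, 0)

/-- `ℓ²(ℕ, ℂⁿ)`. -/
abbrev HalfLine (n : ℕ) : Type := lp (fun _ : ℕ => EuclideanSpace ℂ (Fin n)) 2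

/-- The block matrix acting on sequences; blocks `(m, j)` with `j > m + 1` vanish. -/
def Hamiltonian.edgeAction (H : Hamiltonian n) (ky : ℝ) (ψ : ℕ → EuclideanSpace ℂ (Fin n))
    (m : ℕ) : EuclideanSpace ℂ (Fin n) :=
  ∑ j ∈ Finset.range (m + 2), Matrix.toEuclideanLin (H.edgeBlock ky m j) (ψ j)

theorem Hamiltonian.kernel_eq_zero (H : Hamiltonian n) {p q : ℤ × ℤ} (h : 1 < |p.1 - q.1|) :
    H.kernel p q = 0 := by
  apply H.range_one
  refine lt_of_lt_of_le ?_ (le_max_left _ _)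
  rw [Int.dist_eq]
  exact_mod_cast h

theorem Hamiltonian.modulatedKernel_eq (H : Hamiltonian n) (p q : ℤ × ℤ) :
    H.modulatedKernel p q = ((min p.1 q.1 : ℤ) : ℂ) • H.kernel p q := by
  unfold Hamiltonian.modulatedKernel
  rw [finsum_eq_single _ (min p.1 q.1)]
  · unfold Hamiltonian.columnKernel
    split_ifs with h
    · rfl
    · rw [H.kernel_eq_zero]
      by_contra hc
      apply h
      rw [not_lt, abs_le] at hc
      omega
  · intro x hx
    unfold Hamiltonian.columnKernel
    rw [if_neg, smul_zero]
    intro h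
    apply hx
    omega

theorem Hamiltonian.edgeBlock_eq_zero (H : Hamiltonian n) (ky : ℝ) {m j : ℕ}
    (h : 1 < |(m : ℤ) - j|) : H.edgeBlock ky m j = 0 := by
  refine Finset.sum_eq_zero fun y _ => ?_
  rw [H.modulatedKernel_eq, H.kernel_eq_zero, smul_zero, smul_zero]
  simpa using h

theorem Hamiltonian.edgeBlock_bound (H : Hamiltonian n) (ky : ℝ) :
    ∃ D : ℝ, 0 ≤ D ∧ ∀ (m j : ℕ) (u : EuclideanSpace ℂ (Fin n)),
      ‖Matrix.toEuclideanLin (H.edgeBlock ky m j) u‖ ≤ D * (((j : ℝ) + 1) * ‖u‖) := by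
  let N : ℤ × ℤ → ℝ := fun r =>
    ‖(Matrix.toEuclideanLin (H.kernel r 0)).toContinuousLinearMap‖
  have hN : ∀ r u, ‖Matrix.toEuclideanLin (H.kernel r 0) u‖ ≤ N r * ‖u‖ := fun r u =>
    (Matrix.toEuclideanLin (H.kernel r 0)).toContinuousLinearMap.le_opNorm u
  have hN0 : ∀ r, 0 ≤ N r := fun r => norm_nonneg _
  refine ⟨∑ x ∈ Finset.Icc (-1 : ℤ) 1, ∑ y ∈ Finset.Icc (-1 : ℤ) 1, N (x, y), ?_, ?_⟩
  · exact Finset.sum_nonneg fun x _ => Finset.sum_nonneg fun y _ => hN0 _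
  intro m j u
  by_cases h : 1 < |(m : ℤ) - j|
  · rw [H.edgeBlock_eq_zero ky h, map_zero, LinearMap.zero_apply, norm_zero]
    have : 0 ≤ ∑ x ∈ Finset.Icc (-1 : ℤ) 1, ∑ y ∈ Finset.Icc (-1 : ℤ) 1, N (x, y) :=
      Finset.sum_nonneg fun x _ => Finset.sum_nonneg fun y _ => hN0 _
    positivity
  · have hx : (m : ℤ) - j ∈ Finset.Icc (-1 : ℤ) 1 := by
      rw [not_lt, abs_le] at h
      exact Finset.mem_Icc.2 h
    have h1 : ‖Matrix.toEuclideanLin (H.edgeBlock ky m j) u‖ ≤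
        ∑ y ∈ Finset.Icc (-1 : ℤ) 1, N ((m : ℤ) - j, y) * (((j : ℝ) + 1) * ‖u‖) := by
      unfold Hamiltonian.edgeBlock
      rw [map_sum, LinearMap.sum_apply]
      refine (norm_sum_le _ _).trans (Finset.sum_le_sum fun y _ => ?_)
      have hper := H.periodic ((j : ℤ) + 1, 0) ((m : ℤ) - j, y) 0
      have e1 : (((m : ℤ) - j, y) : ℤ × ℤ) + ((j : ℤ) + 1, 0) = ((m : ℤ) + 1, y) := by
        ext <;> simp
        ring
      rw [e1, zero_add] at hper
      rw [H.modulatedKernel_eq, hper]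
      simp only [map_smul, LinearMap.smul_apply, norm_smul]
      have hexp : ‖Complex.exp (Complex.I * (ky * y))‖ = 1 := by
        have : Complex.I * (ky * y) = ((ky * y : ℝ) : ℂ) * Complex.I := by push_cast; ring
        rw [this, Complex.norm_exp_ofReal_mul_I]
      have hmin : ‖((min ((m : ℤ) + 1) ((j : ℤ) + 1) : ℤ) : ℂ)‖ ≤ (j : ℝ) + 1 := by
        rw [Complex.norm_intCast, abs_of_nonneg]
        · have : min ((m : ℤ) + 1) ((j : ℤ) + 1) ≤ (j : ℤ) + 1 := min_le_right _ _
          exact_mod_cast this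
        · have : 0 ≤ min ((m : ℤ) + 1) ((j : ℤ) + 1) := by omega
          exact_mod_cast this
      rw [hexp, one_mul]
      calc _ ≤ ((j : ℝ) + 1) * (N ((m : ℤ) - j, y) * ‖u‖) :=
            mul_le_mul hmin (hN _ _) (norm_nonneg _) (by positivity)
        _ = _ := by ring
    refine h1.trans ?_
    rw [← Finset.sum_mul]
    refine mul_le_mul_of_nonneg_right ?_ (by positivity)
    exact Finset.single_le_sum (f := fun x => ∑ y ∈ Finset.Icc (-1 : ℤ) 1, N (x, y))
      (fun x _ => Finset.sum_nonneg fun y _ => hN0 _) hx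

theorem Hamiltonian.edgeAction_mem (H : Hamiltonian n) (ky : ℝ)
    (ψ : ℕ → EuclideanSpace ℂ (Fin n))
    (hψ : Summable fun m : ℕ => ((m : ℝ) + 1) ^ 2 * ‖ψ m‖ ^ 2) :
    Memℓp (H.edgeAction ky ψ) 2 := by
  obtain ⟨D, hD, hb⟩ := H.edgeBlock_bound ky
  let a : ℕ → ℝ := fun j => ((j : ℝ) + 1) * ‖ψ j‖
  have ha0 : ∀ j, 0 ≤ a j := fun j => by positivity
  have ha : Summable fun j => a j ^ 2 := by simpa only [a, mul_pow] using hψ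
  have ha1 : Summable fun j => a (j + 1) ^ 2 := (summable_nat_add_iff 1).2 ha
  have ha2 : Summable fun j => a (j - 1) ^ 2 :=
    (summable_nat_add_iff (f := fun j => a (j - 1) ^ 2) 1).1 (by simpa using ha)
  have hrow : ∀ m, ‖H.edgeAction ky ψ m‖ ≤ D * (a (m - 1) + a m + a (m + 1)) := by
    intro m
    have key : H.edgeAction ky ψ m =
        ∑ j ∈ Finset.Icc (m - 1) (m + 1), Matrix.toEuclideanLin (H.edgeBlock ky m j) (ψ j) := by
      symm
      apply Finset.sum_subset
      · intro j hj
        simp only [Finset.mem_Icc, Finset.mem_range] at hj ⊢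
        omega
      · intro j hj hj'
        simp only [Finset.mem_Icc, Finset.mem_range] at hj hj'
        rw [H.edgeBlock_eq_zero, map_zero, LinearMap.zero_apply]
        rw [lt_abs]
        omega
    rw [key]
    refine (norm_sum_le _ _).trans ?_
    refine (Finset.sum_le_sum fun j _ => hb m j (ψ j)).trans ?_
    rw [← Finset.mul_sum]
    refine mul_le_mul_of_nonneg_left ?_ hD
    calc ∑ j ∈ Finset.Icc (m - 1) (m + 1), ((j : ℝ) + 1) * ‖ψ j‖
        = ∑ j ∈ Finset.Icc (m - 1) (m + 1), a j := rfl
      _ ≤ ∑ j ∈ Finset.Icc (m - 1) (m - 1) ∪ {m, m + 1}, a j := by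
          refine Finset.sum_le_sum_of_subset_of_nonneg ?_ fun j _ _ => ha0 j
          intro j hj
          simp only [Finset.mem_Icc, Finset.mem_union, Finset.mem_insert,
            Finset.mem_singleton] at hj ⊢
          omega
      _ ≤ ∑ j ∈ Finset.Icc (m - 1) (m - 1), a j + ∑ j ∈ {m, m + 1}, a j := by
          rw [← Finset.sum_union_inter]
          exact le_add_of_nonneg_right (Finset.sum_nonneg fun j _ => ha0 j)
      _ = a (m - 1) + a m + a (m + 1) := by
          rw [Finset.Icc_self, Finset.sum_singleton, Finset.sum_pair (by omega), add_assoc]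
  apply memℓp_gen
  simp only [ENNReal.toReal_ofNat, Real.rpow_ofNat]
  refine Summable.of_nonneg_of_le (fun m => by positivity) (fun m => ?_)
    (((ha2.add ha).add ha1).mul_left (3 * D ^ 2))
  calc ‖H.edgeAction ky ψ m‖ ^ 2 ≤ (D * (a (m - 1) + a m + a (m + 1))) ^ 2 := by
        gcongr
        exact hrow m
    _ = D ^ 2 * (a (m - 1) + a m + a (m + 1)) ^ 2 := by ring
    _ ≤ D ^ 2 * (3 * (a (m - 1) ^ 2 + a m ^ 2 + a (m + 1) ^ 2)) := by
        refine mul_le_mul_of_nonneg_left ?_ (sq_nonneg D)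
        nlinarith [sq_nonneg (a (m - 1) - a m), sq_nonneg (a (m - 1) - a (m + 1)),
          sq_nonneg (a m - a (m + 1))]
    _ = _ := by ring

/-- The domain of the edge operators: all `ψ` with `∑ x, x² ‖ψ(x)‖² < ∞`. -/
def edgeDomain (n : ℕ) : Submodule ℂ (HalfLine n) where
  carrier := {ψ | Summable fun m : ℕ => ((m : ℝ) + 1) ^ 2 * ‖ψ m‖ ^ 2}
  zero_mem' := by simp [summable_zero]
  add_mem' := by
    intro u v hu hv
    refine Summable.of_nonneg_of_le (fun m => by positivity) (fun m => ?_)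
      ((hu.add hv).mul_left 2)
    have h1 : ‖(u + v) m‖ ≤ ‖u m‖ + ‖v m‖ := norm_add_le _ _
    have h2 : ‖(u + v) m‖ ^ 2 ≤ 2 * (‖u m‖ ^ 2 + ‖v m‖ ^ 2) := by
      nlinarith [norm_nonneg ((u + v) m), sq_nonneg (‖u m‖ - ‖v m‖)]
    calc ((m : ℝ) + 1) ^ 2 * ‖(u + v) m‖ ^ 2
        ≤ ((m : ℝ) + 1) ^ 2 * (2 * (‖u m‖ ^ 2 + ‖v m‖ ^ 2)) := by gcongr
      _ = _ := by ring
  smul_mem' := by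
    intro c u hu
    refine (hu.mul_left (‖c‖ ^ 2)).congr fun m => ?_
    have : (c • u) m = c • u m := rfl
    rw [this, norm_smul]
    ring

/-- The fiber at `k_y` of the edge Hamiltonian, as an unbounded operator on `ℓ²(ℕ, ℂⁿ)`. -/
def Hamiltonian.edgeFiber (H : Hamiltonian n) (ky : ℝ) : HalfLine n →ₗ.[ℂ] HalfLine n where
  domain := edgeDomain n
  toFun :=
    { toFun := fun ψ => ⟨H.edgeAction ky (ψ : HalfLine n), H.edgeAction_mem ky _ ψ.2⟩
      map_add' := by
        intro u v
        ext1
        funext m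
        simp [Hamiltonian.edgeAction, Finset.sum_add_distrib]
        rfl
      map_smul' := by
        intro c u
        ext1
        funext m
        simp [Hamiltonian.edgeAction, Finset.smul_sum] }

end KitaevEdge

end

open Real Set
open scoped Matrix

noncomputable section

namespace KitaevEdge

section Inertia

open Module Topology Filter
open scoped InnerProductSpace

variable {K : Type*} [NormedAddCommGroup K] [InnerProductSpace ℂ K]

/-- The largest dimension of a subspace of `M` on which `s` is negative away from `0`. -/
def negDim (s : K → ℝ) (M : Submodule ℂ K) : ℕ :=
  sSup {d | ∃ Z ≤ M, finrank ℂ Z = d ∧ ∀ w ∈ Z, w ≠ 0 → s w < 0}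

theorem bddAbove_negDim (s : K → ℝ) (M : Submodule ℂ K) [FiniteDimensional ℂ M] :
    BddAbove {d | ∃ Z ≤ M, finrank ℂ Z = d ∧ ∀ w ∈ Z, w ≠ 0 → s w < 0} :=
  ⟨finrank ℂ M, by rintro d ⟨Z, hZ, rfl, -⟩; exact Submodule.finrank_mono hZ⟩

theorem le_negDim {s : K → ℝ} {M Z : Submodule ℂ K} [FiniteDimensional ℂ M] (hZ : Z ≤ M)
    (h : ∀ w ∈ Z, w ≠ 0 → s w < 0) : finrank ℂ Z ≤ negDim s M :=
  le_csSup (bddAbove_negDim s M) ⟨Z, hZ, rfl, h⟩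

theorem exists_negDim (s : K → ℝ) (M : Submodule ℂ K) [FiniteDimensional ℂ M] :
    ∃ Z ≤ M, finrank ℂ Z = negDim s M ∧ ∀ w ∈ Z, w ≠ 0 → s w < 0 :=
  Nat.sSup_mem (s := {d | ∃ Z ≤ M, finrank ℂ Z = d ∧ ∀ w ∈ Z, w ≠ 0 → s w < 0})
    ⟨0, ⊥, bot_le, finrank_bot ℂ K, by simp⟩ (bddAbove_negDim s M)

theorem negDim_le_of_equiv {K' : Type*} [NormedAddCommGroup K'] [InnerProductSpace ℂ K']
    {s : K → ℝ} {s' : K' → ℝ} {M : Submodule ℂ K} {M' : Submodule ℂ K'} [FiniteDimensional ℂ M]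
    [FiniteDimensional ℂ M'] (f : K →ₗ[ℂ] K') (hf : Function.Injective f)
    (hM : ∀ u ∈ M, f u ∈ M') (hs : ∀ u ∈ M, s' (f u) = s u) : negDim s M ≤ negDim s' M' := by
  obtain ⟨Z, hZ, hd, hneg⟩ := exists_negDim s M
  rw [← hd, (Submodule.equivMapOfInjective f hf Z).finrank_eq]
  refine le_negDim ?_ ?_
  · rintro _ ⟨u, hu, rfl⟩
    exact hM u (hZ hu)
  · rintro _ ⟨u, hu, rfl⟩ h0
    rw [hs u (hZ hu)]
    exact hneg u hu fun h => h0 (by rw [h, map_zero])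

/-- The real quadratic form of an operator. -/
def quadForm (B : K →L[ℂ] K) (u : K) : ℝ := (⟪u, B u⟫_ℂ).re

theorem continuous_quadForm : Continuous fun x : (K →L[ℂ] K) × K => quadForm x.1 x.2 := by
  unfold quadForm
  fun_prop

theorem quadForm_neg (B : K →L[ℂ] K) : quadForm (-B) = fun u => -quadForm B u := by
  funext u; simp [quadForm]

theorem quadForm_smul (B : K →L[ℂ] K) (c : ℂ) (u : K) :
    quadForm B (c • u) = ‖c‖ ^ 2 * quadForm B u := by
  unfold quadForm
  rw [map_smul, inner_smul_left, inner_smul_right, ← mul_assoc, Complex.conj_mul']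
  rw [← Complex.ofReal_pow, Complex.re_ofReal_mul]

/-- `B` is symmetric, formulated without completeness. -/
def SymmOp (B : K →L[ℂ] K) : Prop := ∀ u v, ⟪B u, v⟫_ℂ = ⟪u, B v⟫_ℂ

theorem SymmOp.quadForm_add {B : K →L[ℂ] K} (hB : SymmOp B) (u v : K) :
    quadForm B (u + v) = quadForm B u + 2 * (⟪v, B u⟫_ℂ).re + quadForm B v := by
  unfold quadForm
  have : (⟪u, B v⟫_ℂ).re = (⟪v, B u⟫_ℂ).re := by
    rw [← hB u v, ← inner_conj_symm, Complex.conj_re]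
  simp only [map_add, inner_add_left, inner_add_right, Complex.add_re, this]
  ring

theorem SymmOp.neg {B : K →L[ℂ] K} (hB : SymmOp B) : SymmOp (-B) := fun u v => by
  simp [hB u v]

/-- The radical of the form of `B` on `M`. -/
def formRadical (B : K →L[ℂ] K) (M : Submodule ℂ K) : Submodule ℂ K :=
  M ⊓ Mᗮ.comap (B : K →ₗ[ℂ] K)

theorem mem_formRadical {B : K →L[ℂ] K} {M : Submodule ℂ K} {u : K} :
    u ∈ formRadical B M ↔ u ∈ M ∧ ∀ v ∈ M, ⟪v, B u⟫_ℂ = 0 := Iff.rfl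

theorem finrank_add_le_of_disjoint {M Z₁ Z₂ : Submodule ℂ K} [FiniteDimensional ℂ M] (h₁ : Z₁ ≤ M)
    (h₂ : Z₂ ≤ M) (h : ∀ u ∈ Z₁, u ∈ Z₂ → u = 0) :
    finrank ℂ Z₁ + finrank ℂ Z₂ = finrank ℂ (Z₁ ⊔ Z₂ : Submodule ℂ K) := by
  have := Submodule.finiteDimensional_of_le h₁
  have := Submodule.finiteDimensional_of_le h₂
  have hd : Disjoint Z₁ Z₂ := Submodule.disjoint_def.2 h
  have := Submodule.finrank_sup_add_finrank_inf_eq Z₁ Z₂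
  rw [hd.eq_bot, finrank_bot] at this
  omega

theorem SymmOp.inertia_le {B : K →L[ℂ] K} (hB : SymmOp B) (M : Submodule ℂ K)
    [FiniteDimensional ℂ M] :
    negDim (quadForm B) M + negDim (quadForm (-B)) M + finrank ℂ (formRadical B M)
      ≤ finrank ℂ M := by
  obtain ⟨Z, hZ, hd, hneg⟩ := exists_negDim (quadForm B) M
  obtain ⟨Y, hY, hd', hpos⟩ := exists_negDim (quadForm (-B)) M
  simp only [quadForm_neg] at hpos
  have hR : formRadical B M ≤ M := inf_le_left
  have hadd : ∀ u ∈ M, ∀ v ∈ formRadical B M, quadForm B (u + v) = quadForm B u := by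
    intro u hu v hv
    rw [add_comm, hB.quadForm_add, (mem_formRadical.1 hv).2 u hu]
    simp [quadForm, (mem_formRadical.1 hv).2 v (hR hv)]
  have h1 := finrank_add_le_of_disjoint hY hR fun u hu hu' => by
    by_contra h0
    have := hadd 0 (zero_mem _) u hu'
    have h2 := hpos u hu h0
    rw [zero_add] at this
    rw [this] at h2
    simp [quadForm] at h2
  have h2 := finrank_add_le_of_disjoint hZ (sup_le hY hR) fun u hu hu' => by
    by_contra h0
    obtain ⟨y, hy, r, hr, rfl⟩ := Submodule.mem_sup.1 hu'
    have h3 := hneg _ hu h0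
    rw [hadd y (hY hy) r hr] at h3
    by_cases hy0 : y = 0
    · simp [hy0, quadForm] at h3
    · have := hpos y hy hy0
      linarith
  have h3 := Submodule.finrank_mono (sup_le hZ (sup_le hY hR))
  omega

theorem SymmOp.inertia_ge {B : K →L[ℂ] K} (hB : SymmOp B) (M : Submodule ℂ K)
    [FiniteDimensional ℂ M] :
    finrank ℂ M ≤
      negDim (quadForm B) M + negDim (quadForm (-B)) M + finrank ℂ (formRadical B M) := by
  let S : M →ₗ[ℂ] M :=
    (M.orthogonalProjectionOnto : K →ₗ[ℂ] M) ∘ₗ (B : K →ₗ[ℂ] K) ∘ₗ M.subtype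
  have hSin : ∀ u v : M, ⟪u, S v⟫_ℂ = ⟪(u : K), B v⟫_ℂ := fun u v => by
    simp [S]
  have hS : S.IsSymmetric := fun u v => by
    rw [← inner_conj_symm, hSin, hSin, inner_conj_symm, hB]
  let b := hS.eigenvectorBasis rfl
  let μ := hS.eigenvalues rfl
  have hb : ∀ i, S (b i) = (μ i : ℂ) • b i := fun i => hS.apply_eigenvectorBasis rfl i
  let c : Fin (finrank ℂ M) → K := fun i => (b i : K)
  have hcM : ∀ i, c i ∈ M := fun i => (b i).2
  have hcB : ∀ i, ∀ v ∈ M, ⟪v, B (c i)⟫_ℂ = μ i * ⟪v, c i⟫_ℂ := fun i v hv => by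
    have := hSin ⟨v, hv⟩ (b i)
    rw [hb, inner_smul_right] at this
    exact this.symm
  have hcon : Orthonormal ℂ c := b.orthonormal.comp_linearIsometry M.subtypeₗᵢ
  have hform : ∀ a : Fin (finrank ℂ M) → ℂ,
      quadForm B (∑ i, a i • c i) = ∑ i, ‖a i‖ ^ 2 * μ i := by
    intro a
    have hmem : ∑ i, a i • c i ∈ M := sum_mem fun i _ => M.smul_mem _ (hcM i)
    unfold quadForm
    rw [map_sum, inner_sum, Complex.re_sum]
    refine Finset.sum_congr rfl fun i _ => ?_
    rw [map_smul, inner_smul_right, hcB i _ hmem, hcon.inner_left_fintype]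
    have : a i * (μ i * (starRingEnd ℂ) (a i)) = (‖a i‖ ^ 2 * μ i : ℝ) := by
      push_cast
      rw [← Complex.mul_conj']; ring
    rw [this, Complex.ofReal_re]
  have hli : ∀ s : Set (Fin (finrank ℂ M)), finrank ℂ (Submodule.span ℂ (c '' s)) = Nat.card s := by
    intro s
    classical
    have h1 := hcon.linearIndependent.comp ((↑) : s → _) Subtype.val_injective
    have h2 := finrank_span_eq_card (R := ℂ) h1
    rw [Nat.card_eq_fintype_card, ← h2, Set.range_comp, Subtype.range_coe]
  have hspan : ∀ s : Set (Fin (finrank ℂ M)), Submodule.span ℂ (c '' s) ≤ M := fun s => by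
    rw [Submodule.span_le]
    rintro _ ⟨i, -, rfl⟩
    exact hcM i
  have hrep : ∀ s : Set (Fin (finrank ℂ M)), ∀ w ∈ Submodule.span ℂ (c '' s),
      ∃ a : Fin (finrank ℂ M) → ℂ, (∀ i ∉ s, a i = 0) ∧ w = ∑ i, a i • c i := by
    intro s w hw
    obtain ⟨l, hl, rfl⟩ := (Finsupp.mem_span_image_iff_linearCombination ℂ).1 hw
    refine ⟨l, fun i hi => ?_, ?_⟩
    · by_contra h0
      exact hi (hl (Finsupp.mem_support_iff.2 h0))
    · rw [Finsupp.linearCombination_apply, Finsupp.sum_fintype]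
      simp
  have hneg : Nat.card {i | μ i < 0} ≤ negDim (quadForm B) M := by
    rw [← hli]
    refine le_negDim (hspan _) fun w hw h0 => ?_
    obtain ⟨a, ha, rfl⟩ := hrep _ w hw
    rw [hform]
    obtain ⟨i, -, hi⟩ := Finset.exists_ne_zero_of_sum_ne_zero h0
    have hai : a i ≠ 0 := fun h => hi (by rw [h, zero_smul])
    have hmi : μ i < 0 := by
      by_contra h
      exact hai (ha i h)
    refine Finset.sum_neg' (fun j _ => ?_) ⟨i, Finset.mem_univ _, ?_⟩
    · by_cases hj : μ j < 0
      · exact mul_nonpos_of_nonneg_of_nonpos (by positivity) hj.le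
      · simp [ha j hj]
    · exact mul_neg_of_pos_of_neg (by positivity) hmi
  have hpos : Nat.card {i | 0 < μ i} ≤ negDim (quadForm (-B)) M := by
    rw [← hli]
    refine le_negDim (hspan _) fun w hw h0 => ?_
    obtain ⟨a, ha, rfl⟩ := hrep _ w hw
    rw [quadForm_neg, neg_lt_zero, hform]
    obtain ⟨i, -, hi⟩ := Finset.exists_ne_zero_of_sum_ne_zero h0
    have hai : a i ≠ 0 := fun h => hi (by rw [h, zero_smul])
    have hmi : 0 < μ i := by
      by_contra h
      exact hai (ha i h)
    refine Finset.sum_pos' (fun j _ => ?_) ⟨i, Finset.mem_univ _, ?_⟩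
    · by_cases hj : 0 < μ j
      · exact mul_nonneg (by positivity) hj.le
      · simp [ha j hj]
    · exact mul_pos (by positivity) hmi
  have hzero : Nat.card {i | μ i = 0} ≤ finrank ℂ (formRadical B M) := by
    rw [← hli]
    have : FiniteDimensional ℂ (formRadical B M) :=
      Submodule.finiteDimensional_of_le (inf_le_left : formRadical B M ≤ M)
    refine Submodule.finrank_mono (Submodule.span_le.2 ?_)
    rintro _ ⟨i, hi, rfl⟩
    refine mem_formRadical.2 ⟨hcM i, fun v hv => ?_⟩
    rw [hcB i v hv, show μ i = 0 from hi]
    simp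
  have hcard : finrank ℂ M = Nat.card {i | μ i < 0} + Nat.card {i | 0 < μ i}
      + Nat.card {i | μ i = 0} := by
    have hc : ∀ (P : Fin (finrank ℂ M) → Prop) [DecidablePred P],
        Nat.card {i | P i} = (Finset.univ.filter P).card := fun P _ => by
      rw [← Fintype.card_subtype, ← Nat.card_eq_fintype_card]
      rfl
    rw [hc fun i => μ i < 0, hc fun i => 0 < μ i, hc fun i => μ i = 0,
      ← Finset.card_union_of_disjoint, ← Finset.card_union_of_disjoint]
    · rw [← Finset.filter_or, ← Finset.filter_or, Finset.filter_true_of_mem, Finset.card_univ,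
        Fintype.card_fin]
      intro i _
      rcases lt_trichotomy (μ i) 0 with h | h | h <;> simp [h]
    · rw [← Finset.filter_or, Finset.disjoint_filter]
      intro i _ h h'
      rcases h with h | h <;> linarith
    · rw [Finset.disjoint_filter]
      intro i _ h h'
      linarith
  omega

theorem SymmOp.inertia {B : K →L[ℂ] K} (hB : SymmOp B) (M : Submodule ℂ K)
    [FiniteDimensional ℂ M] :
    negDim (quadForm B) M + negDim (quadForm (-B)) M + finrank ℂ (formRadical B M)
      = finrank ℂ M :=
  le_antisymm (hB.inertia_le M) (hB.inertia_ge M)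


theorem finrank_map_eq_of_forall {K' : Type*} [AddCommGroup K'] [Module ℂ K'] (f : K →ₗ[ℂ] K')
    (Y : Submodule ℂ K) (h : ∀ u ∈ Y, f u = 0 → u = 0) : finrank ℂ (Y.map f) = finrank ℂ Y := by
  rw [← LinearMap.range_domRestrict]
  refine LinearMap.finrank_range_of_inj ?_
  rw [← LinearMap.ker_eq_bot, LinearMap.ker_eq_bot']
  rintro ⟨u, hu⟩ h0
  exact Subtype.ext (h u hu h0)

/-- The orthogonal complement of `V` with respect to the form of `B`. -/
def formOrth (B : K →L[ℂ] K) (V : Submodule ℂ K) : Submodule ℂ K :=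
  Vᗮ.comap (B : K →ₗ[ℂ] K)

theorem mem_formOrth {B : K →L[ℂ] K} {V : Submodule ℂ K} {u : K} :
    u ∈ formOrth B V ↔ ∀ v ∈ V, ⟪v, B u⟫_ℂ = 0 := Iff.rfl

/-- `J` is a symmetric involution preserving `V`, and the form of `B` on `V` is bounded below by
`δ > 0` on the part of `V` where `J = 1`, bounded above by `-δ` where `J = -1`. -/
structure Coercive (B J : K →L[ℂ] K) (V : Submodule ℂ K) (δ : ℝ) : Prop where
  pos : 0 < δ
  sq : ∀ u, J (J u) = u
  symm : SymmOp J
  map_mem : ∀ v ∈ V, J v ∈ V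
  le : ∀ w ∈ V, δ * ‖w‖ ^ 2 ≤ (⟪J w, B w⟫_ℂ).re

/-- The index of `B` relative to `V`: the negative index of the form of `B` on the complement
of `V` that is orthogonal to `V` for this form. -/
def relIndex (B : K →L[ℂ] K) (V : Submodule ℂ K) : ℕ := negDim (quadForm B) (formOrth B V)

variable {B B' J : K →L[ℂ] K} {V V' : Submodule ℂ K} {δ : ℝ}

theorem Coercive.neg (h : Coercive B J V δ) : Coercive (-B) (-J) V δ where
  pos := h.pos
  sq u := by simp [h.sq]
  symm := h.symm.neg
  map_mem v hv := by simpa using h.map_mem v hv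
  le w hw := by simpa using h.le w hw

theorem formOrth_neg : formOrth (-B) V = formOrth B V := by
  ext u; simp [mem_formOrth]

theorem formOrth_anti (h : V' ≤ V) : formOrth B V ≤ formOrth B V' := fun _ hu =>
  mem_formOrth.2 fun v hv => mem_formOrth.1 hu v (h hv)

theorem Coercive.mono (h : Coercive B J V δ) (hV : V' ≤ V) (hJ : ∀ v ∈ V', J v ∈ V') :
    Coercive B J V' δ :=
  ⟨h.pos, h.sq, h.symm, hJ, fun w hw => h.le w (hV hw)⟩

theorem Coercive.eq_zero (h : Coercive B J V δ) {u : K} (hu : u ∈ V) (hu' : u ∈ formOrth B V) :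
    u = 0 := by
  have h1 := h.le u hu
  rw [mem_formOrth.1 hu' _ (h.map_mem u hu), Complex.zero_re] at h1
  have h2 : ‖u‖ ^ 2 ≤ 0 := by
    by_contra hc
    push Not at hc
    exact absurd (mul_pos h.pos hc) (not_lt.2 h1)
  exact norm_eq_zero.1 (pow_eq_zero_iff two_ne_zero |>.1 (le_antisymm h2 (sq_nonneg _)))

variable [V.HasOrthogonalProjection]

/-- The compression of `J B` to `V`, continued by the identity. -/
def coreOp (V : Submodule ℂ K) [V.HasOrthogonalProjection] (J B : K →L[ℂ] K) : K →L[ℂ] K :=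
  J * V.starProjection * B * V.starProjection + (1 - V.starProjection)

/-- The projection along `V` onto the complement of `V` that is orthogonal to `V` for the form
of `B`. -/
def liftOp (V : Submodule ℂ K) [V.HasOrthogonalProjection] (J B : K →L[ℂ] K) : K →L[ℂ] K :=
  1 - Ring.inverse (coreOp V J B) * (J * V.starProjection * B)

theorem lift_of_mem {u : K} (hu : u ∈ formOrth B V) : liftOp V J B u = u := by
  have : V.starProjection (B u) = 0 := (Submodule.starProjection_apply_eq_zero_iff V).2 hu
  simp [liftOp, this]

theorem ker_le_formOrth (B : K →L[ℂ] K) (V : Submodule ℂ K) :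
    LinearMap.ker (B : K →ₗ[ℂ] K) ≤ formOrth B V := fun u hu => by
  rw [mem_formOrth]
  intro v _
  rw [show B u = 0 from hu, inner_zero_right]

variable [CompleteSpace K]

theorem Coercive.isUnit_coreOp (h : Coercive B J V δ) : IsUnit (coreOp V J B) := by
  have hc : 0 < min δ 1 := lt_min h.pos one_pos
  refine ContinuousLinearMap.isUnit_of_forall_le_norm_inner_map _ (c := ⟨min δ 1, hc.le⟩) hc
    fun x => ?_
  refine le_trans ?_ (Complex.re_le_norm _)
  set v := V.starProjection x with hv
  have hvV : v ∈ V := V.starProjection_apply_mem x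
  have hw : x - v ∈ Vᗮ := V.sub_starProjection_mem_orthogonal x
  have e1 : coreOp V J B x = J (V.starProjection (B v)) + (x - v) := by
    simp [coreOp, hv]
  have e2 : ⟪J (V.starProjection (B v)), x⟫_ℂ = ⟪B v, J v⟫_ℂ := by
    have h1 : ⟪J (V.starProjection (B v)), x - v⟫_ℂ = 0 :=
      hw _ (h.map_mem _ (V.starProjection_apply_mem _))
    have h2 : ⟪J (V.starProjection (B v)), x⟫_ℂ = ⟪J (V.starProjection (B v)), v⟫_ℂ := by
      rw [← sub_eq_zero, ← inner_sub_right, h1]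
    have h3 : ⟪B v - V.starProjection (B v), J v⟫_ℂ = 0 := by
      rw [← inner_conj_symm, V.sub_starProjection_mem_orthogonal (B v) _ (h.map_mem v hvV), map_zero]
    rw [h2, h.symm]
    rw [inner_sub_left, sub_eq_zero] at h3
    exact h3.symm
  have e3 : ⟪x - v, x⟫_ℂ = ⟪x - v, x - v⟫_ℂ := by
    have : ⟪x - v, v⟫_ℂ = 0 := by
      rw [← inner_conj_symm, hw v hvV, map_zero]
    rw [inner_sub_right (x - v) x v, this, sub_zero]
  have e4 : ‖x‖ ^ 2 = ‖v‖ ^ 2 + ‖x - v‖ ^ 2 := by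
    have := norm_add_sq_eq_norm_sq_add_norm_sq_of_inner_eq_zero v (x - v) (hw v hvV)
    rw [add_sub_cancel] at this
    rw [pow_two, pow_two, pow_two]
    exact this
  have h5 := h.le v hvV
  rw [e1, inner_add_left, e2, e3, Complex.add_re, e4]
  have h6 : (⟪x - v, x - v⟫_ℂ).re = ‖x - v‖ ^ 2 := by
    rw [inner_self_eq_norm_sq_to_K]
    norm_cast
  rw [h6, ← inner_conj_symm, Complex.conj_re]
  change (_ + _) * min δ 1 ≤ _
  nlinarith [min_le_left δ 1, min_le_right δ 1, sq_nonneg ‖v‖, sq_nonneg ‖x - v‖]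

theorem Coercive.lift_aux (h : Coercive B J V δ) (u : K) :
    u - liftOp V J B u ∈ V ∧
      V.starProjection (B (u - liftOp V J B u)) = V.starProjection (B u) := by
  set x := J (V.starProjection (B u)) with hx
  have hxV : x ∈ V := h.map_mem _ (V.starProjection_apply_mem _)
  set y := u - liftOp V J B u with hy
  have hyx : coreOp V J B y = x := by
    have : y = Ring.inverse (coreOp V J B) x := by simp [hy, liftOp, hx]
    rw [this, ← mul_apply_eq_comp, Ring.mul_inverse_cancel _ h.isUnit_coreOp,
      one_apply_eq_self]
  have hy1 : J (V.starProjection (B (V.starProjection y))) + (y - V.starProjection y) = x := by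
    rw [← hyx]; simp [coreOp]
  have hy2 : y - V.starProjection y = 0 := by
    have hV : y - V.starProjection y ∈ V := by
      rw [← eq_sub_iff_add_eq'] at hy1
      rw [hy1]
      exact V.sub_mem hxV (h.map_mem _ (V.starProjection_apply_mem _))
    have := V.sub_starProjection_mem_orthogonal y _ hV
    exact inner_self_eq_zero.1 this
  have hy3 : V.starProjection y = y := (sub_eq_zero.1 hy2).symm
  refine ⟨hy3 ▸ V.starProjection_apply_mem y, ?_⟩
  rw [hy2, add_zero, hy3, hx] at hy1
  have := congrArg J hy1
  rwa [h.sq, h.sq] at this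

theorem Coercive.sub_lift_mem (h : Coercive B J V δ) (u : K) : u - liftOp V J B u ∈ V :=
  (h.lift_aux u).1

theorem Coercive.lift_mem (h : Coercive B J V δ) (u : K) : liftOp V J B u ∈ formOrth B V := by
  have h1 := (h.lift_aux u).2
  rw [map_sub, map_sub, sub_eq_self] at h1
  exact (Submodule.starProjection_apply_eq_zero_iff V).1 h1

theorem Coercive.continuousAt_liftOp (h : Coercive B J V δ) : ContinuousAt (liftOp V J) B := by
  have h1 : ContinuousAt (coreOp V J) B := by unfold coreOp; fun_prop
  have h2 : ContinuousAt (fun X => Ring.inverse (coreOp V J X)) B := by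
    obtain ⟨x, hx⟩ := h.isUnit_coreOp
    exact ContinuousAt.comp (g := Ring.inverse) (hx ▸ NormedRing.inverse_continuousAt x) h1
  unfold liftOp
  fun_prop

/-- Any two complements of `V` are isomorphic. -/
theorem Coercive.nonempty_equiv (h : Coercive B J V δ) : Nonempty (formOrth B V ≃ₗ[ℂ] Vᗮ) := by
  let f : formOrth B V →ₗ[ℂ] Vᗮ :=
    (Vᗮ.orthogonalProjectionOnto : K →ₗ[ℂ] Vᗮ) ∘ₗ (formOrth B V).subtype
  have hf : ∀ u, ((f u : Vᗮ) : K) = u - V.starProjection u := fun u => by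
    simp [f, Submodule.starProjection_orthogonal]
  refine ⟨LinearEquiv.ofBijective f ⟨?_, ?_⟩⟩
  · rw [← LinearMap.ker_eq_bot, LinearMap.ker_eq_bot']
    intro u hu
    have h1 := hf u
    rw [hu] at h1
    have h2 : V.starProjection (u : K) = u := (sub_eq_zero.1 h1.symm).symm
    exact Subtype.ext (h.eq_zero (h2 ▸ V.starProjection_apply_mem _) u.2)
  · intro w
    refine ⟨⟨liftOp V J B w, h.lift_mem w⟩, Subtype.ext ?_⟩
    rw [hf]
    have h1 : V.starProjection (w : K) = 0 :=
      (Submodule.starProjection_apply_eq_zero_iff V).2 w.2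
    have h2 : V.starProjection ((w : K) - liftOp V J B w) = (w : K) - liftOp V J B w :=
      Submodule.starProjection_eq_self_iff.2 (h.sub_lift_mem w)
    rw [map_sub, h1, zero_sub] at h2
    change liftOp V J B w - V.starProjection (liftOp V J B w) = w
    rw [sub_eq_add_neg, h2]
    abel

theorem Coercive.finiteDimensional [FiniteDimensional ℂ Vᗮ] (h : Coercive B J V δ) :
    FiniteDimensional ℂ (formOrth B V) := by
  obtain ⟨e⟩ := h.nonempty_equiv
  exact Module.Finite.equiv e.symm

theorem Coercive.finrank_formOrth (h : Coercive B J V δ) :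
    finrank ℂ (formOrth B V) = finrank ℂ Vᗮ := by
  obtain ⟨e⟩ := h.nonempty_equiv
  exact e.finrank_eq

theorem Coercive.formRadical_eq (h : Coercive B J V δ) :
    formRadical B (formOrth B V) = LinearMap.ker (B : K →ₗ[ℂ] K) := by
  refine le_antisymm (fun u hu => ?_) fun u hu => mem_formRadical.2
    ⟨ker_le_formOrth B V hu, fun v _ => by rw [show B u = 0 from hu, inner_zero_right]⟩
  obtain ⟨hu1, hu2⟩ := mem_formRadical.1 hu
  refine (inner_self_eq_zero (𝕜 := ℂ)).1 ?_
  change ⟪B u, B u⟫_ℂ = 0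
  have h1 := mem_formOrth.1 hu1 _ (h.sub_lift_mem (B u))
  have h2 := hu2 _ (h.lift_mem (B u))
  rw [inner_sub_left, h2, sub_zero] at h1
  exact h1

theorem Coercive.inertia [FiniteDimensional ℂ Vᗮ] (h : Coercive B J V δ) (hB : SymmOp B) :
    relIndex B V + relIndex (-B) V + finrank ℂ (LinearMap.ker (B : K →ₗ[ℂ] K))
      = finrank ℂ Vᗮ := by
  have := h.finiteDimensional
  rw [← h.finrank_formOrth, ← hB.inertia (formOrth B V), h.formRadical_eq]
  simp only [relIndex, formOrth_neg]

/-- An operator that is coercive on a subspace of finite codimension is invertible as soon as it is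
injective. -/
theorem Coercive.isUnit [FiniteDimensional ℂ Vᗮ] (h : Coercive B J V δ)
    (hker : LinearMap.ker (B : K →ₗ[ℂ] K) = ⊥) : IsUnit B := by
  rw [ContinuousLinearMap.isUnit_iff_bijective]
  refine ⟨LinearMap.ker_eq_bot.1 hker, fun y => ?_⟩
  have := h.finiteDimensional
  let f : formOrth B V →ₗ[ℂ] Vᗮ :=
    ((B : K →ₗ[ℂ] K) ∘ₗ (formOrth B V).subtype).codRestrict Vᗮ fun u => u.2
  have hf : Function.Surjective f := by
    rw [← LinearMap.injective_iff_surjective_of_finrank_eq_finrank h.finrank_formOrth]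
    intro u v huv
    exact Subtype.ext (LinearMap.ker_eq_bot.1 hker (congrArg Subtype.val huv))
  obtain ⟨x, hx⟩ : ∃ x ∈ V, y - B x ∈ Vᗮ := by
    let v := J (V.starProjection y)
    have hv : V.starProjection v = v :=
      Submodule.starProjection_eq_self_iff.2 (h.map_mem _ (V.starProjection_apply_mem y))
    obtain ⟨x, hx⟩ := ((ContinuousLinearMap.isUnit_iff_bijective).1 h.isUnit_coreOp).2 v
    have hx1 : J (V.starProjection (B (V.starProjection x))) + (x - V.starProjection x) = v := by
      rw [← hx]; simp [coreOp]
    have hx2 : x - V.starProjection x = 0 := by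
      have hV : x - V.starProjection x ∈ V := by
        rw [← eq_sub_iff_add_eq'] at hx1
        rw [hx1]
        exact V.sub_mem (hv ▸ V.starProjection_apply_mem v)
          (h.map_mem _ (V.starProjection_apply_mem _))
      exact inner_self_eq_zero.1 (V.sub_starProjection_mem_orthogonal x _ hV)
    have hx3 : V.starProjection x = x := (sub_eq_zero.1 hx2).symm
    refine ⟨x, hx3 ▸ V.starProjection_apply_mem x, ?_⟩
    rw [← Submodule.starProjection_apply_eq_zero_iff, map_sub]
    rw [hx2, add_zero, hx3] at hx1
    have := congrArg J hx1
    simp only [v, h.sq] at this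
    rw [this, sub_self]
  obtain ⟨u, hu⟩ := hf ⟨y - B x, hx.2⟩
  refine ⟨x + u, ?_⟩
  have h1 : B u = y - B x := congrArg Subtype.val hu
  rw [map_add, h1, add_sub_cancel]

theorem Coercive.eventually_relIndex_ge [FiniteDimensional ℂ Vᗮ] (h : Coercive B J V δ) :
    ∀ᶠ X in 𝓝 B, Coercive X J V δ → relIndex B V ≤ relIndex X V := by
  have := h.finiteDimensional
  obtain ⟨Z, hZ, hd, hneg⟩ := exists_negDim (quadForm B) (formOrth B V)
  have hZf : FiniteDimensional ℂ Z := Submodule.finiteDimensional_of_le hZ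
  let S : Set K := Z.subtype '' Metric.sphere (0 : Z) 1
  have hS : IsCompact S := (isCompact_sphere (0 : Z) 1).image (by fun_prop)
  have hev : ∀ u ∈ S, ∀ᶠ x : (K →L[ℂ] K) × K in 𝓝 (B, u),
      quadForm x.1 (liftOp V J x.1 x.2) < 0 := by
    rintro _ ⟨u, hu, rfl⟩
    have hc : ContinuousAt (fun x : (K →L[ℂ] K) × K => quadForm x.1 (liftOp V J x.1 x.2))
        (B, (u : K)) := by
      have h1 : ContinuousAt (fun x : (K →L[ℂ] K) × K => liftOp V J x.1) (B, (u : K)) :=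
        ContinuousAt.comp (g := liftOp V J) h.continuousAt_liftOp continuousAt_fst
      have h2 : ContinuousAt (fun x : (K →L[ℂ] K) × K => liftOp V J x.1 x.2) (B, (u : K)) :=
        h1.clm_apply continuousAt_snd
      exact ContinuousAt.comp (g := fun x : (K →L[ℂ] K) × K => quadForm x.1 x.2)
        continuous_quadForm.continuousAt (continuousAt_fst.prodMk h2)
    refine hc.eventually_lt (g := fun _ => (0 : ℝ)) continuousAt_const ?_
    change quadForm B (liftOp V J B u) < 0
    rw [lift_of_mem (hZ u.2)]
    refine hneg _ u.2 fun h0 => ?_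
    have : ‖u‖ = 1 := by simpa using hu
    rw [show u = 0 from Subtype.ext h0, norm_zero] at this
    exact zero_ne_one this
  filter_upwards [hS.eventually_forall_of_forall_eventually
    (P := fun X u => quadForm X (liftOp V J X u) < 0) hev] with X hX hXc
  have := hXc.finiteDimensional
  have hall : ∀ u ∈ Z, u ≠ 0 → quadForm X (liftOp V J X u) < 0 := by
    intro u hu h0
    have hn : ‖u‖ ≠ 0 := norm_ne_zero_iff.2 h0
    have h1 := hX (((‖u‖⁻¹ : ℝ) : ℂ) • u) ⟨⟨((‖u‖⁻¹ : ℝ) : ℂ) • u, Z.smul_mem _ hu⟩, by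
      rw [mem_sphere_zero_iff_norm, Submodule.coe_norm, norm_smul, Complex.norm_real, norm_inv,
        norm_norm, inv_mul_cancel₀ hn], rfl⟩
    rw [map_smul, quadForm_smul] at h1
    by_contra hc
    exact absurd h1 (not_lt.2 (mul_nonneg (sq_nonneg _) (not_lt.1 hc)))
  unfold relIndex
  rw [← hd, ← finrank_map_eq_of_forall (liftOp V J X : K →ₗ[ℂ] K) Z]
  · refine le_negDim ?_ ?_
    · rintro _ ⟨u, -, rfl⟩
      exact hXc.lift_mem u
    · rintro _ ⟨u, hu, rfl⟩ h0
      exact hall u hu fun hu0 => h0 (by rw [hu0, map_zero])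
  · intro u hu h0
    by_contra hu0
    have := hall u hu hu0
    rw [show liftOp V J X u = 0 from h0] at this
    simp [quadForm] at this

theorem Coercive.eventually_relIndex_le [FiniteDimensional ℂ Vᗮ] (h : Coercive B J V δ)
    (hB : SymmOp B) : ∀ᶠ X in 𝓝 B, Coercive X J V δ → SymmOp X →
      relIndex X V ≤ relIndex B V + finrank ℂ (LinearMap.ker (B : K →ₗ[ℂ] K)) := by
  have h1 := h.neg.eventually_relIndex_ge
  have h2 : Tendsto (fun X : K →L[ℂ] K => -X) (𝓝 B) (𝓝 (-B)) := continuous_neg.tendsto B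
  filter_upwards [h2.eventually h1] with X hX hXc hXs
  have h3 := hX hXc.neg
  have h4 := h.inertia hB
  have h5 := hXc.inertia hXs
  omega

theorem relIndex_eq_of_injective [FiniteDimensional ℂ Vᗮ] {a b : ℝ} {X : ℝ → K →L[ℂ] K}
    (hab : a ≤ b) (hc : ContinuousOn X (Icc a b)) (hX : ∀ t ∈ Icc a b, Coercive (X t) J V δ)
    (hs : ∀ t ∈ Icc a b, SymmOp (X t))
    (hi : ∀ t ∈ Icc a b, LinearMap.ker (X t : K →ₗ[ℂ] K) = ⊥) :
    relIndex (X a) V = relIndex (X b) V := by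
  refine isPreconnected_Icc.constant (f := fun t => relIndex (X t) V) (fun t ht => ?_)
    (left_mem_Icc.2 hab) (right_mem_Icc.2 hab)
  refine tendsto_nhds_of_eventually_eq ?_
  filter_upwards [(hc t ht).eventually (hX t ht).eventually_relIndex_ge,
    (hc t ht).eventually ((hX t ht).eventually_relIndex_le (hs t ht)),
    self_mem_nhdsWithin] with u h1 h2 hu
  have h3 := h1 (hX u hu)
  have h4 := h2 (hX u hu) (hs u hu)
  rw [hi t ht, finrank_bot] at h4
  omega

theorem Coercive.relIndex_add_ker_le [FiniteDimensional ℂ Vᗮ] (h : Coercive B J V δ)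
    (h' : Coercive B' J V δ) (hB : SymmOp B) (hB' : SymmOp B')
    (hle : ∀ u, quadForm B' u ≤ quadForm B u) (hlt : ∀ u, B u = 0 → u ≠ 0 → quadForm B' u < 0) :
    relIndex B V + finrank ℂ (LinearMap.ker (B : K →ₗ[ℂ] K)) ≤ relIndex B' V := by
  have := h.finiteDimensional
  have := h'.finiteDimensional
  obtain ⟨Z, hZ, hd, hneg⟩ := exists_negDim (quadForm B) (formOrth B V)
  set N := LinearMap.ker (B : K →ₗ[ℂ] K) with hN
  have hq : ∀ z, ∀ r ∈ N, quadForm B (z + r) = quadForm B z := by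
    intro z r hr
    have hr0 : B r = 0 := hr
    rw [add_comm, hB.quadForm_add]
    simp [quadForm, hr0]
  have hall : ∀ u ∈ Z ⊔ N, u ≠ 0 → quadForm B' (liftOp V J B' u) < 0 := by
    intro u hu h0
    set d := liftOp V J B' u - u with hd
    have hdV : d ∈ V := by
      rw [hd, ← neg_sub]; exact V.neg_mem (h'.sub_lift_mem u)
    set dp := (2⁻¹ : ℂ) • (d + J d) with hdp
    set dm := (2⁻¹ : ℂ) • (d - J d) with hdm
    have hdpV : dp ∈ V := V.smul_mem _ (V.add_mem hdV (h.map_mem d hdV))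
    have hdmV : dm ∈ V := V.smul_mem _ (V.sub_mem hdV (h.map_mem d hdV))
    have hsum : d = dp + dm := by
      rw [hdp, hdm, ← smul_add, add_add_sub_cancel, ← two_smul ℂ d, smul_smul]
      simp
    have hJp : J dp = dp := by
      rw [hdp, map_smul, map_add, h.sq, add_comm]
    have hJm : J dm = -dm := by
      rw [hdm, map_smul, map_sub, h.sq, ← smul_neg, neg_sub]
    have huV : u ∈ formOrth B V := sup_le hZ (ker_le_formOrth B V) hu
    have h1 : quadForm B (u + dm) = quadForm B u + quadForm B dm := by
      rw [hB.quadForm_add, mem_formOrth.1 huV _ hdmV]; simp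
    have h2 : quadForm B dm ≤ -(δ * ‖dm‖ ^ 2) := by
      have := h.le dm hdmV
      rw [hJm, inner_neg_left, Complex.neg_re] at this
      unfold quadForm
      linarith
    have h3 : quadForm B' (u + dm) = quadForm B' (liftOp V J B' u) + quadForm B' dp := by
      have e : u + dm = liftOp V J B' u + -dp := by
        have : liftOp V J B' u = u + (dp + dm) := by rw [← hsum, hd]; abel
        rw [this]; abel
      rw [e, hB'.quadForm_add, inner_neg_left, mem_formOrth.1 (h'.lift_mem u) _ hdpV]
      simp [quadForm]
    have h4 : 0 ≤ quadForm B' dp := by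
      have := h'.le dp hdpV
      rw [hJp] at this
      exact (mul_nonneg h.pos.le (sq_nonneg _)).trans this
    have h5 := hle (u + dm)
    obtain ⟨z, hz, r, hr, rfl⟩ := Submodule.mem_sup.1 hu
    have h6 := hq z r hr
    have h7 : 0 ≤ δ * ‖dm‖ ^ 2 := mul_nonneg h.pos.le (sq_nonneg _)
    by_cases hz0 : z = 0
    · by_cases hm0 : dm = 0
      · have h8 := hlt (z + r) (by rw [hz0, zero_add]; exact hr) h0
        rw [hm0, add_zero] at h3
        linarith
      · have h9 : 0 < δ * ‖dm‖ ^ 2 := mul_pos h.pos (by positivity)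
        have h10 : quadForm B z = 0 := by simp [hz0, quadForm]
        linarith
    · have := hneg z hz hz0
      linarith
  have hdisj := finrank_add_le_of_disjoint hZ (ker_le_formOrth B V) fun u hu hu' => by
    by_contra h0
    have h1 := hneg u hu h0
    simp [quadForm, show B u = 0 from hu'] at h1
  unfold relIndex
  rw [← hd, hdisj, ← finrank_map_eq_of_forall (liftOp V J B' : K →ₗ[ℂ] K) (Z ⊔ N)]
  · refine le_negDim ?_ ?_
    · rintro _ ⟨u, -, rfl⟩
      exact h'.lift_mem u
    · rintro _ ⟨u, hu, rfl⟩ h0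
      exact hall u hu fun hu0 => h0 (by rw [hu0, map_zero])
  · intro u hu h0
    by_contra hu0
    have := hall u hu hu0
    rw [show liftOp V J B' u = 0 from h0] at this
    simp [quadForm] at this

theorem Coercive.relIndex_add_le [V'.HasOrthogonalProjection] [FiniteDimensional ℂ Vᗮ]
    [FiniteDimensional ℂ V'ᗮ] (h : Coercive B J V δ) (hB : SymmOp B) (hV : V' ≤ V)
    (hJ : ∀ v ∈ V', J v ∈ V') {F : Submodule ℂ K} (hFV : F ≤ V) (hF : F ≤ V'ᗮ)
    (hJF : ∀ f ∈ F, J f = -f) : relIndex B V + finrank ℂ F ≤ relIndex B V' := by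
  have h' := h.mono hV hJ
  have := h.finiteDimensional
  have := h'.finiteDimensional
  obtain ⟨Z, hZ, hd, hneg⟩ := exists_negDim (quadForm B) (formOrth B V)
  have hLV : ∀ f ∈ F, liftOp V' J B f ∈ V := fun f hf => by
    have := V.sub_mem (hFV hf) (hV (h'.sub_lift_mem f))
    rwa [sub_sub_cancel] at this
  have hL0 : ∀ f ∈ F, liftOp V' J B f = 0 → f = 0 := fun f hf h0 => by
    have := h'.sub_lift_mem f
    rw [h0, sub_zero] at this
    exact inner_self_eq_zero.1 (hF hf f this)
  have hq : ∀ f ∈ F, f ≠ 0 → quadForm B (liftOp V' J B f) < 0 := by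
    intro f hf h0
    set z := liftOp V' J B f with hz
    have hz0 : z ≠ 0 := fun h1 => h0 (hL0 f hf h1)
    have h1 := h.le z (hLV f hf)
    have hzf : z = f - (f - z) := by abel
    have hv : f - z ∈ V' := h'.sub_lift_mem f
    have h2 : ⟪J z, B z⟫_ℂ = -⟪f, B z⟫_ℂ := by
      conv_lhs => rw [hzf, map_sub, hJF f hf, inner_sub_left]
      rw [sub_sub_cancel, inner_neg_left,
        mem_formOrth.1 (h'.lift_mem f) _ (hJ _ hv), sub_zero]
    have h3 : ⟪z, B z⟫_ℂ = ⟪f, B z⟫_ℂ := by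
      conv_lhs => rw [hzf, inner_sub_left]
      rw [sub_sub_cancel, mem_formOrth.1 (h'.lift_mem f) _ hv, sub_zero]
    have h4 : 0 < δ * ‖z‖ ^ 2 := mul_pos h.pos (by positivity)
    unfold quadForm
    rw [h3]
    rw [h2, Complex.neg_re] at h1
    linarith
  let Y := F.map (liftOp V' J B : K →ₗ[ℂ] K)
  have hYV : Y ≤ V := by rintro _ ⟨f, hf, rfl⟩; exact hLV f hf
  have hYO : Y ≤ formOrth B V' := by rintro _ ⟨f, hf, rfl⟩; exact h'.lift_mem f
  have hZO : Z ≤ formOrth B V' := hZ.trans (formOrth_anti hV)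
  have hdisj := finrank_add_le_of_disjoint hZO hYO fun u hu hu' => h.eq_zero (hYV hu') (hZ hu)
  unfold relIndex
  rw [← hd, ← finrank_map_eq_of_forall (liftOp V' J B : K →ₗ[ℂ] K) F hL0, hdisj]
  refine le_negDim (sup_le hZO hYO) fun w hw h0 => ?_
  obtain ⟨z, hz, y, hy, rfl⟩ := Submodule.mem_sup.1 hw
  rw [hB.quadForm_add, mem_formOrth.1 (hZ hz) y (hYV hy)]
  obtain ⟨f, hf, rfl⟩ := hy
  by_cases hf0 : f = 0
  · have hz0 : z ≠ 0 := fun h1 => h0 (by rw [h1, hf0, map_zero, add_zero])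
    have := hneg z hz hz0
    simpa [hf0, quadForm] using this
  · have h1 : quadForm B (liftOp V' J B f) < 0 := hq f hf hf0
    have h2 : quadForm B z ≤ 0 := by
      by_cases hz0 : z = 0
      · simp [hz0, quadForm]
      · exact (hneg z hz hz0).le
    simp only [Complex.zero_re, mul_zero, add_zero]
    exact add_neg_of_nonpos_of_neg h2 h1

/-- Additivity of the index (Haynsworth). -/
theorem Coercive.relIndex_eq_add [V'.HasOrthogonalProjection] [FiniteDimensional ℂ Vᗮ]
    [FiniteDimensional ℂ V'ᗮ] (h : Coercive B J V δ) (hB : SymmOp B) (hV : V' ≤ V)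
    (hJ : ∀ v ∈ V', J v ∈ V') {Fm Fp : Submodule ℂ K} (hmV : Fm ≤ V) (hm : Fm ≤ V'ᗮ)
    (hJm : ∀ f ∈ Fm, J f = -f) (hpV : Fp ≤ V) (hp : Fp ≤ V'ᗮ) (hJp : ∀ f ∈ Fp, J f = f)
    (hdim : finrank ℂ V'ᗮ = finrank ℂ Vᗮ + finrank ℂ Fm + finrank ℂ Fp) :
    relIndex B V' = relIndex B V + finrank ℂ Fm := by
  have h1 := h.relIndex_add_le hB hV hJ hmV hm hJm
  have h2 := h.neg.relIndex_add_le hB.neg hV (fun v hv => by simpa using hJ v hv) hpV hp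
    fun f hf => by simp [hJp f hf]
  have h3 := h.inertia hB
  have h4 := (h.mono hV hJ).inertia hB
  omega

/-- How the index of a decreasing family changes near a given parameter. -/
theorem eventually_relIndex_eq [FiniteDimensional ℂ Vᗮ] {R : ℝ} {X : ℝ → K →L[ℂ] K}
    (hc : Continuous X) (hX : ∀ t, |t| < R → Coercive (X t) J V δ) (hs : ∀ t, SymmOp (X t))
    (hle : ∀ t t', t ≤ t' → ∀ u, quadForm (X t') u ≤ quadForm (X t) u)
    (hlt : ∀ t t', t < t' → ∀ u, X t u = 0 → u ≠ 0 → quadForm (X t') u < 0)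
    {t : ℝ} (ht : |t| < R) :
    ∀ᶠ t' in 𝓝 t,
      (t < t' → relIndex (X t') V
        = relIndex (X t) V + finrank ℂ (LinearMap.ker (X t : K →ₗ[ℂ] K))) ∧
      (t' < t → relIndex (X t') V = relIndex (X t) V) ∧
      (t' ≠ t → LinearMap.ker (X t' : K →ₗ[ℂ] K) = ⊥) := by
  have hmono : ∀ t t', |t| < R → |t'| < R → t < t' →
      relIndex (X t) V + finrank ℂ (LinearMap.ker (X t : K →ₗ[ℂ] K)) ≤ relIndex (X t') V :=
    fun t t' h h' hlt' => (hX t h).relIndex_add_ker_le (hX t' h') (hs t) (hs t')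
      (hle t t' hlt'.le) (hlt t t' hlt')
  have hfin : ∀ t, |t| < R → FiniteDimensional ℂ (LinearMap.ker (X t : K →ₗ[ℂ] K)) := fun t h => by
    have := (hX t h).finiteDimensional
    exact Submodule.finiteDimensional_of_le (ker_le_formOrth (X t) V)
  have hev : ∀ᶠ t' in 𝓝 t, |t'| < R ∧ relIndex (X t) V ≤ relIndex (X t') V ∧ relIndex (X t') V
      ≤ relIndex (X t) V + finrank ℂ (LinearMap.ker (X t : K →ₗ[ℂ] K)) := by
    have h0 : ∀ᶠ t' in 𝓝 t, |t'| < R := continuous_abs.continuousAt.eventually_lt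
      continuousAt_const ht
    filter_upwards [h0, (hc.tendsto t).eventually (hX t ht).eventually_relIndex_ge,
      (hc.tendsto t).eventually ((hX t ht).eventually_relIndex_le (hs t))] with t' h1 h2 h3
    exact ⟨h1, h2 (hX t' h1), h3 (hX t' h1) (hs t')⟩
  obtain ⟨ε, hε, hball⟩ := Metric.eventually_nhds_iff_ball.1 hev
  refine Metric.eventually_nhds_iff_ball.2 ⟨ε, hε, fun t' ht' => ?_⟩
  obtain ⟨h1, h2, h3⟩ := hball t' ht'
  refine ⟨fun hl => ?_, fun hl => ?_, fun hne => ?_⟩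
  · have := hmono t t' ht h1 hl
    omega
  · have := hmono t' t h1 ht hl
    omega
  · have := hfin t' h1
    rw [← Submodule.finrank_eq_zero]
    rcases lt_or_gt_of_ne hne with hl | hl
    · have := hmono t' t h1 ht hl
      omega
    · have hlt'' : |t' - t| < ε := by simpa [Real.dist_eq] using ht'
      rw [abs_of_pos (sub_pos.2 hl)] at hlt''
      obtain ⟨t'', h4, h5⟩ := exists_between hlt''
      have hmem : t'' + t ∈ Metric.ball t ε := by
        rw [Metric.mem_ball, Real.dist_eq, add_sub_cancel_right, abs_of_pos]
        · exact h5
        · linarith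
      obtain ⟨h6, h7, h8⟩ := hball _ hmem
      have := hmono t' (t'' + t) h1 h6 (by linarith)
      have := hmono t t' ht h1 hl
      omega

end Inertia

section Lattice

open Module Topology Filter
open scoped InnerProductSpace

variable {ι : Type*} {E : Type*} [NormedAddCommGroup E] [InnerProductSpace ℂ E]

theorem memℓp_two_iff {ι E : Type*} [NormedAddCommGroup E] {f : ι → E} : Memℓp f 2 ↔ Summable fun i => ‖f i‖ ^ 2 := by
  rw [memℓp_gen_iff (by norm_num)]
  simp

theorem hasSum_norm_sq {ι E : Type*} [NormedAddCommGroup E] (f : lp (fun _ : ι => E) 2) : HasSum (fun i => ‖f i‖ ^ 2) (‖f‖ ^ 2) := by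
  have := lp.hasSum_norm (p := 2) (by norm_num) f
  simpa using this

theorem norm_le_mul_of_le {ι E ι' E' : Type*} [NormedAddCommGroup E] [NormedAddCommGroup E']
    (f : lp (fun _ : ι => E) 2) (g : lp (fun _ : ι' => E') 2)
    {e : ι → ι'} (he : Function.Injective e) {C : ℝ} (hC : 0 ≤ C)
    (h : ∀ i, ‖f i‖ ≤ C * ‖g (e i)‖) : ‖f‖ ≤ C * ‖g‖ := by
  refine le_of_sq_le_sq ?_ (by positivity)
  rw [mul_pow]
  have h1 : Summable fun i => ‖g (e i)‖ ^ 2 := (hasSum_norm_sq g).summable.comp_injective he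
  rw [← (hasSum_norm_sq f).tsum_eq, ← (hasSum_norm_sq g).tsum_eq, ← tsum_mul_left]
  calc ∑' i, ‖f i‖ ^ 2 ≤ ∑' i, C ^ 2 * ‖g (e i)‖ ^ 2 := by
        refine (hasSum_norm_sq f).summable.tsum_le_tsum (fun i => ?_) (h1.mul_left _)
        rw [← mul_pow]
        exact pow_le_pow_left₀ (norm_nonneg _) (h i) 2
    _ ≤ _ := (h1.mul_left (C ^ 2)).tsum_le_tsum_of_inj e he (fun _ _ => by positivity)
        (fun _ => le_rfl) ((hasSum_norm_sq g).summable.mul_left _)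

/-- The operator that acts on the fiber over `i` by `D i`, for a bounded family `D`. -/
def diagOp (D : ι → E →L[ℂ] E) : lp (fun _ : ι => E) 2 →L[ℂ] lp (fun _ : ι => E) 2 :=
  open Classical in
  if h : ∃ C, ∀ i, ‖D i‖ ≤ C then
    LinearMap.mkContinuousOfExistsBound
      { toFun := fun f => ⟨fun i => D i (f i), by
          obtain ⟨C, hC⟩ := h
          refine memℓp_two_iff.2 (Summable.of_nonneg_of_le (fun _ => by positivity) (fun i => ?_)
            ((hasSum_norm_sq f).summable.mul_left (C ^ 2)))
          rw [← mul_pow]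
          exact pow_le_pow_left₀ (norm_nonneg _) ((D i).le_of_opNorm_le (hC i) _) 2⟩
        map_add' := fun f g => by ext1; funext i; exact map_add (D i) _ _
        map_smul' := fun c f => by ext1; funext i; exact map_smul (D i) c _ }
      (by
        obtain ⟨C, hC⟩ := h
        refine ⟨max C 0, fun f => norm_le_mul_of_le _ f (e := id) Function.injective_id
          (le_max_right _ _) fun i => ?_⟩
        exact (D i).le_of_opNorm_le ((hC i).trans (le_max_left _ _)) _)
  else 0

theorem diagOp_apply {D : ι → E →L[ℂ] E} {C : ℝ} (h : ∀ i, ‖D i‖ ≤ C)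
    (f : lp (fun _ : ι => E) 2) (i : ι) : diagOp D f i = D i (f i) := by
  unfold diagOp
  rw [dif_pos ⟨C, h⟩]
  rfl

theorem norm_diagOp_le {D : ι → E →L[ℂ] E} {C : ℝ} (hC : 0 ≤ C) (h : ∀ i, ‖D i‖ ≤ C) :
    ‖diagOp D‖ ≤ C :=
  ContinuousLinearMap.opNorm_le_bound _ hC fun f =>
    norm_le_mul_of_le _ f (e := id) Function.injective_id hC fun i => by
      rw [diagOp_apply h]
      exact (D i).le_of_opNorm_le (h i) _

theorem inner_diagOp [CompleteSpace E] {D : ι → E →L[ℂ] E} {C : ℝ} (h : ∀ i, ‖D i‖ ≤ C)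
    (f g : lp (fun _ : ι => E) 2) :
    ⟪diagOp D f, g⟫_ℂ = ⟪f, diagOp (fun i => (D i).adjoint) g⟫_ℂ := by
  have h' : ∀ i, ‖(D i).adjoint‖ ≤ C := fun i => by
    rw [LinearIsometryEquiv.norm_map]; exact h i
  rw [lp.inner_eq_tsum, lp.inner_eq_tsum]
  refine tsum_congr fun i => ?_
  rw [diagOp_apply h, diagOp_apply h', ContinuousLinearMap.adjoint_inner_right]

/-- The translation by `d`. -/
def shiftOp (d : ℤ) : lp (fun _ : ℤ => E) 2 →L[ℂ] lp (fun _ : ℤ => E) 2 :=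
  LinearMap.mkContinuous
    { toFun := fun f => ⟨fun p => f (p - d), memℓp_two_iff.2
        ((hasSum_norm_sq f).summable.comp_injective (sub_left_injective (b := d)))⟩
      map_add' := fun f g => rfl
      map_smul' := fun c f => rfl } 1
    fun f => norm_le_mul_of_le _ f (e := fun p => p - d) (sub_left_injective (b := d))
      zero_le_one fun i => by rw [one_mul]; rfl

theorem shiftOp_apply (d : ℤ) (f : lp (fun _ : ℤ => E) 2) (p : ℤ) : shiftOp d f p = f (p - d) :=
  rfl

theorem inner_shiftOp (d : ℤ) (f g : lp (fun _ : ℤ => E) 2) :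
    ⟪shiftOp d f, g⟫_ℂ = ⟪f, shiftOp (-d) g⟫_ℂ := by
  rw [lp.inner_eq_tsum, lp.inner_eq_tsum, ← (Equiv.addRight d).tsum_eq]
  simp [shiftOp_apply]

/-- The operator that acts by `M` on every fiber. -/
def fiberOp (M : E →L[ℂ] E) : lp (fun _ : ι => E) 2 →L[ℂ] lp (fun _ : ι => E) 2 :=
  diagOp fun _ => M

theorem fiberOp_apply (M : E →L[ℂ] E) (f : lp (fun _ : ι => E) 2) (i : ι) :
    fiberOp M f i = M (f i) := diagOp_apply (C := ‖M‖) (fun _ => le_rfl) f i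

theorem norm_fiberOp_le (M : E →L[ℂ] E) :
    ‖(fiberOp M : lp (fun _ : ι => E) 2 →L[ℂ] _)‖ ≤ ‖M‖ :=
  norm_diagOp_le (norm_nonneg _) fun _ => le_rfl

theorem continuous_fiberOp :
    Continuous (fiberOp : (E →L[ℂ] E) → lp (fun _ : ι => E) 2 →L[ℂ] lp (fun _ : ι => E) 2) := by
  let L : (E →L[ℂ] E) →ₗ[ℂ] (lp (fun _ : ι => E) 2 →L[ℂ] lp (fun _ : ι => E) 2) :=
    { toFun := fiberOp
      map_add' := fun M M' => by
        ext f i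
        simp only [fiberOp_apply, add_apply, lp.coeFn_add, Pi.add_apply]
      map_smul' := fun c M => by
        ext f i
        simp only [fiberOp_apply, smul_apply, lp.coeFn_smul, Pi.smul_apply, RingHom.id_apply] }
  have hL : ∀ M, ‖L M‖ ≤ 1 * ‖M‖ := fun M => by
    rw [one_mul]; exact norm_fiberOp_le (ι := ι) M
  exact AddMonoidHomClass.continuous_of_bound L 1 hL

theorem inner_fiberOp [CompleteSpace E] (M : E →L[ℂ] E) (f g : lp (fun _ : ι => E) 2) :
    ⟪fiberOp M f, g⟫_ℂ = ⟪f, fiberOp M.adjoint g⟫_ℂ :=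
  inner_diagOp (D := fun _ => M) (C := ‖M‖) (fun _ => le_rfl) f g

/-! ### The Fourier transform of finitely supported sequences -/

/-- A finitely supported sequence as an element of `ℓ²`. -/
def ofFinsupp : (ℤ →₀ E) →ₗ[ℂ] lp (fun _ : ℤ => E) 2 :=
  Finsupp.lsum ℂ fun p => lp.lsingle (𝕜 := ℂ) (E := fun _ : ℤ => E) 2 p

theorem ofFinsupp_single (p : ℤ) (a : E) :
    ofFinsupp (Finsupp.single p a) = lp.single (E := fun _ : ℤ => E) 2 p a := by
  simp [ofFinsupp]

theorem denseRange_ofFinsupp : DenseRange (ofFinsupp : (ℤ →₀ E) → lp (fun _ : ℤ => E) 2) := by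
  intro f
  refine mem_closure_of_tendsto (lp.hasSum_single (by norm_num) f)
    (Eventually.of_forall fun s => ⟨∑ p ∈ s, Finsupp.single p (f p), ?_⟩)
  rw [map_sum]
  exact Finset.sum_congr rfl fun p _ => ofFinsupp_single p (f p)

/-- The Fourier transform `∑ p, e^{i t p} w(p)`. -/
def fourierSum (t : ℝ) : (ℤ →₀ E) →ₗ[ℂ] E :=
  Finsupp.lsum ℂ fun p => Complex.exp (Complex.I * (t * p)) • LinearMap.id

theorem fourierSum_single (t : ℝ) (p : ℤ) (a : E) :
    fourierSum t (Finsupp.single p a) = Complex.exp (Complex.I * (t * p)) • a := by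
  simp [fourierSum]

theorem continuous_fourierSum (w : ℤ →₀ E) : Continuous fun t => fourierSum t w := by
  induction w using Finsupp.induction_linear with
  | zero => simpa using continuous_const
  | add f g hf hg =>
    simp only [map_add]
    exact hf.add hg
  | single q a =>
    simp only [fourierSum_single]
    fun_prop

theorem integral_exp_int (m : ℤ) :
    ∫ t in (0 : ℝ)..2 * π, Complex.exp (Complex.I * (t * m)) = if m = 0 then 2 * π else 0 := by
  split_ifs with h
  · simp [h]
  · have hc : Complex.I * m ≠ 0 := mul_ne_zero Complex.I_ne_zero (by exact_mod_cast h)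
    have h1 := integral_exp_mul_complex (a := 0) (b := 2 * π) hc
    have h2 : ∀ t : ℝ, Complex.I * (t * m) = Complex.I * m * t := fun t => by ring
    simp only [h2, h1]
    have h3 : Complex.I * m * ((2 * π : ℝ) : ℂ) = m * (2 * π * Complex.I) := by push_cast; ring
    rw [h3, Complex.exp_int_mul_two_pi_mul_I]
    simp

theorem parseval (v w : ℤ →₀ E) :
    ∫ t in (0 : ℝ)..2 * π, ⟪fourierSum t v, fourierSum t w⟫_ℂ
      = 2 * π * ⟪ofFinsupp v, ofFinsupp w⟫_ℂ := by
  have hint : ∀ v w : ℤ →₀ E, IntervalIntegrable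
      (fun t => ⟪fourierSum t v, fourierSum t w⟫_ℂ) MeasureTheory.volume 0 (2 * π) := fun v w =>
    ((continuous_fourierSum v).inner (continuous_fourierSum w)).intervalIntegrable _ _
  induction v using Finsupp.induction_linear with
  | zero => simp
  | add f g hf hg =>
    simp only [map_add, inner_add_left]
    rw [intervalIntegral.integral_add (hint f w) (hint g w), hf, hg, mul_add]
  | single p a =>
    induction w using Finsupp.induction_linear with
    | zero => simp
    | add f g hf hg =>
      simp only [map_add, inner_add_right]
      rw [intervalIntegral.integral_add (hint _ f) (hint _ g), hf, hg, mul_add]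
    | single q b =>
      have h1 : ∀ t : ℝ, ⟪fourierSum t (Finsupp.single p a), fourierSum t (Finsupp.single q b)⟫_ℂ
          = Complex.exp (Complex.I * (t * (q - p : ℤ))) * ⟪a, b⟫_ℂ := by
        intro t
        rw [fourierSum_single, fourierSum_single, inner_smul_left, inner_smul_right, ← mul_assoc,
          ← Complex.exp_conj, ← Complex.exp_add]
        congr 2
        simp only [map_mul, Complex.conj_I, Complex.conj_ofReal, map_intCast]
        push_cast; ring
      simp only [h1]
      rw [intervalIntegral.integral_mul_const, integral_exp_int, ofFinsupp_single,
        ofFinsupp_single, lp.inner_single_left, lp.single_apply, Pi.single_apply]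
      by_cases h : p = q
      · subst h; simp
      · simp [h, sub_eq_zero, Ne.symm h]

/-- `A` maps finitely supported sequences to such sequences, and acts on their Fourier transforms
by multiplication with `σ`. -/
def HasSymbol (A : lp (fun _ : ℤ => E) 2 →L[ℂ] lp (fun _ : ℤ => E) 2) (σ : ℝ → E →L[ℂ] E) : Prop :=
  ∀ w : ℤ →₀ E, ∃ w' : ℤ →₀ E, A (ofFinsupp w) = ofFinsupp w' ∧
    ∀ t, fourierSum t w' = σ t (fourierSum t w)

section Symbol

variable {A B : lp (fun _ : ℤ => E) 2 →L[ℂ] lp (fun _ : ℤ => E) 2} {σ τ : ℝ → E →L[ℂ] E}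

theorem hasSymbol_of_single (h : ∀ p a, ∃ w' : ℤ →₀ E,
    A (lp.single (E := fun _ : ℤ => E) 2 p a) = ofFinsupp w' ∧
    ∀ t, fourierSum t w' = σ t (Complex.exp (Complex.I * (t * p)) • a)) : HasSymbol A σ := by
  intro w
  induction w using Finsupp.induction_linear with
  | zero => exact ⟨0, by simp, by simp⟩
  | add f g hf hg =>
    obtain ⟨f', hf1, hf2⟩ := hf
    obtain ⟨g', hg1, hg2⟩ := hg
    exact ⟨f' + g', by rw [map_add, map_add, map_add, hf1, hg1], fun t => by
      rw [map_add, map_add, map_add, hf2, hg2]⟩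
  | single p a =>
    obtain ⟨w', h1, h2⟩ := h p a
    exact ⟨w', by rw [ofFinsupp_single, h1], fun t => by rw [fourierSum_single, h2]⟩

theorem HasSymbol.mul (hA : HasSymbol A σ) (hB : HasSymbol B τ) :
    HasSymbol (A * B) fun t => σ t * τ t := fun w => by
  obtain ⟨w', h1, h2⟩ := hB w
  obtain ⟨w'', h3, h4⟩ := hA w'
  exact ⟨w'', by rw [mul_apply_eq_comp, h1, h3], fun t => by
    rw [mul_apply_eq_comp, h4, h2]⟩

theorem hasSymbol_sum {κ : Type*} (s : Finset κ)
    {A : κ → lp (fun _ : ℤ => E) 2 →L[ℂ] lp (fun _ : ℤ => E) 2} {σ : κ → ℝ → E →L[ℂ] E}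
    (h : ∀ i, HasSymbol (A i) (σ i)) : HasSymbol (∑ i ∈ s, A i) fun t => ∑ i ∈ s, σ i t :=
  fun w => by
  choose w' h1 h2 using fun i => h i w
  exact ⟨∑ i ∈ s, w' i, by simp [h1], fun t => by simp [h2]⟩

theorem hasSymbol_fiberOp (M : E →L[ℂ] E) : HasSymbol (fiberOp M) fun _ => M := by
  refine hasSymbol_of_single fun p a => ⟨Finsupp.single p (M a), ?_, fun t => ?_⟩
  · ext q
    rw [fiberOp_apply, ofFinsupp_single, lp.single_apply, lp.single_apply, Pi.single_apply,
      Pi.single_apply]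
    split_ifs <;> simp
  · rw [fourierSum_single, map_smul]

theorem hasSymbol_shiftOp (d : ℤ) :
    HasSymbol (shiftOp d : lp (fun _ : ℤ => E) 2 →L[ℂ] _)
      fun t => Complex.exp (Complex.I * (t * d)) • (1 : E →L[ℂ] E) := by
  refine hasSymbol_of_single fun p a => ⟨Finsupp.single (p + d) a, ?_, fun t => ?_⟩
  · ext q
    rw [shiftOp_apply, ofFinsupp_single, lp.single_apply, lp.single_apply, Pi.single_apply,
      Pi.single_apply]
    simp only [sub_eq_iff_eq_add]
  · rw [fourierSum_single, smul_apply, one_apply_eq_self, smul_smul, ← Complex.exp_add]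
    congr 2
    push_cast; ring

theorem HasSymbol.le_re_inner (hA : HasSymbol A σ) (hB : HasSymbol B τ) {c : ℝ}
    (h : ∀ t ∈ Icc 0 (2 * π), ∀ v, c * ‖v‖ ^ 2 ≤ (⟪σ t v, τ t v⟫_ℂ).re)
    (w : lp (fun _ : ℤ => E) 2) : c * ‖w‖ ^ 2 ≤ (⟪A w, B w⟫_ℂ).re := by
  refine denseRange_ofFinsupp.induction_on (p := fun w => c * ‖w‖ ^ 2 ≤ (⟪A w, B w⟫_ℂ).re) w
    (isClosed_le (by fun_prop) (by fun_prop)) fun w => ?_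
  obtain ⟨a, ha, ha'⟩ := hA w
  obtain ⟨b, hb, hb'⟩ := hB w
  rw [ha, hb]
  have hpi : (0 : ℝ) ≤ 2 * π := by positivity
  have hre : ∀ x y : ℤ →₀ E, ∫ t in (0 : ℝ)..2 * π, (⟪fourierSum t x, fourierSum t y⟫_ℂ).re
      = 2 * π * (⟪ofFinsupp x, ofFinsupp y⟫_ℂ).re := by
    intro x y
    have h1 := congrArg Complex.re (parseval x y)
    have h2 : ((2 : ℂ) * π * ⟪ofFinsupp x, ofFinsupp y⟫_ℂ).re
        = 2 * π * (⟪ofFinsupp x, ofFinsupp y⟫_ℂ).re := by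
      rw [← Complex.re_ofReal_mul]; push_cast; rfl
    rw [h2] at h1
    rw [← h1]
    exact (Complex.reCLM.intervalIntegral_comp_comm
      (((continuous_fourierSum x).inner (continuous_fourierSum y)).intervalIntegrable _ _))
  have hmono : ∫ t in (0 : ℝ)..2 * π, c * (⟪fourierSum t w, fourierSum t w⟫_ℂ).re
      ≤ ∫ t in (0 : ℝ)..2 * π, (⟪fourierSum t a, fourierSum t b⟫_ℂ).re := by
    refine intervalIntegral.integral_mono_on hpi ?_ ?_ fun t ht => ?_
    · exact (continuous_const.mul (Complex.continuous_re.comp ((continuous_fourierSum w).inner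
        (continuous_fourierSum w)))).intervalIntegrable _ _
    · exact (Complex.continuous_re.comp ((continuous_fourierSum a).inner
        (continuous_fourierSum b))).intervalIntegrable _ _
    · rw [ha', hb', inner_self_eq_norm_sq_to_K]
      refine le_trans (le_of_eq ?_) (h t ht _)
      norm_cast
  rw [intervalIntegral.integral_const_mul, hre, hre, inner_self_eq_norm_sq_to_K] at hmono
  have h3 : (((‖ofFinsupp w‖ : ℂ)) ^ 2).re = ‖ofFinsupp w‖ ^ 2 := by norm_cast
  have h4 : c * (2 * π * ‖ofFinsupp w‖ ^ 2) ≤ 2 * π * (⟪ofFinsupp a, ofFinsupp b⟫_ℂ).re := by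
    rw [← h3]; exact hmono
  have : 0 < 2 * π := by positivity
  nlinarith

end Symbol

/-- The convolution with the operators `g d`, `|d| ≤ r`. -/
def convOp (r : ℕ) (g : ℤ → E →L[ℂ] E) : lp (fun _ : ℤ => E) 2 →L[ℂ] lp (fun _ : ℤ => E) 2 :=
  ∑ d ∈ Finset.Icc (-r : ℤ) r, fiberOp (g d) * shiftOp d

/-- The symbol of a convolution. -/
def convSymbol (r : ℕ) (g : ℤ → E →L[ℂ] E) (t : ℝ) : E →L[ℂ] E :=
  ∑ d ∈ Finset.Icc (-r : ℤ) r, Complex.exp (Complex.I * (t * d)) • g d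

theorem convOp_apply (r : ℕ) (g : ℤ → E →L[ℂ] E) (f : lp (fun _ : ℤ => E) 2) (p : ℤ) :
    convOp r g f p = ∑ d ∈ Finset.Icc (-r : ℤ) r, g d (f (p - d)) := by
  unfold convOp
  rw [sum_apply, lp.coeFn_sum, Finset.sum_apply]
  exact Finset.sum_congr rfl fun d _ => by
    rw [mul_apply_eq_comp, fiberOp_apply, shiftOp_apply]

theorem hasSymbol_convOp (r : ℕ) (g : ℤ → E →L[ℂ] E) :
    HasSymbol (convOp r g) (convSymbol r g) := by
  have := hasSymbol_sum (Finset.Icc (-r : ℤ) r)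
    fun d => (hasSymbol_fiberOp (g d)).mul (hasSymbol_shiftOp d)
  have e : convSymbol r g = fun t : ℝ => ∑ d ∈ Finset.Icc (-r : ℤ) r,
      g d * Complex.exp (Complex.I * (t * d)) • (1 : E →L[ℂ] E) := by
    funext t
    refine Finset.sum_congr rfl fun d _ => ?_
    rw [mul_smul_comm, mul_one]
  rw [e]
  exact this

theorem hasSymbol_adjoint_convOp [CompleteSpace E] (r : ℕ) (g : ℤ → E →L[ℂ] E) :
    HasSymbol (convOp r g).adjoint fun t => (convSymbol r g t).adjoint := by
  have h1 : (convOp r g).adjoint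
      = ∑ d ∈ Finset.Icc (-r : ℤ) r, shiftOp (-d) * fiberOp (g d).adjoint := by
    symm
    rw [ContinuousLinearMap.eq_adjoint_iff]
    intro x y
    rw [sum_apply, convOp, sum_apply, sum_inner, inner_sum]
    refine Finset.sum_congr rfl fun d _ => ?_
    rw [mul_apply_eq_comp, mul_apply_eq_comp, inner_shiftOp, neg_neg,
      inner_fiberOp, ContinuousLinearMap.adjoint_adjoint]
  rw [h1]
  have := hasSymbol_sum (Finset.Icc (-r : ℤ) r)
    fun d => (hasSymbol_shiftOp (-d)).mul (hasSymbol_fiberOp (g d).adjoint)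
  convert this using 1
  funext t
  unfold convSymbol
  rw [map_sum]
  refine Finset.sum_congr rfl fun d _ => ?_
  rw [map_smulₛₗ, smul_mul_assoc, one_mul, ← Complex.exp_conj]
  congr 2
  simp

theorem continuous_convOp (r : ℕ) {X : Type*} [TopologicalSpace X] {g : X → ℤ → E →L[ℂ] E}
    (h : ∀ d, Continuous fun x => g x d) : Continuous fun x => convOp r (g x) := by
  unfold convOp
  refine continuous_finsetSum _ fun d _ => ?_
  exact (continuous_fiberOp.comp (h d)).clm_comp continuous_const

end Lattice

section Bands

open Module Topology Filter
open scoped InnerProductSpace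

variable {n : ℕ}

/-- The Fourier transform in the `y`-direction of the terms of `H` that hop by `d` columns. -/
def Hamiltonian.hop (H : Hamiltonian n) (ky : ℝ) (d : ℤ) :
    EuclideanSpace ℂ (Fin n) →L[ℂ] EuclideanSpace ℂ (Fin n) :=
  Matrix.toEuclideanCLM (𝕜 := ℂ)
    (∑ y ∈ Finset.Icc (-1 : ℤ) 1, Complex.exp (Complex.I * (ky * y)) • H.kernel (d, y) 0)

/-- The Bloch Hamiltonian as an operator. -/
def Hamiltonian.blochOp (H : Hamiltonian n) (kx ky : ℝ) :
    EuclideanSpace ℂ (Fin n) →L[ℂ] EuclideanSpace ℂ (Fin n) :=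
  Matrix.toEuclideanCLM (𝕜 := ℂ) (H.bloch kx ky)

theorem continuous_toEuclideanCLM : Continuous
    (Matrix.toEuclideanCLM (𝕜 := ℂ) : Matrix (Fin n) (Fin n) ℂ → _ →L[ℂ] _) :=
  LinearMap.continuous_of_finiteDimensional
    ((Matrix.toEuclideanCLM (n := Fin n) (𝕜 := ℂ)).toAlgEquiv.toLinearMap)

theorem Hamiltonian.blochOp_eq_convSymbol (H : Hamiltonian n) (kx ky : ℝ) :
    H.blochOp kx ky = convSymbol 1 (H.hop ky) kx := by
  unfold Hamiltonian.blochOp Hamiltonian.bloch convSymbol Hamiltonian.hop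
  rw [Finset.sum_product, map_sum]
  refine Finset.sum_congr rfl fun d _ => ?_
  rw [← map_smul, Finset.smul_sum]
  congr 1
  refine Finset.sum_congr rfl fun y _ => ?_
  rw [smul_smul, ← Complex.exp_add]
  congr 2
  ring

theorem Hamiltonian.continuous_bloch (H : Hamiltonian n) :
    Continuous fun k : ℝ × ℝ => H.bloch k.1 k.2 := by
  unfold Hamiltonian.bloch
  fun_prop

theorem Hamiltonian.continuous_blochOp (H : Hamiltonian n) :
    Continuous fun k : ℝ × ℝ => H.blochOp k.1 k.2 :=
  continuous_toEuclideanCLM.comp H.continuous_bloch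

theorem Hamiltonian.continuous_hop (H : Hamiltonian n) (d : ℤ) :
    Continuous fun ky => H.hop ky d := by
  unfold Hamiltonian.hop
  exact continuous_toEuclideanCLM.comp (by fun_prop)

theorem exp_add_two_pi_mul_int (k : ℝ) (m : ℤ) :
    Complex.exp (Complex.I * ((k + 2 * π : ℝ) * m)) = Complex.exp (Complex.I * (k * m)) := by
  have : Complex.I * ((k + 2 * π : ℝ) * m) = Complex.I * (k * m) + m * (2 * π * Complex.I) := by
    push_cast; ring
  rw [this, Complex.exp_add, Complex.exp_int_mul_two_pi_mul_I, mul_one]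

theorem Hamiltonian.hop_add_two_pi (H : Hamiltonian n) (ky : ℝ) (d : ℤ) :
    H.hop (ky + 2 * π) d = H.hop ky d := by
  unfold Hamiltonian.hop
  simp only [exp_add_two_pi_mul_int]

theorem Hamiltonian.blochOp_add_two_pi_left (H : Hamiltonian n) (kx ky : ℝ) :
    H.blochOp (kx + 2 * π) ky = H.blochOp kx ky := by
  simp only [H.blochOp_eq_convSymbol, convSymbol, exp_add_two_pi_mul_int]

theorem Hamiltonian.blochOp_add_two_pi_right (H : Hamiltonian n) (kx ky : ℝ) :
    H.blochOp kx (ky + 2 * π) = H.blochOp kx ky := by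
  simp only [H.blochOp_eq_convSymbol, convSymbol, H.hop_add_two_pi]

theorem Hamiltonian.adjoint_hop (H : Hamiltonian n) (ky : ℝ) (d : ℤ) :
    (H.hop ky d).adjoint = H.hop ky (-d) := by
  unfold Hamiltonian.hop
  rw [← ContinuousLinearMap.star_eq_adjoint, ← map_star]
  congr 1
  rw [star_sum]
  refine Finset.sum_nbij' (fun y => -y) (fun y => -y) (by simp; omega) (by simp; omega)
    (by simp) (by simp) fun y _ => ?_
  rw [star_smul, Matrix.star_eq_conjTranspose, ← H.hermitian]
  have h1 := H.periodic (d, y) (-d, -y) 0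
  have h2 : ((-d, -y) : ℤ × ℤ) + (d, y) = 0 := by ext <;> simp
  rw [h2, zero_add] at h1
  rw [h1]
  congr 1
  rw [← starRingEnd_apply, ← Complex.exp_conj]
  simp

theorem Hamiltonian.adjoint_blochOp (H : Hamiltonian n) (kx ky : ℝ) :
    (H.blochOp kx ky).adjoint = H.blochOp kx ky := by
  rw [H.blochOp_eq_convSymbol]
  unfold convSymbol
  rw [map_sum]
  refine Finset.sum_nbij' (fun y => -y) (fun y => -y) (by simp; omega) (by simp; omega)
    (by simp) (by simp) fun d _ => ?_
  rw [map_smulₛₗ, H.adjoint_hop, ← Complex.exp_conj]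
  simp

theorem Hamiltonian.symmOp_blochOp (H : Hamiltonian n) (kx ky : ℝ) : SymmOp (H.blochOp kx ky) :=
  fun u v => by
    conv_lhs => rw [← H.adjoint_blochOp]
    exact ContinuousLinearMap.adjoint_inner_left _ _ _

theorem Hamiltonian.exists_norm_blochOp_le (H : Hamiltonian n) :
    ∃ M : ℝ, ∀ kx ky, ‖H.blochOp kx ky‖ ≤ M := by
  refine ⟨∑ r ∈ Finset.Icc (-1 : ℤ) 1 ×ˢ Finset.Icc (-1 : ℤ) 1,
    ‖Matrix.toEuclideanCLM (𝕜 := ℂ) (H.kernel r 0)‖, fun kx ky => ?_⟩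
  unfold Hamiltonian.blochOp Hamiltonian.bloch
  rw [map_sum]
  refine (norm_sum_le _ _).trans (Finset.sum_le_sum fun r _ => ?_)
  rw [map_smul, norm_smul]
  have : Complex.I * (kx * r.1 + ky * r.2) = ((kx * r.1 + ky * r.2 : ℝ) : ℂ) * Complex.I := by
    push_cast; ring
  rw [this, Complex.norm_exp_ofReal_mul_I, one_mul]

variable {H : Hamiltonian n} {E : Fin n → ℝ → ℝ → ℝ}

theorem IsGappedBands.exists_basis (hE : IsGappedBands H E) (kx ky : ℝ) :
    ∃ b : OrthonormalBasis (Fin n) ℂ (EuclideanSpace ℂ (Fin n)),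
      ∀ j, H.blochOp kx ky (b j) = (E j kx ky : ℂ) • b j := by
  have h1 : ∀ j, ∃ v : EuclideanSpace ℂ (Fin n), ‖v‖ = 1 ∧
      H.blochOp kx ky v = (E j kx ky : ℂ) • v := by
    intro j
    obtain ⟨v, hv⟩ := (hE.eigenvalue j kx ky).exists_hasEigenvector
    have hv0 : WithLp.toLp 2 v ≠ 0 := fun h => hv.2 (by simpa using h)
    have hv1 : H.blochOp kx ky (WithLp.toLp 2 v) = (E j kx ky : ℂ) • WithLp.toLp 2 v := by
      unfold Hamiltonian.blochOp
      rw [Matrix.toEuclideanCLM_toLp, ← Matrix.toLin'_apply, hv.apply_eq_smul, WithLp.toLp_smul]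
    refine ⟨((‖WithLp.toLp 2 v‖⁻¹ : ℝ) : ℂ) • WithLp.toLp 2 v, ?_, ?_⟩
    · rw [norm_smul, Complex.norm_real, norm_inv, norm_norm, inv_mul_cancel₀ (norm_ne_zero_iff.2 hv0)]
    · rw [map_smul, hv1, smul_comm]
  choose v hv hv' using h1
  have hon : Orthonormal ℂ v := by
    refine ⟨hv, fun i j hij => ?_⟩
    have h2 := H.symmOp_blochOp kx ky (v i) (v j)
    rw [hv', hv', inner_smul_left, inner_smul_right, Complex.conj_ofReal, ← sub_eq_zero,
      ← sub_mul] at h2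
    refine (mul_eq_zero.1 h2).resolve_left fun h3 => hij ?_
    exact (hE.strictMono kx ky).injective (by exact_mod_cast sub_eq_zero.1 h3)
  refine ⟨OrthonormalBasis.mk hon ?_, fun j => by rw [OrthonormalBasis.coe_mk]; exact hv' j⟩
  rw [hon.linearIndependent.span_eq_top_of_card_eq_finrank' (by simp)]

/-- An orthonormal basis of eigenvectors of the Bloch Hamiltonian. -/
def IsGappedBands.basis (hE : IsGappedBands H E) (kx ky : ℝ) :
    OrthonormalBasis (Fin n) ℂ (EuclideanSpace ℂ (Fin n)) := (hE.exists_basis kx ky).choose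

theorem IsGappedBands.blochOp_basis (hE : IsGappedBands H E) (kx ky : ℝ) (j : Fin n) :
    H.blochOp kx ky (hE.basis kx ky j) = (E j kx ky : ℂ) • hE.basis kx ky j :=
  (hE.exists_basis kx ky).choose_spec j

theorem IsGappedBands.exists_eq_of_eigenvector (hE : IsGappedBands H E) {kx ky : ℝ} {μ : ℂ}
    {v : EuclideanSpace ℂ (Fin n)} (hv : H.blochOp kx ky v = μ • v) (h0 : v ≠ 0) :
    ∃ j, μ = E j kx ky := by
  have h1 : ∃ j, ⟪hE.basis kx ky j, v⟫_ℂ ≠ 0 := by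
    by_contra hc
    push Not at hc
    refine h0 ?_
    rw [← (hE.basis kx ky).sum_repr' v]
    exact Finset.sum_eq_zero fun j _ => by rw [hc j, zero_smul]
  obtain ⟨j, hj⟩ := h1
  refine ⟨j, ?_⟩
  have h2 := H.symmOp_blochOp kx ky (hE.basis kx ky j) v
  rw [hv, hE.blochOp_basis, inner_smul_left, inner_smul_right, Complex.conj_ofReal] at h2
  exact (mul_right_cancel₀ hj h2).symm

theorem IsGappedBands.abs_energy_le (hE : IsGappedBands H E) (j : Fin n) (kx ky : ℝ) :
    |E j kx ky| ≤ ‖H.blochOp kx ky‖ := by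
  have h1 := (H.blochOp kx ky).le_opNorm (hE.basis kx ky j)
  rw [hE.blochOp_basis, norm_smul, (hE.basis kx ky).orthonormal.1, Complex.norm_real] at h1
  simpa using h1

theorem IsGappedBands.eq_of_blochOp_eq (hE : IsGappedBands H E) {kx ky kx' ky' : ℝ}
    (h : H.blochOp kx ky = H.blochOp kx' ky') (j : Fin n) : E j kx ky = E j kx' ky' := by
  have key : ∀ {kx ky kx' ky' : ℝ}, H.blochOp kx ky = H.blochOp kx' ky' →
      range (fun j => E j kx ky) ⊆ range fun j => E j kx' ky' := by
    rintro kx ky kx' ky' h _ ⟨j, rfl⟩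
    have h1 := hE.blochOp_basis kx ky j
    rw [h] at h1
    obtain ⟨i, hi⟩ := hE.exists_eq_of_eigenvector h1 ((hE.basis kx ky).orthonormal.ne_zero j)
    exact ⟨i, by exact_mod_cast hi.symm⟩
  exact congrFun (((hE.strictMono kx ky).range_inj (hE.strictMono kx' ky')).1
    ((key h).antisymm (key h.symm))) j

theorem IsGappedBands.exists_separation (hE : IsGappedBands H E) {i j : Fin n} (hij : i < j) :
    ∃ e : ℝ, ∀ kx ky, E i kx ky < e ∧ e < E j kx ky := by
  have hi : i.val + 1 < n := by omega
  obtain ⟨e, he⟩ := hE.gap i ⟨i.val + 1, hi⟩ rfl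
  refine ⟨e, fun kx ky => ⟨(he kx ky).1, (he kx ky).2.trans_le ?_⟩⟩
  refine (hE.strictMono kx ky).monotone ?_
  rw [Fin.le_def]
  exact hij

theorem IsGappedBands.continuous_energy (hE : IsGappedBands H E) (j : Fin n) :
    Continuous fun k : ℝ × ℝ => E j k.1 k.2 := by
  rw [continuous_iff_continuousAt]
  intro k₀
  have hbd : ∀ᶠ k : ℝ × ℝ in 𝓝 k₀,
      E j k.1 k.2 ∈ Icc (-(‖H.blochOp k₀.1 k₀.2‖ + 1)) (‖H.blochOp k₀.1 k₀.2‖ + 1) := by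
    have h1 : ∀ᶠ k : ℝ × ℝ in 𝓝 k₀, ‖H.blochOp k.1 k.2‖ < ‖H.blochOp k₀.1 k₀.2‖ + 1 :=
      H.continuous_blochOp.norm.continuousAt.eventually_lt continuousAt_const (by linarith)
    filter_upwards [h1] with k hk
    exact abs_le.1 ((hE.abs_energy_le j k.1 k.2).trans hk.le)
  refine isCompact_Icc.tendsto_nhds_of_unique_mapClusterPt hbd fun x _ hx => ?_
  obtain ⟨U, hU, hUx⟩ := mapClusterPt_iff_ultrafilter.1 hx
  have hdet : (H.bloch k₀.1 k₀.2 - (x : ℂ) • (1 : Matrix (Fin n) (Fin n) ℂ)).det = 0 := by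
    obtain ⟨D, hD⟩ : ∃ D : Matrix (Fin n) (Fin n) ℂ × ℝ → ℂ,
      ∀ p, D p = (p.1 - (p.2 : ℂ) • (1 : Matrix (Fin n) (Fin n) ℂ)).det := ⟨_, fun _ => rfl⟩
    have h2 : Continuous D := by
      rw [funext hD]
      fun_prop
    have h3 : Tendsto (fun k : ℝ × ℝ => (H.bloch k.1 k.2, E j k.1 k.2)) U
        (𝓝 (H.bloch k₀.1 k₀.2, x)) :=
      ((H.continuous_bloch.tendsto k₀).mono_left hU).prodMk_nhds hUx
    have h1 := (h2.tendsto _).comp h3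
    refine (hD (H.bloch k₀.1 k₀.2, x)).symm.trans
      (tendsto_nhds_unique h1 (tendsto_const_nhds.congr fun k => ?_))
    symm
    obtain ⟨v, hv⟩ := (hE.eigenvalue j k.1 k.2).exists_hasEigenvector
    rw [Function.comp_apply, hD]
    refine Matrix.exists_mulVec_eq_zero_iff.1 ⟨v, hv.2, ?_⟩
    have := hv.apply_eq_smul
    rw [Matrix.toLin'_apply] at this
    rw [Matrix.sub_mulVec, this, Matrix.smul_mulVec, Matrix.one_mulVec, sub_self]
  obtain ⟨v, hv0, hv⟩ := Matrix.exists_mulVec_eq_zero_iff.2 hdet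
  rw [Matrix.sub_mulVec, Matrix.smul_mulVec, Matrix.one_mulVec, sub_eq_zero] at hv
  obtain ⟨i, hi⟩ := hE.exists_eq_of_eigenvector (kx := k₀.1) (ky := k₀.2) (μ := x)
    (v := WithLp.toLp 2 v) (by
      unfold Hamiltonian.blochOp
      rw [Matrix.toEuclideanCLM_toLp, hv, WithLp.toLp_smul]) (fun h => hv0 (by simpa using h))
  have hxi : x = E i k₀.1 k₀.2 := by exact_mod_cast hi
  rcases lt_trichotomy i j with hij | rfl | hij
  · obtain ⟨e, he⟩ := hE.exists_separation hij
    have h1 : e ≤ x := ge_of_tendsto' hUx fun k => (he k.1 k.2).2.le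
    linarith [(he k₀.1 k₀.2).1]
  · exact hxi
  · obtain ⟨e, he⟩ := hE.exists_separation hij
    have h1 : x ≤ e := le_of_tendsto' hUx fun k => (he k.1 k.2).1.le
    linarith [(he k₀.1 k₀.2).2]

/-- The spectral projection onto the band `j`, by Lagrange interpolation. -/
def IsGappedBands.proj (_ : IsGappedBands H E) (j : Fin n) (kx ky : ℝ) :
    EuclideanSpace ℂ (Fin n) →L[ℂ] EuclideanSpace ℂ (Fin n) :=
  (((List.finRange n).filter (· ≠ j)).map fun i =>
    ((E j kx ky - E i kx ky : ℝ) : ℂ)⁻¹ • (H.blochOp kx ky - (E i kx ky : ℂ) • 1)).prod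

theorem IsGappedBands.continuous_proj (hE : IsGappedBands H E) (j : Fin n) :
    Continuous fun k : ℝ × ℝ => hE.proj j k.1 k.2 := by
  unfold IsGappedBands.proj
  refine continuous_list_prod _ fun i hi => ?_
  have hij : i ≠ j := by simpa using hi
  have h1 := H.continuous_blochOp
  have h2 := hE.continuous_energy i
  have h3 := hE.continuous_energy j
  refine Continuous.smul (Continuous.inv₀ (Complex.continuous_ofReal.comp (h3.sub h2)) fun k hk => ?_)
    (h1.sub ((Complex.continuous_ofReal.comp h2).smul continuous_const))
  have : E j k.1 k.2 = E i k.1 k.2 := sub_eq_zero.1 (Complex.ofReal_eq_zero.1 hk)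
  exact hij ((hE.strictMono k.1 k.2).injective this).symm

theorem list_prod_apply_of_eigenvector {ι F : Type*} [NormedAddCommGroup F] [NormedSpace ℂ F]
    (l : List ι) (A : ι → F →L[ℂ] F) (a : ι → ℂ) (v : F) (h : ∀ i, A i v = a i • v) :
    (l.map A).prod v = (l.map a).prod • v := by
  induction l with
  | nil => simp
  | cons i l ih =>
    rw [List.map_cons, List.prod_cons, mul_apply_eq_comp, ih, map_smul, h, List.map_cons,
      List.prod_cons, smul_smul, mul_comm]

theorem IsGappedBands.proj_apply (hE : IsGappedBands H E) (j : Fin n) (kx ky : ℝ)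
    (u : EuclideanSpace ℂ (Fin n)) :
    hE.proj j kx ky u = ⟪hE.basis kx ky j, u⟫_ℂ • hE.basis kx ky j := by
  have hb : ∀ l, hE.proj j kx ky (hE.basis kx ky l)
      = if l = j then hE.basis kx ky l else 0 := by
    intro l
    have h1 : hE.proj j kx ky (hE.basis kx ky l) = _ := list_prod_apply_of_eigenvector
      ((List.finRange n).filter (· ≠ j)) _
      (fun i => ((E j kx ky - E i kx ky : ℝ) : ℂ)⁻¹ * ((E l kx ky : ℂ) - E i kx ky)) _ fun i => by
        rw [smul_apply, sub_apply, hE.blochOp_basis, smul_apply, one_apply_eq_self, ← sub_smul,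
          smul_smul]
    rw [h1]
    split_ifs with hl
    · subst hl
      rw [List.prod_eq_one, one_smul]
      intro x hx
      obtain ⟨i, hi, rfl⟩ := List.mem_map.1 hx
      have hil : i ≠ l := by simpa using hi
      rw [Complex.ofReal_sub]
      refine inv_mul_cancel₀ fun h => hil ?_
      exact ((hE.strictMono kx ky).injective (by exact_mod_cast sub_eq_zero.1 h)).symm
    · rw [List.prod_eq_zero, zero_smul]
      exact List.mem_map.2 ⟨l, by simpa using hl, by simp⟩
  have hL : (hE.proj j kx ky : EuclideanSpace ℂ (Fin n) →ₗ[ℂ] EuclideanSpace ℂ (Fin n))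
      = (((innerSL ℂ (hE.basis kx ky j)).smulRight (hE.basis kx ky j) :
        EuclideanSpace ℂ (Fin n) →L[ℂ] EuclideanSpace ℂ (Fin n)) :
        EuclideanSpace ℂ (Fin n) →ₗ[ℂ] EuclideanSpace ℂ (Fin n)) := by
    refine (hE.basis kx ky).toBasis.ext fun l => ?_
    rw [OrthonormalBasis.coe_toBasis]
    change hE.proj j kx ky (hE.basis kx ky l)
      = ⟪hE.basis kx ky j, hE.basis kx ky l⟫_ℂ • hE.basis kx ky j
    rw [hb, (hE.basis kx ky).inner_eq_ite]
    by_cases hl : l = j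
    · subst hl; simp
    · simp [hl, Ne.symm hl]
  exact congrArg (fun L : EuclideanSpace ℂ (Fin n) →ₗ[ℂ] EuclideanSpace ℂ (Fin n) => L u) hL

theorem IsGappedBands.proj_proj (hE : IsGappedBands H E) (j : Fin n) (kx ky : ℝ)
    (u : EuclideanSpace ℂ (Fin n)) :
    hE.proj j kx ky (hE.proj j kx ky u) = hE.proj j kx ky u := by
  simp only [hE.proj_apply, inner_smul_right, (hE.basis kx ky).inner_eq_one, mul_one]

theorem IsGappedBands.blochOp_of_proj (hE : IsGappedBands H E) {j : Fin n} {kx ky : ℝ}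
    {u : EuclideanSpace ℂ (Fin n)} (h : hE.proj j kx ky u = u) :
    H.blochOp kx ky u = (E j kx ky : ℂ) • u := by
  rw [← h, hE.proj_apply, map_smul, hE.blochOp_basis, smul_comm]

theorem IsGappedBands.eq_smul_of_proj (hE : IsGappedBands H E) {j : Fin n} {kx ky : ℝ}
    {u v : EuclideanSpace ℂ (Fin n)} (hu : hE.proj j kx ky u = u) (hv : hE.proj j kx ky v = v)
    (h1 : ‖u‖ = 1) : v = ⟪u, v⟫_ℂ • u := by
  rw [hE.proj_apply] at hu hv
  set b := hE.basis kx ky j with hb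
  have hb1 : ‖b‖ = 1 := (hE.basis kx ky).orthonormal.1 j
  set a := ⟪b, u⟫_ℂ
  set c := ⟪b, v⟫_ℂ
  have ha : ‖a‖ = 1 := by
    have := congrArg norm hu
    rwa [norm_smul, hb1, mul_one, h1] at this
  rw [← hu, ← hv, inner_smul_left, inner_smul_right, inner_self_eq_norm_sq_to_K, hb1, smul_smul]
  congr 1
  have : (starRingEnd ℂ) a * a = 1 := by
    rw [Complex.conj_mul', ha]; simp
  simp only [Complex.coe_algebraMap, Complex.ofReal_one, one_pow, mul_one]
  linear_combination (-c) * this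

theorem IsGappedBands.proj_eq_of_blochOp_eq (hE : IsGappedBands H E) {kx ky kx' ky' : ℝ}
    (h : H.blochOp kx ky = H.blochOp kx' ky') (j : Fin n) :
    hE.proj j kx ky = hE.proj j kx' ky' := by
  unfold IsGappedBands.proj
  simp only [h, hE.eq_of_blochOp_eq h]

end Bands

section Frames

open Module Topology Filter
open scoped InnerProductSpace

theorem exists_forall_norm_sub_lt_one {Y M : Type*} [TopologicalSpace Y] [CompactSpace Y]
    [NormedAddCommGroup M] (P : ℝ → Y → M) (hP : Continuous fun x : ℝ × Y => P x.1 x.2) (T : ℝ) :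
    ∃ δ > 0, ∀ s ∈ Icc 0 T, ∀ t ∈ Icc 0 T, dist s t < δ → ∀ y, ‖P s y - P t y‖ < 1 := by
  let G : ℝ → C(Y, M) := fun t => ⟨P t, hP.comp (Continuous.prodMk_right t)⟩
  have hG : Continuous G := ContinuousMap.continuous_of_continuous_uncurry _ hP
  have hunif := isCompact_Icc.uniformContinuousOn_of_continuous (hG.continuousOn (s := Icc 0 T))
  obtain ⟨δ, hδ, hclose⟩ := Metric.uniformContinuousOn_iff.1 hunif 1 one_pos
  refine ⟨δ, hδ, fun s hs t ht hst y => ?_⟩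
  rw [← dist_eq_norm]
  exact (ContinuousMap.dist_apply_le_dist (f := G s) (g := G t) y).trans_lt (hclose _ hs _ ht hst)

/-- Transport of unit vectors in the ranges of a continuous family of projections. -/
theorem exists_transport {Y F : Type*} [TopologicalSpace Y] [CompactSpace Y]
    [NormedAddCommGroup F] [NormedSpace ℂ F] (P : ℝ → Y → F →L[ℂ] F)
    (hP : Continuous fun x : ℝ × Y => P x.1 x.2) (hPP : ∀ t y v, P t y (P t y v) = P t y v)
    {φ₀ : Y → F} (hφ : Continuous φ₀) (h1 : ∀ y, ‖φ₀ y‖ = 1) (h0 : ∀ y, P 0 y (φ₀ y) = φ₀ y)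
    (T : ℝ) :
    ∃ φ : ℝ → Y → F, Continuous (fun x : ℝ × Y => φ x.1 x.2) ∧ (∀ t y, ‖φ t y‖ = 1) ∧
      (∀ t ∈ Icc 0 T, ∀ y, P t y (φ t y) = φ t y) ∧ (∀ y, φ 0 y = φ₀ y) ∧
      ∀ y y', (∀ t, P t y = P t y') → φ₀ y = φ₀ y' → ∀ t, φ t y = φ t y' := by
  obtain ⟨δ, hδ, hclose⟩ := exists_forall_norm_sub_lt_one P hP T
  have hstep : ∀ m : ℕ, ∃ φ : ℝ → Y → F, Continuous (fun x : ℝ × Y => φ x.1 x.2) ∧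
      (∀ t y, ‖φ t y‖ = 1) ∧
      (∀ t ≤ T, ∀ y, P (max 0 (min t (m * (δ / 2)))) y (φ t y) = φ t y) ∧
      (∀ y, ∀ t ≤ 0, φ t y = φ₀ y) ∧
      ∀ y y', (∀ t, P t y = P t y') → φ₀ y = φ₀ y' → ∀ t, φ t y = φ t y' := by
    intro m
    induction m with
    | zero =>
      refine ⟨fun _ y => φ₀ y, hφ.comp continuous_snd, fun _ y => h1 y, fun t _ y => ?_,
        fun _ _ _ => rfl, fun y y' _ h _ => h⟩
      rw [Nat.cast_zero, zero_mul, max_eq_left (min_le_right _ _), h0]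
    | succ m ih =>
      obtain ⟨φ, hc, hn, hPφ, hi, hd⟩ := ih
      let c : ℕ → ℝ → ℝ := fun m t => max 0 (min (min t T) (m * (δ / 2)))
      have hcc : ∀ m, Continuous (c m) := fun m => by fun_prop
      have hcT : ∀ m t, t ≤ T → c m t = max 0 (min t (m * (δ / 2))) := fun m t ht => by
        simp only [c, min_eq_left ht]
      let φT : ℝ → Y → F := fun t y => φ (min t T) y
      have hPT : ∀ t y, P (c m t) y (φT t y) = φT t y := fun t y =>
        hPφ (min t T) (min_le_right _ _) y
      have hnz : ∀ t y, P (c (m + 1) t) y (φT t y) ≠ 0 := by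
        intro t y
        by_cases hT : 0 ≤ T
        · have hmem : ∀ m, c m t ∈ Icc 0 T := fun m =>
            ⟨le_max_left _ _, max_le hT ((min_le_left _ _).trans (min_le_right _ _))⟩
          have hdist : dist (c (m + 1) t) (c m t) < δ := by
            rw [Real.dist_eq]
            have e : ((m + 1 : ℕ) : ℝ) * (δ / 2) = m * (δ / 2) + δ / 2 := by push_cast; ring
            simp only [c, e]
            refine (abs_max_sub_max_le_max _ _ _ _).trans_lt (max_lt (by simpa using hδ) ?_)
            refine (abs_min_sub_min_le_max _ _ _ _).trans_lt (max_lt (by simpa using hδ) ?_)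
            rw [add_sub_cancel_left, abs_of_pos (by linarith)]
            linarith
          have h2 := hclose _ (hmem (m + 1)) _ (hmem m) hdist y
          intro h3
          have h4 := (P (c (m + 1) t) y - P (c m t) y).le_opNorm (φT t y)
          rw [sub_apply, h3, hPT, zero_sub, norm_neg, hn, mul_one] at h4
          linarith
        · have hz : ∀ m, c m t = 0 := fun m => by
            refine max_eq_left ((min_le_left _ _).trans ((min_le_right _ _).trans ?_))
            exact (not_le.1 hT).le
          have h3 := hPT t y
          rw [hz] at h3
          rw [hz, h3, ← norm_ne_zero_iff, hn]
          exact one_ne_zero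
      refine ⟨fun t y => ((‖P (c (m + 1) t) y (φT t y)‖⁻¹ : ℝ) : ℂ) • P (c (m + 1) t) y (φT t y),
        ?_, ?_, ?_, ?_, ?_⟩
      · have hφT : Continuous fun x : ℝ × Y => φT x.1 x.2 :=
          hc.comp ((continuous_fst.min continuous_const).prodMk continuous_snd)
        have hPc : Continuous fun x : ℝ × Y => P (c (m + 1) x.1) x.2 (φT x.1 x.2) :=
          (hP.comp (((hcc (m + 1)).comp continuous_fst).prodMk continuous_snd)).clm_apply hφT
        exact (Complex.continuous_ofReal.comp (hPc.norm.inv₀ fun x =>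
          norm_ne_zero_iff.2 (hnz x.1 x.2))).smul hPc
      · intro t y
        rw [norm_smul, Complex.norm_real, norm_inv, norm_norm,
          inv_mul_cancel₀ (norm_ne_zero_iff.2 (hnz t y))]
      · intro t ht y
        rw [← hcT _ _ ht, map_smul, hPP]
      · intro y t ht
        by_cases hT : 0 ≤ T
        · have hz : c (m + 1) t = 0 :=
            max_eq_left ((min_le_left _ _).trans ((min_le_left _ _).trans ht))
          have h2 : φT t y = φ₀ y := hi y _ ((min_le_left _ _).trans ht)
          simp only [hz, h2, h0, h1]
          simp
        · have hz : c (m + 1) t = 0 := by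
            refine max_eq_left ((min_le_left _ _).trans ((min_le_left _ _).trans ht))
          have h2 : φT t y = φ₀ y := hi y _ ((min_le_left _ _).trans ht)
          simp only [hz, h2, h0, h1]
          simp
      · intro y y' hyP hy t
        have h2 : φT t y = φT t y' := hd y y' hyP hy _
        simp only [h2, hyP]
  obtain ⟨m, hm⟩ := exists_nat_ge (T / (δ / 2))
  obtain ⟨φ, hc, hn, hPφ, hi, hd⟩ := hstep m
  refine ⟨φ, hc, hn, fun t ht y => ?_, fun y => hi y 0 le_rfl, hd⟩
  have h2 := hPφ t ht.2 y
  rwa [min_eq_left, max_eq_right ht.1] at h2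
  rw [div_le_iff₀ (by positivity)] at hm
  exact ht.2.trans hm

/-- A continuous function to the unit circle has a continuous argument. -/
theorem exists_continuous_arg {T : ℝ} (hT : 0 < T) {g : ℝ → ℂ} (hg : ContinuousOn g (Icc 0 T))
    (h1 : ∀ y ∈ Icc 0 T, ‖g y‖ = 1) :
    ∃ θ : ℝ → ℝ, Continuous θ ∧ ∀ y ∈ Icc 0 T, g y = Complex.exp (Complex.I * θ y) := by
  have hmem : ∀ s : unitInterval, T * (s : ℝ) ∈ Icc 0 T := fun s =>
    ⟨mul_nonneg hT.le s.2.1, mul_le_of_le_one_right hT.le s.2.2⟩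
  let γ : C(unitInterval, Circle) :=
    ⟨fun s => ⟨g (T * s), mem_sphere_zero_iff_norm.2 (h1 _ (hmem s))⟩,
      Continuous.subtype_mk (hg.comp_continuous (by fun_prop) hmem) _⟩
  obtain ⟨a, ha⟩ := Circle.exp_surjective (γ 0)
  let Γ := Circle.isAddQuotientCoveringMap_exp.isCoveringMap.liftPath γ a ha.symm
  have hΓ : ∀ s, Circle.exp (Γ s) = γ s := fun s => congrFun
    (Circle.isAddQuotientCoveringMap_exp.isCoveringMap.liftPath_lifts γ a ha.symm) s
  refine ⟨fun y => Γ (projIcc 0 1 zero_le_one (y / T)),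
    Γ.continuous.comp (continuous_projIcc.comp (by fun_prop)), fun y hy => ?_⟩
  have h2 := congrArg (fun z : Circle => (z : ℂ)) (hΓ (projIcc 0 1 zero_le_one (y / T)))
  have h3 : y / T ∈ Icc (0 : ℝ) 1 := ⟨div_nonneg hy.1 hT.le, (div_le_one hT).2 hy.2⟩
  have h4 : ((γ (projIcc 0 1 zero_le_one (y / T)) : Circle) : ℂ) = g y := by
    change g (T * _) = _
    rw [projIcc_of_mem _ h3, mul_div_cancel₀ _ hT.ne']
  simp only [h4, Circle.coe_exp] at h2
  rw [← h2, mul_comm]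

variable {n : ℕ} {H : Hamiltonian n} {E : Fin n → ℝ → ℝ → ℝ}

theorem exp_I_mul_eq_one_iff {x : ℝ} :
    Complex.exp (Complex.I * x) = 1 ↔ ∃ m : ℤ, x = 2 * π * m := by
  rw [Complex.exp_eq_one_iff]
  refine exists_congr fun m => ⟨fun h => ?_, fun h => ?_⟩
  · have h2 : Complex.I * x = Complex.I * ((2 * π * m : ℝ) : ℂ) := by rw [h]; push_cast; ring
    exact_mod_cast mul_left_cancel₀ Complex.I_ne_zero h2
  · rw [h]; push_cast; ring

theorem norm_exp_I_mul (x : ℝ) : ‖Complex.exp (Complex.I * x)‖ = 1 := by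
  rw [mul_comm, Complex.norm_exp_ofReal_mul_I]

theorem exists_eq_exp_I_mul {z : ℂ} (h : ‖z‖ = 1) : ∃ β : ℝ, z = Complex.exp (Complex.I * β) := by
  refine ⟨z.arg, ?_⟩
  have := Complex.norm_mul_exp_arg_mul_I z
  rw [h, Complex.ofReal_one, one_mul] at this
  rw [mul_comm Complex.I]
  exact this.symm

theorem exists_periodic_section {F : Type*} [NormedAddCommGroup F] [InnerProductSpace ℂ F]
    (P : ℝ → F →L[ℂ] F) (hP : Continuous P) (hPP : ∀ t v, P t (P t v) = P t v)
    (hphase : ∀ t u v, P t u = u → P t v = v → ‖u‖ = 1 → v = ⟪u, v⟫_ℂ • u)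
    (hper : P (2 * π) = P 0) {b : F} (hb : ‖b‖ = 1) (hPb : P 0 b = b) :
    ∃ φ : ℝ → F, Continuous φ ∧ (∀ t, ‖φ t‖ = 1) ∧
      (∀ t ∈ Icc 0 (2 * π), P t (φ t) = φ t) ∧ φ (2 * π) = φ 0 := by
  have h2π : (0 : ℝ) < 2 * π := by positivity
  obtain ⟨ψ, hψc, hψ1, hψP, -, -⟩ := exists_transport (Y := Unit) (fun t _ => P t)
    (hP.comp continuous_fst) (fun t _ v => hPP t v) (φ₀ := fun _ => b) continuous_const
    (fun _ => hb) (fun _ => hPb) (2 * π)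
  have hψ0 := hψP 0 ⟨le_rfl, h2π.le⟩ ()
  have hψ2 := hψP (2 * π) ⟨h2π.le, le_rfl⟩ ()
  rw [hper] at hψ2
  have hu := hphase 0 _ _ hψ0 hψ2 (hψ1 _ _)
  have hu1 : ‖⟪ψ 0 (), ψ (2 * π) ()⟫_ℂ‖ = 1 := by
    have := congrArg norm hu
    rw [norm_smul, hψ1, hψ1, mul_one] at this
    exact this.symm
  obtain ⟨β, hβ⟩ : ∃ β : ℝ, ⟪ψ 0 (), ψ (2 * π) ()⟫_ℂ = Complex.exp (Complex.I * β) :=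
    exists_eq_exp_I_mul hu1
  rw [hβ] at hu
  refine ⟨fun y => Complex.exp (Complex.I * (-(β * (y / (2 * π))) : ℝ)) • ψ y (), ?_, ?_, ?_, ?_⟩
  · exact Continuous.smul (by fun_prop) (hψc.comp (continuous_id.prodMk continuous_const))
  · intro y
    rw [norm_smul, norm_exp_I_mul, hψ1, one_mul]
  · intro y hy
    rw [map_smul, hψP y hy ()]
  · simp only
    rw [hu, div_self h2π.ne', smul_smul, ← Complex.exp_add]
    simp

theorem exists_twisted_section {F : Type*} [NormedAddCommGroup F] [InnerProductSpace ℂ F]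
    (P : ℝ → ℝ → F →L[ℂ] F) (hP : Continuous fun k : ℝ × ℝ => P k.1 k.2)
    (hPP : ∀ s t v, P s t (P s t v) = P s t v)
    (hphase : ∀ s t u v, P s t u = u → P s t v = v → ‖u‖ = 1 → v = ⟪u, v⟫_ℂ • u)
    (hper : ∀ s, P s (2 * π) = P s 0) (hper' : ∀ t, P (2 * π) t = P 0 t)
    {b : F} (hb : ‖b‖ = 1) (hPb : P 0 0 b = b) :
    ∃ (φ : ℝ → ℝ → F) (θ : ℝ → ℝ) (c : ℤ), Continuous (Function.uncurry φ) ∧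
      (∀ s t, ‖φ s t‖ = 1) ∧
      (∀ s ∈ Icc 0 (2 * π), ∀ t ∈ Icc 0 (2 * π), P s t (φ s t) = φ s t) ∧ Continuous θ ∧
      (∀ t ∈ Icc 0 (2 * π), φ (2 * π) t = Complex.exp (Complex.I * θ t) • φ 0 t) ∧
      (∀ s, φ s (2 * π) = φ s 0) ∧ θ (2 * π) - θ 0 = 2 * π * c := by
  have h2π : (0 : ℝ) < 2 * π := by positivity
  obtain ⟨φ₀, hφ₀c, hφ₀1, hφ₀P, hφ₀per⟩ := exists_periodic_section (P 0)
    (hP.comp (continuous_const.prodMk continuous_id)) (hPP 0) (hphase 0) (hper 0) hb hPb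
  let Y := Icc (0 : ℝ) (2 * π)
  obtain ⟨φ, hc, hn, hPφ, -, hd⟩ := exists_transport (Y := Y) (fun t y => P t y)
    (hP.comp (continuous_fst.prodMk (continuous_subtype_val.comp continuous_snd)))
    (fun t y v => hPP t y v) (φ₀ := fun y : Y => φ₀ y) (hφ₀c.comp continuous_subtype_val)
    (fun y => hφ₀1 y) (fun y => hφ₀P y y.2) (2 * π)
  let q : ℝ → Y := projIcc 0 (2 * π) h2π.le
  have hq : Continuous q := continuous_projIcc
  have hqy : ∀ y (hy : y ∈ Icc 0 (2 * π)), ((q y : Y) : ℝ) = y := fun y hy =>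
    congrArg Subtype.val (projIcc_of_mem h2π.le hy)
  have hmem0 : (0 : ℝ) ∈ Icc 0 (2 * π) := ⟨le_rfl, h2π.le⟩
  have hmem1 : 2 * π ∈ Icc 0 (2 * π) := ⟨h2π.le, le_rfl⟩
  have hφper : ∀ t, φ t (q (2 * π)) = φ t (q 0) := by
    refine hd _ _ (fun t => ?_) ?_
    · rw [hqy _ hmem0, hqy _ hmem1, hper]
    · rw [hqy _ hmem0, hqy _ hmem1, hφ₀per]
  have hφ0 := fun y : Y => hPφ 0 hmem0 y
  have hφ2 := fun y : Y => hPφ (2 * π) hmem1 y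
  simp only [hper'] at hφ2
  have hgφ : ∀ y, φ (2 * π) y = ⟪φ 0 y, φ (2 * π) y⟫_ℂ • φ 0 y := fun y =>
    hphase 0 y _ _ (hφ0 y) (hφ2 y) (hn _ _)
  let g : ℝ → ℂ := fun y => ⟪φ 0 (q y), φ (2 * π) (q y)⟫_ℂ
  have hgc : Continuous g :=
    (hc.comp (continuous_const.prodMk hq)).inner (hc.comp (continuous_const.prodMk hq))
  have hg1 : ∀ y, ‖g y‖ = 1 := fun y => by
    have := congrArg norm (hgφ (q y))
    rw [norm_smul, hn, hn, mul_one] at this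
    exact this.symm
  obtain ⟨θ, hθc, hθ⟩ := exists_continuous_arg h2π hgc.continuousOn fun y _ => hg1 y
  have hg01 : g (2 * π) = g 0 := by
    simp only [g, hφper]
  obtain ⟨c, hcθ⟩ : ∃ c : ℤ, θ (2 * π) - θ 0 = 2 * π * c := by
    rw [← exp_I_mul_eq_one_iff]
    have h3 := hg01
    rw [hθ _ hmem0, hθ _ hmem1] at h3
    rw [Complex.ofReal_sub, mul_sub, Complex.exp_sub, h3, div_self (Complex.exp_ne_zero _)]
  refine ⟨fun kx ky => φ kx (q ky), θ, c, ?_, fun _ _ => hn _ _, ?_, hθc, ?_, hφper, hcθ⟩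
  · exact hc.comp (continuous_fst.prodMk (hq.comp continuous_snd))
  · intro kx hkx ky hky
    have := hPφ kx hkx (q ky)
    rwa [hqy ky hky] at this
  · intro ky hky
    rw [← hθ ky hky]
    exact hgφ (q ky)

theorem IsGappedBands.exists_isChernNumber (hE : IsGappedBands H E) (j : Fin n) :
    ∃ c : ℤ, IsChernNumber H (E j) c := by
  obtain ⟨φ, θ, c, h1, h2, h3, h4, h5, h6, h7⟩ := exists_twisted_section (hE.proj j)
    (hE.continuous_proj j) (hE.proj_proj j) (fun s t u v hu hv h => hE.eq_smul_of_proj hu hv h)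
    (fun t => hE.proj_eq_of_blochOp_eq (by rw [← H.blochOp_add_two_pi_right t 0, zero_add]) j)
    (fun t => hE.proj_eq_of_blochOp_eq (by rw [← H.blochOp_add_two_pi_left 0 t, zero_add]) j)
    ((hE.basis 0 0).orthonormal.1 j)
    (by rw [hE.proj_apply, (hE.basis 0 0).inner_eq_one, one_smul])
  exact ⟨c, φ, θ, h1.continuousOn,
    fun s hs t ht => ⟨h2 s t, hE.blochOp_of_proj (h3 s hs t ht)⟩, h4.continuousOn, h5,
    fun s _ => h6 s, h7⟩

theorem IsGappedBands.exists_gap (hE : IsGappedBands H E) (h : ∀ j kx ky, E j kx ky ≠ 0) :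
    ∃ δ > 0, ∀ j, ∀ kx ∈ Icc 0 (2 * π), ∀ ky ∈ Icc 0 (2 * π), δ ≤ |E j kx ky| := by
  have h1 : ∀ j, ∃ δ > 0, ∀ kx ∈ Icc 0 (2 * π), ∀ ky ∈ Icc 0 (2 * π), δ ≤ |E j kx ky| := by
    intro j
    have hne : (Icc 0 (2 * π) ×ˢ Icc 0 (2 * π) : Set (ℝ × ℝ)).Nonempty :=
      ⟨(0, 0), by constructor <;> exact ⟨le_rfl, by positivity⟩⟩
    obtain ⟨k, -, hk⟩ := (isCompact_Icc.prod isCompact_Icc).exists_isMinOn hne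
      (hE.continuous_energy j).abs.continuousOn
    exact ⟨|E j k.1 k.2|, abs_pos.2 (h _ _ _), fun kx hkx ky hky => hk (Set.mk_mem_prod hkx hky)⟩
  choose δ hδ hle using h1
  by_cases hn : Nonempty (Fin n)
  · refine ⟨Finset.univ.inf' Finset.univ_nonempty δ, (Finset.lt_inf'_iff _).2 fun j _ => hδ j,
      fun j kx hkx ky hky => (Finset.inf'_le _ (Finset.mem_univ j)).trans (hle j kx hkx ky hky)⟩
  · exact ⟨1, one_pos, fun j => absurd ⟨j⟩ hn⟩

end Frames

section Trigonometric

open Module Topology Filter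
open scoped InnerProductSpace

theorem dense_trigPoly {Y : Type*} [TopologicalSpace Y] [CompactSpace Y] {T : ℝ} [Fact (0 < T)]
    (hY : ∃ f : C(Y, ℂ), Function.Injective f) (F : C(AddCircle T × Y, ℂ)) {ε : ℝ} (hε : 0 < ε) :
    ∃ a : ℤ →₀ C(Y, ℂ), ∀ x y, ‖F (x, y) - a.sum fun d c => fourier d x * c y‖ < ε := by
  let m : ℤ → C(Y, ℂ) → C(AddCircle T × Y, ℂ) := fun d c =>
    (fourier d).comp ContinuousMap.fst * c.comp ContinuousMap.snd
  let S : Set C(AddCircle T × Y, ℂ) := range fun p : ℤ × C(Y, ℂ) => m p.1 p.2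
  let A : StarSubalgebra ℂ C(AddCircle T × Y, ℂ) :=
    { toSubalgebra := Algebra.adjoin ℂ S
      star_mem' := by
        change Algebra.adjoin ℂ S ≤ star (Algebra.adjoin ℂ S)
        refine Algebra.adjoin_le ?_
        rintro - ⟨⟨d, c⟩, rfl⟩
        refine Algebra.subset_adjoin ⟨(-d, star c), ?_⟩
        ext p
        simp only [m, ContinuousMap.mul_apply, ContinuousMap.comp_apply, ContinuousMap.star_apply,
          fourier_neg, star_mul']
        rfl }
  let L : (ℤ →₀ C(Y, ℂ)) →ₗ[ℂ] C(AddCircle T × Y, ℂ) := Finsupp.lsum ℂ fun d =>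
    { toFun := m d
      map_add' := fun c c' => by ext p; simp [m, mul_add]
      map_smul' := fun z c => by ext p; simp [m] }
  have hspan : Subalgebra.toSubmodule (Algebra.adjoin ℂ S) ≤ LinearMap.range L := by
    rw [Algebra.adjoin_eq_span_of_subset]
    · refine Submodule.span_le.2 ?_
      rintro - ⟨⟨d, c⟩, rfl⟩
      exact ⟨Finsupp.single d c, (Finsupp.lsum_single ℂ _ d c).trans rfl⟩
    · refine Subset.trans ?_ Submodule.subset_span
      intro x hx
      refine Submonoid.closure_induction (fun _ => id) ⟨(0, 1), ?_⟩ ?_ hx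
      · ext p; simp [m]
      · rintro - - - - ⟨⟨d, c⟩, rfl⟩ ⟨⟨d', c'⟩, rfl⟩
        refine ⟨(d + d', c * c'), ?_⟩
        ext p
        simp only [m, ContinuousMap.mul_apply, ContinuousMap.comp_apply, fourier_add]
        ring
  have hsep : A.SeparatesPoints := by
    rintro ⟨x, y⟩ ⟨x', y'⟩ hne
    by_cases hx : x = x'
    · obtain ⟨f, hf⟩ := hY
      refine ⟨_, ⟨m 0 f, Algebra.subset_adjoin ⟨(0, f), rfl⟩, rfl⟩, ?_⟩
      have hy : y ≠ y' := fun h => hne (by rw [hx, h])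
      simpa [m] using hf.ne hy
    · refine ⟨_, ⟨m 1 1, Algebra.subset_adjoin ⟨(1, 1), rfl⟩, rfl⟩, ?_⟩
      have : fourier (T := T) 1 x ≠ fourier 1 x' := by
        rw [fourier_one, fourier_one]
        intro h
        exact hx (AddCircle.injective_toCircle (Fact.out : 0 < T).ne' (Subtype.ext h))
      simpa [m] using this
  have htop := ContinuousMap.starSubalgebra_topologicalClosure_eq_top_of_separatesPoints A hsep
  have hF : F ∈ closure (A : Set C(AddCircle T × Y, ℂ)) := by
    rw [← StarSubalgebra.topologicalClosure_coe, htop]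
    trivial
  obtain ⟨P, hP, hd⟩ := Metric.mem_closure_iff.1 hF ε hε
  obtain ⟨a, ha⟩ := hspan hP
  refine ⟨a, fun x y => ?_⟩
  have h1 : P (x, y) = a.sum fun d c => fourier d x * c y := by
    rw [← ha]
    simp only [L, Finsupp.coe_lsum, Finsupp.sum, ContinuousMap.coe_sum, Finset.sum_apply]
    rfl
  rw [← h1]
  rw [dist_eq_norm] at hd
  exact (ContinuousMap.norm_coe_le_norm (F - P) (x, y)).trans_lt hd

theorem exists_trigPoly_complex {f : ℝ → ℝ → ℂ}
    (hf : ContinuousOn (Function.uncurry f) (Icc 0 (2 * π) ×ˢ Icc 0 (2 * π)))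
    (hper : ∀ y ∈ Icc 0 (2 * π), f (2 * π) y = f 0 y) {ε : ℝ} (hε : 0 < ε) :
    ∃ (r : ℕ) (a : ℤ → ℝ → ℂ), (∀ d, Continuous (a d)) ∧ (∀ d, (r : ℤ) < |d| → a d = 0) ∧
      ∀ x ∈ Icc 0 (2 * π), ∀ y ∈ Icc 0 (2 * π),
        ‖f x y - ∑ d ∈ Finset.Icc (-r : ℤ) r, Complex.exp (Complex.I * (x * d)) * a d y‖ < ε := by
  have h2π : (0 : ℝ) < 2 * π := by positivity
  have : Fact (0 < 2 * π) := ⟨h2π⟩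
  let Y := Icc (0 : ℝ) (2 * π)
  let q : ℝ → Y := projIcc 0 (2 * π) h2π.le
  have hq : Continuous q := continuous_projIcc
  have hqm : ∀ x (hx : x ∈ Icc 0 (2 * π)), q x = ⟨x, hx⟩ := fun x hx => projIcc_of_mem _ hx
  have hf' : Continuous fun p : Y × Y => f p.1 p.2 :=
    hf.comp_continuous (f := fun p : Y × Y => ((p.1 : ℝ), (p.2 : ℝ))) (by fun_prop)
      fun p => ⟨p.1.2, p.2.2⟩
  let g : ℝ → C(Y, ℂ) := fun x => ⟨fun y => f (q x) y,
    hf'.comp (continuous_const.prodMk continuous_id)⟩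
  have hg : Continuous g := ContinuousMap.continuous_of_continuous_uncurry _
    (hf'.comp ((hq.comp continuous_fst).prodMk continuous_snd))
  have hg0 : g 0 = g (2 * π) := by
    ext y
    simp only [g, ContinuousMap.coe_mk, hqm 0 ⟨le_rfl, h2π.le⟩, hqm (2 * π) ⟨h2π.le, le_rfl⟩]
    exact (hper y y.2).symm
  let F₀ : C(AddCircle (2 * π), C(Y, ℂ)) := ⟨AddCircle.liftIco (2 * π) 0 g,
    AddCircle.liftIco_zero_continuous hg0 hg.continuousOn⟩
  have hF₀ : ∀ x ∈ Icc 0 (2 * π), F₀ (x : AddCircle (2 * π)) = g x := by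
    intro x hx
    rcases hx.2.eq_or_lt with h | h
    · rw [h, AddCircle.coe_period, ← hg0, ← AddCircle.coe_zero]
      exact AddCircle.liftIco_zero_coe_apply (f := g) ⟨le_rfl, h2π⟩
    · exact AddCircle.liftIco_zero_coe_apply (f := g) ⟨hx.1, h⟩
  obtain ⟨a, ha⟩ := dense_trigPoly (T := 2 * π) (Y := Y)
    ⟨⟨fun y => ((y : ℝ) : ℂ), by fun_prop⟩, fun y y' h => Subtype.ext (Complex.ofReal_injective h)⟩
    F₀.uncurry hε
  obtain ⟨r, hr⟩ : ∃ r : ℕ, ∀ d ∈ a.support, |d| ≤ r :=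
    ⟨a.support.sup Int.natAbs, fun d hd => by
      have := Finset.le_sup (f := Int.natAbs) hd
      rw [Int.abs_eq_natAbs]
      exact_mod_cast this⟩
  refine ⟨r, fun d y => a d (q y), fun d => (a d).continuous.comp hq, fun d hd => ?_,
    fun x hx y hy => ?_⟩
  · have : a d = 0 := by
      by_contra hc
      exact absurd (hr d (Finsupp.mem_support_iff.2 hc)) (not_le.2 hd)
    funext y
    simp [this]
  · have h1 := ha x (q y)
    have h2 : F₀.uncurry (↑x, q y) = f x y := by
      rw [ContinuousMap.uncurry_apply, Function.uncurry_apply_pair, hF₀ x hx]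
      simp only [g, ContinuousMap.coe_mk, hqm x hx, hqm y hy]
    rw [h2, Finsupp.sum_of_support_subset (s := Finset.Icc (-r : ℤ) r)] at h1
    · convert h1 using 5 with d hd
      rw [fourier_coe_apply]
      congr 1
      push_cast
      field_simp
    · intro d hd
      rw [Finset.mem_Icc, ← abs_le]
      exact hr d hd
    · intro d _
      simp

theorem exists_trigPoly {W : Type*} [NormedAddCommGroup W] [NormedSpace ℂ W]
    [FiniteDimensional ℂ W] {f : ℝ → ℝ → W}
    (hf : ContinuousOn (Function.uncurry f) (Icc 0 (2 * π) ×ˢ Icc 0 (2 * π)))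
    (hper : ∀ y ∈ Icc 0 (2 * π), f (2 * π) y = f 0 y) {ε : ℝ} (hε : 0 < ε) :
    ∃ (r : ℕ) (a : ℤ → ℝ → W), (∀ d, Continuous (a d)) ∧
      ∀ x ∈ Icc 0 (2 * π), ∀ y ∈ Icc 0 (2 * π),
        ‖f x y - ∑ d ∈ Finset.Icc (-r : ℤ) r, Complex.exp (Complex.I * (x * d)) • a d y‖ < ε := by
  let e : W ≃L[ℂ] (Fin (finrank ℂ W) → ℂ) := (finBasis ℂ W).equivFun.toContinuousLinearEquiv
  let M := ‖(e.symm : (Fin (finrank ℂ W) → ℂ) →L[ℂ] W)‖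
  have hM : 0 < M + 1 := by positivity
  choose r a ha hr hfa using fun i => exists_trigPoly_complex (f := fun x y => e (f x y) i)
    ((continuous_apply i).comp_continuousOn (e.continuous.comp_continuousOn hf))
    (fun y hy => by rw [hper y hy]) (div_pos hε hM)
  let R := Finset.univ.sup r
  refine ⟨R, fun d y => e.symm fun i => a i d y,
    fun d => e.symm.continuous.comp (continuous_pi fun i => ha i d), fun x hx y hy => ?_⟩
  have h1 : f x y - ∑ d ∈ Finset.Icc (-R : ℤ) R, Complex.exp (Complex.I * (x * d)) •
      e.symm (fun i => a i d y) = e.symm (e (f x y) - ∑ d ∈ Finset.Icc (-R : ℤ) R,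
        Complex.exp (Complex.I * (x * d)) • (fun i => a i d y)) := by
    simp only [map_sub, map_sum, map_smul, ContinuousLinearEquiv.symm_apply_apply]
  rw [h1]
  have h2 : ‖e (f x y) - ∑ d ∈ Finset.Icc (-R : ℤ) R,
        Complex.exp (Complex.I * (x * d)) • (fun i => a i d y)‖ ≤ ε / (M + 1) := by
    refine (pi_norm_le_iff_of_nonneg (by positivity)).2 fun i => ?_
    have h3 := (hfa i x hx y hy).le
    rw [Pi.sub_apply, Finset.sum_apply]
    simp only [Pi.smul_apply, smul_eq_mul]
    rwa [← Finset.sum_subset (s₁ := Finset.Icc (-(r i) : ℤ) (r i))]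
    · have : r i ≤ R := Finset.le_sup (Finset.mem_univ i)
      intro d hd
      rw [Finset.mem_Icc] at hd ⊢
      omega
    · intro d _ hd
      rw [Finset.mem_Icc, ← abs_le, not_le] at hd
      rw [hr i d hd]
      simp
  calc _ ≤ M * (ε / (M + 1)) := (e.symm : (Fin (finrank ℂ W) → ℂ) →L[ℂ] W).le_of_opNorm_le_of_le
        le_rfl h2
    _ = ε * (M / (M + 1)) := by ring
    _ < ε * 1 := by
        refine mul_lt_mul_of_pos_left ?_ hε
        rw [div_lt_one hM]
        linarith
    _ = ε := mul_one _

end Trigonometric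

section LocalOperators

open Module Topology Filter
open scoped InnerProductSpace

variable {E : Type*} [NormedAddCommGroup E] [InnerProductSpace ℂ E]

/-- `(A w)(p)` depends only on the `w(q)` with `|q - p| ≤ r`. -/
def HasRange (A : lp (fun _ : ℤ => E) 2 →L[ℂ] lp (fun _ : ℤ => E) 2) (r : ℕ) : Prop :=
  ∀ (w : lp (fun _ : ℤ => E) 2) (p : ℤ), (∀ q : ℤ, |q - p| ≤ r → w q = 0) → A w p = 0

theorem HasRange.mono {A : lp (fun _ : ℤ => E) 2 →L[ℂ] lp (fun _ : ℤ => E) 2} {r s : ℕ}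
    (h : HasRange A r) (hrs : r ≤ s) : HasRange A s := fun w p hw =>
  h w p fun q hq => hw q (hq.trans (by exact_mod_cast hrs))

/-- Translation-invariant operators of finite range `r`, with symbol `σ`. -/
structure IsConv [CompleteSpace E]
    (A : lp (fun _ : ℤ => E) 2 →L[ℂ] lp (fun _ : ℤ => E) 2) (r : ℕ) (σ : ℝ → E →L[ℂ] E) : Prop where
  range : HasRange A r
  symbol : HasSymbol A σ
  adjoint : HasSymbol A.adjoint fun t => (σ t).adjoint

variable {A B : lp (fun _ : ℤ => E) 2 →L[ℂ] lp (fun _ : ℤ => E) 2} {r s : ℕ}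
  {σ τ : ℝ → E →L[ℂ] E}

theorem HasSymbol.add (hA : HasSymbol A σ) (hB : HasSymbol B τ) :
    HasSymbol (A + B) fun t => σ t + τ t := fun w => by
  obtain ⟨a, h1, h2⟩ := hA w
  obtain ⟨b, h3, h4⟩ := hB w
  exact ⟨a + b, by rw [add_apply, h1, h3, map_add], fun t => by rw [map_add, h2, h4, add_apply]⟩

theorem HasSymbol.smul (hA : HasSymbol A σ) (c : ℂ) :
    HasSymbol (c • A) fun t => c • σ t := fun w => by
  obtain ⟨a, h1, h2⟩ := hA w
  exact ⟨c • a, by rw [smul_apply, h1, map_smul], fun t => by rw [map_smul, h2, smul_apply]⟩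

variable [CompleteSpace E]

theorem IsConv.mono (h : IsConv A r σ) (hrs : r ≤ s) : IsConv A s σ :=
  ⟨h.range.mono hrs, h.symbol, h.adjoint⟩

theorem IsConv.add (hA : IsConv A r σ) (hB : IsConv B r τ) :
    IsConv (A + B) r fun t => σ t + τ t where
  range := fun w p hw => by
    rw [add_apply, lp.coeFn_add, Pi.add_apply, hA.range w p hw, hB.range w p hw, add_zero]
  symbol := hA.symbol.add hB.symbol
  adjoint := by
    simp only [map_add]
    exact hA.adjoint.add hB.adjoint

theorem IsConv.smul (hA : IsConv A r σ) (c : ℂ) : IsConv (c • A) r fun t => c • σ t where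
  range := fun w p hw => by
    rw [smul_apply, lp.coeFn_smul, Pi.smul_apply, hA.range w p hw, smul_zero]
  symbol := hA.symbol.smul c
  adjoint := by
    simp only [map_smulₛₗ]
    exact hA.adjoint.smul _

theorem IsConv.mul (hA : IsConv A r σ) (hB : IsConv B s τ) :
    IsConv (A * B) (r + s) fun t => σ t * τ t where
  range := fun w p hw => by
    rw [mul_apply_eq_comp]
    refine hA.range _ p fun q hq => hB.range w q fun q' hq' => hw q' ?_
    push_cast
    have := abs_sub_le q' q p
    omega
  symbol := hA.symbol.mul hB.symbol
  adjoint := by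
    have := hB.adjoint.mul hA.adjoint
    simp only [← ContinuousLinearMap.star_eq_adjoint, star_mul] at this ⊢
    exact this

theorem isConv_convOp (r : ℕ) (g : ℤ → E →L[ℂ] E) : IsConv (convOp r g) r (convSymbol r g) where
  range := fun w p hw => by
    rw [convOp_apply]
    refine Finset.sum_eq_zero fun d hd => ?_
    rw [hw, map_zero]
    rw [Finset.mem_Icc, ← abs_le] at hd
    rwa [sub_sub_cancel_left, abs_neg]
  symbol := hasSymbol_convOp r g
  adjoint := hasSymbol_adjoint_convOp r g

theorem isUnit_of_le_norm {K : Type*} [NormedAddCommGroup K] [InnerProductSpace ℂ K]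
    [CompleteSpace K] {G : K →L[ℂ] K} {c : ℝ} (hc : 0 < c) (h : ∀ w, c * ‖w‖ ^ 2 ≤ ‖G w‖ ^ 2)
    (h' : ∀ w, c * ‖w‖ ^ 2 ≤ ‖G.adjoint w‖ ^ 2) : IsUnit G := by
  have key : ∀ G : K →L[ℂ] K, (∀ w, c * ‖w‖ ^ 2 ≤ ‖G w‖ ^ 2) → IsUnit (G.adjoint * G) := by
    intro G h
    refine ContinuousLinearMap.isUnit_of_forall_le_norm_inner_map _ (c := ⟨c, hc.le⟩) hc
      fun x => ?_
    refine le_trans ?_ (Complex.re_le_norm _)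
    rw [mul_apply_eq_comp, ContinuousLinearMap.adjoint_inner_left, inner_self_eq_norm_sq_to_K]
    refine le_trans (le_of_eq ?_) ((h x).trans (le_of_eq ?_))
    · exact mul_comm _ _
    · norm_cast
  obtain ⟨a, ha⟩ := (key G h).exists_left_inv
  obtain ⟨b, hb⟩ := (key G.adjoint h').exists_right_inv
  rw [ContinuousLinearMap.adjoint_adjoint] at hb
  exact isUnit_iff_exists_and_exists.2 ⟨⟨G.adjoint * b, by rw [← mul_assoc]; exact hb⟩,
    ⟨a * G.adjoint, by rw [mul_assoc]; exact ha⟩⟩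

end LocalOperators

section Trivialization

open Module Topology Filter
open scoped InnerProductSpace

variable {n : ℕ}

/-- The multiplication by `s j` in the `j`-th coordinate. -/
def coordMul (s : Fin n → ℂ) : EuclideanSpace ℂ (Fin n) →L[ℂ] EuclideanSpace ℂ (Fin n) :=
  Matrix.toEuclideanCLM (𝕜 := ℂ) (Matrix.diagonal s)

theorem coordMul_apply (s : Fin n → ℂ) (v : EuclideanSpace ℂ (Fin n)) (j : Fin n) :
    coordMul s v j = s j * v j := by
  simp [coordMul, Matrix.mulVec_diagonal]

theorem norm_coordMul_apply {s : Fin n → ℂ} (hs : ∀ j, ‖s j‖ = 1)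
    (v : EuclideanSpace ℂ (Fin n)) : ‖coordMul s v‖ = ‖v‖ := by
  simp only [EuclideanSpace.norm_eq, coordMul_apply, norm_mul, hs, one_mul]

/-- The symbol of `bandShift`. -/
def bandPhase (c : Fin n → ℤ) (t : ℝ) :
    EuclideanSpace ℂ (Fin n) →L[ℂ] EuclideanSpace ℂ (Fin n) :=
  coordMul fun j => Complex.exp (Complex.I * (t * (-c j : ℤ)))

/-- The translation of the `j`-th coordinate by `-c j`. -/
def bandShift (c : Fin n → ℤ) : lp (fun _ : ℤ => EuclideanSpace ℂ (Fin n)) 2 →L[ℂ]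
    lp (fun _ : ℤ => EuclideanSpace ℂ (Fin n)) 2 :=
  convOp (∑ j, (c j).natAbs) fun d => coordMul fun j => if d = -c j then 1 else 0

theorem neg_mem_Icc_sum_natAbs (c : Fin n → ℤ) (j : Fin n) :
    -c j ∈ Finset.Icc (-(∑ j, (c j).natAbs : ℕ) : ℤ) (∑ j, (c j).natAbs : ℕ) := by
  have : (c j).natAbs ≤ ∑ j, (c j).natAbs :=
    Finset.single_le_sum (f := fun j => (c j).natAbs) (fun _ _ => Nat.zero_le _) (Finset.mem_univ j)
  rw [Finset.mem_Icc]
  omega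

theorem bandShift_apply (c : Fin n → ℤ) (w : lp (fun _ : ℤ => EuclideanSpace ℂ (Fin n)) 2)
    (p : ℤ) (j : Fin n) : bandShift c w p j = w (p + c j) j := by
  unfold bandShift
  rw [convOp_apply, WithLp.ofLp_sum, Finset.sum_apply, Finset.sum_eq_single (-c j)]
  · rw [coordMul_apply, if_pos rfl, one_mul, sub_neg_eq_add]
  · intro d _ hd
    rw [coordMul_apply, if_neg hd, zero_mul]
  · intro h
    exact absurd (neg_mem_Icc_sum_natAbs c j) h

theorem isConv_bandShift (c : Fin n → ℤ) :
    IsConv (bandShift c) (∑ j, (c j).natAbs) (bandPhase c) := by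
  have h : bandPhase c = convSymbol (∑ j, (c j).natAbs)
      fun d => coordMul fun j => if d = -c j then 1 else 0 := by
    funext t
    ext v j
    unfold convSymbol bandPhase
    rw [sum_apply, WithLp.ofLp_sum, Finset.sum_apply, Finset.sum_eq_single (-c j)]
    · rw [coordMul_apply, smul_apply, PiLp.smul_apply, coordMul_apply, if_pos rfl, one_mul,
        smul_eq_mul]
    · intro d _ hd
      rw [smul_apply, PiLp.smul_apply, coordMul_apply, if_neg hd, zero_mul, smul_zero]
    · intro h
      exact absurd (neg_mem_Icc_sum_natAbs c j) h
  rw [h]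
  exact isConv_convOp _ _

variable {H : Hamiltonian n} {E : Fin n → ℝ → ℝ → ℝ}

theorem IsGappedBands.orthonormal (hE : IsGappedBands H E) {kx ky : ℝ}
    {φ : Fin n → EuclideanSpace ℂ (Fin n)} (h1 : ∀ j, ‖φ j‖ = 1)
    (h2 : ∀ j, H.blochOp kx ky (φ j) = (E j kx ky : ℂ) • φ j) : Orthonormal ℂ φ := by
  refine ⟨h1, fun i j hij => ?_⟩
  have h := H.symmOp_blochOp kx ky (φ i) (φ j)
  rw [h2, h2, inner_smul_left, inner_smul_right, Complex.conj_ofReal, ← sub_eq_zero,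
    ← sub_mul] at h
  refine (mul_eq_zero.1 h).resolve_left ?_
  exact fun h => hij ((hE.strictMono kx ky).injective
    (by simpa [sub_eq_zero] using h))

/-- The operator whose columns are the vectors `φ j`. -/
def columnOp (φ : Fin n → EuclideanSpace ℂ (Fin n)) :
    EuclideanSpace ℂ (Fin n) →L[ℂ] EuclideanSpace ℂ (Fin n) :=
  ∑ j, ContinuousLinearMap.smulRight (EuclideanSpace.proj j : EuclideanSpace ℂ (Fin n) →L[ℂ] ℂ)
    (φ j)

theorem columnOp_apply (φ : Fin n → EuclideanSpace ℂ (Fin n)) (v : EuclideanSpace ℂ (Fin n)) :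
    columnOp φ v = ∑ j, v j • φ j := by
  simp [columnOp, sum_apply]

theorem inner_columnOp {φ : Fin n → EuclideanSpace ℂ (Fin n)} (h : Orthonormal ℂ φ)
    (u v : EuclideanSpace ℂ (Fin n)) : ⟪columnOp φ u, columnOp φ v⟫_ℂ = ⟪u, v⟫_ℂ := by
  rw [columnOp_apply, columnOp_apply, h.inner_sum, PiLp.inner_apply]
  exact Finset.sum_congr rfl fun j _ => by rw [RCLike.inner_apply, mul_comm]

theorem norm_columnOp_apply {φ : Fin n → EuclideanSpace ℂ (Fin n)} (h : Orthonormal ℂ φ)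
    (v : EuclideanSpace ℂ (Fin n)) : ‖columnOp φ v‖ = ‖v‖ := by
  rw [@norm_eq_sqrt_re_inner ℂ, inner_columnOp h, ← @norm_eq_sqrt_re_inner ℂ]

theorem norm_adjoint_columnOp_apply {φ : Fin n → EuclideanSpace ℂ (Fin n)}
    (h : Orthonormal ℂ φ) (v : EuclideanSpace ℂ (Fin n)) : ‖(columnOp φ).adjoint v‖ = ‖v‖ := by
  have hinj : Function.Injective
      (columnOp φ : EuclideanSpace ℂ (Fin n) →ₗ[ℂ] EuclideanSpace ℂ (Fin n)) := by
    rw [← LinearMap.ker_eq_bot, LinearMap.ker_eq_bot']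
    intro u hu
    rw [← norm_eq_zero, ← norm_columnOp_apply h]
    exact norm_eq_zero.2 hu
  obtain ⟨w, rfl⟩ := LinearMap.injective_iff_surjective.1 hinj v
  have : (columnOp φ).adjoint (columnOp φ w) = w := by
    refine ext_inner_left ℂ fun u => ?_
    rw [ContinuousLinearMap.adjoint_inner_right, inner_columnOp h]
  rw [ContinuousLinearMap.coe_coe, this, norm_columnOp_apply h]

theorem IsGappedBands.exists_frame (hE : IsGappedBands H E) {c : Fin n → ℤ}
    (hc : ∀ j, IsChernNumber H (E j) (c j)) :
    ∃ φ : ℝ → ℝ → Fin n → EuclideanSpace ℂ (Fin n),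
      ContinuousOn (fun k : ℝ × ℝ => columnOp (φ k.1 k.2)) (Icc 0 (2 * π) ×ˢ Icc 0 (2 * π)) ∧
      (∀ ky ∈ Icc 0 (2 * π), φ (2 * π) ky = φ 0 ky) ∧
      (∀ kx ∈ Icc 0 (2 * π),
        columnOp (φ kx (2 * π)) = columnOp (φ kx 0) * bandPhase c kx) ∧
      ∀ kx ∈ Icc 0 (2 * π), ∀ ky ∈ Icc 0 (2 * π), Orthonormal ℂ (φ kx ky) ∧
        ∀ j, H.blochOp kx ky (φ kx ky j) = (E j kx ky : ℂ) • φ kx ky j := by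
  have h2π : (0 : ℝ) < 2 * π := by positivity
  choose φ θ h1 h2 h3 h4 h5 h6 using hc
  refine ⟨fun kx ky j => Complex.exp (Complex.I * (-(kx * (θ j ky / (2 * π))) : ℝ)) • φ j kx ky,
    ?_, fun ky hky => ?_, fun kx hkx => ?_, fun kx hkx ky hky => ?_⟩
  · unfold columnOp
    refine continuousOn_finsetSum _ fun j _ => ?_
    refine (ContinuousLinearMap.smulRightL ℂ (EuclideanSpace ℂ (Fin n)) (EuclideanSpace ℂ (Fin n))
      (EuclideanSpace.proj j : EuclideanSpace ℂ (Fin n) →L[ℂ] ℂ)).continuous.comp_continuousOn ?_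
    have h7 : ContinuousOn (fun k : ℝ × ℝ => φ j k.1 k.2) (Icc 0 (2 * π) ×ˢ Icc 0 (2 * π)) := h1 j
    have h8 : ContinuousOn (fun k : ℝ × ℝ => θ j k.2) (Icc 0 (2 * π) ×ˢ Icc 0 (2 * π)) :=
      (h3 j).comp continuousOn_snd fun k hk => hk.2
    have h9 : ContinuousOn (fun k : ℝ × ℝ => -(k.1 * (θ j k.2 / (2 * π))))
        (Icc 0 (2 * π) ×ˢ Icc 0 (2 * π)) :=
      (continuousOn_fst.mul (h8.div_const _)).neg
    exact ((Complex.continuous_exp.comp (continuous_const.mul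
      Complex.continuous_ofReal)).comp_continuousOn h9).smul h7
  · funext j
    simp only
    rw [h4 j ky hky, smul_smul, ← Complex.exp_add]
    congr 1
    push_cast
    rw [Complex.exp_eq_exp_iff_exists_int]
    exact ⟨0, by field_simp; ring⟩
  · ext1 v
    rw [mul_apply_eq_comp, columnOp_apply, columnOp_apply]
    refine Finset.sum_congr rfl fun j _ => ?_
    simp only
    rw [h5 j kx hkx, bandPhase, coordMul_apply, smul_smul, smul_smul]
    congr 1
    have : θ j (2 * π) = θ j 0 + 2 * π * c j := by linarith [h6 j]
    rw [this, mul_comm (v j), mul_right_comm (Complex.exp _) (v j), ← Complex.exp_add]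
    congr 2
    push_cast
    field_simp
    ring
  · have key : ∀ j, H.blochOp kx ky (φ j kx ky) = (E j kx ky : ℂ) • φ j kx ky :=
      fun j => (h2 j kx hkx ky hky).2
    have key' : ∀ j, H.blochOp kx ky (Complex.exp (Complex.I * (-(kx * (θ j ky / (2 * π))) : ℝ))
        • φ j kx ky) = (E j kx ky : ℂ) •
          (Complex.exp (Complex.I * (-(kx * (θ j ky / (2 * π))) : ℝ)) • φ j kx ky) := fun j => by
      rw [map_smul, key, smul_comm]
    refine ⟨hE.orthonormal (fun j => ?_) key', key'⟩
    rw [norm_smul, norm_exp_I_mul, (h2 j kx hkx ky hky).1, one_mul]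

/-- The sign of the energies of the bands, the first `N` of them being occupied. -/
def bandSign (n N : ℕ) : EuclideanSpace ℂ (Fin n) →L[ℂ] EuclideanSpace ℂ (Fin n) :=
  coordMul fun j => if j.val < N then -1 else 1

theorem le_re_inner_columnOp {A : EuclideanSpace ℂ (Fin n) →L[ℂ] EuclideanSpace ℂ (Fin n)}
    {φ : Fin n → EuclideanSpace ℂ (Fin n)} (h : Orthonormal ℂ φ) {a : Fin n → ℝ}
    (hA : ∀ j, A (φ j) = (a j : ℂ) • φ j) {N : ℕ} {δ : ℝ} (hδ : ∀ j, δ ≤ |a j|)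
    (hocc : ∀ j : Fin n, j.val < N → a j < 0) (hunocc : ∀ j : Fin n, N ≤ j.val → 0 < a j)
    (v : EuclideanSpace ℂ (Fin n)) :
    δ * ‖v‖ ^ 2 ≤ (⟪columnOp φ (bandSign n N v), A (columnOp φ v)⟫_ℂ).re := by
  have h1 : A (columnOp φ v) = ∑ j, ((a j : ℂ) * v j) • φ j := by
    rw [columnOp_apply, map_sum]
    exact Finset.sum_congr rfl fun j _ => by rw [map_smul, hA, smul_smul, mul_comm]
  rw [h1, columnOp_apply, h.inner_sum, Complex.re_sum, EuclideanSpace.norm_sq_eq, Finset.mul_sum]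
  refine Finset.sum_le_sum fun j _ => ?_
  have h2 : (starRingEnd ℂ) (bandSign n N v j) * ((a j : ℂ) * v j)
      = ((|a j| * ‖v j‖ ^ 2 : ℝ) : ℂ) := by
    rw [bandSign, coordMul_apply, map_mul]
    have h3 : (starRingEnd ℂ) (v j) * v j = ((‖v j‖ ^ 2 : ℝ) : ℂ) := by
      rw [Complex.conj_mul']; push_cast; rfl
    by_cases hj : j.val < N
    · rw [if_pos hj, abs_of_neg (hocc j hj), map_neg, map_one, Complex.ofReal_mul, ← h3]
      push_cast; ring
    · rw [if_neg hj, abs_of_pos (hunocc j (not_lt.1 hj)), map_one, Complex.ofReal_mul, ← h3]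
      ring
  rw [h2, Complex.ofReal_re]
  exact mul_le_mul_of_nonneg_right (hδ j) (sq_nonneg _)

theorem le_norm_sq_of_close {F : Type*} [NormedAddCommGroup F] [NormedSpace ℂ F]
    {U X : F →L[ℂ] F} (hU : ∀ v, ‖U v‖ = ‖v‖) (hX : ‖X - U‖ ≤ 1 / 2) (v : F) :
    1 / 4 * ‖v‖ ^ 2 ≤ ‖X v‖ ^ 2 := by
  have h1 := (X - U).le_of_opNorm_le hX v
  have h2 : ‖v‖ ≤ ‖X v‖ + ‖(X - U) v‖ := by
    rw [← hU v, sub_apply, ← norm_neg (X v - U v)]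
    refine le_trans (le_of_eq ?_) (norm_add_le _ _)
    congr 1
    abel
  nlinarith [norm_nonneg v, norm_nonneg (X v)]

theorem le_re_inner_of_close {F : Type*} [NormedAddCommGroup F] [InnerProductSpace ℂ F]
    {U X J A : F →L[ℂ] F} {δ η M : ℝ} (hU : ∀ v, ‖U v‖ = ‖v‖) (hJ : ∀ v, ‖J v‖ = ‖v‖)
    (hX : ‖X - U‖ ≤ η) (hη : η ≤ 1) (hA : ‖A‖ ≤ M) {v : F}
    (h : δ * ‖v‖ ^ 2 ≤ (⟪U (J v), A (U v)⟫_ℂ).re) :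
    (δ - 3 * (M * η)) * ‖v‖ ^ 2 ≤ (⟪X (J v), A (X v)⟫_ℂ).re := by
  have h0 : 0 ≤ ‖v‖ := norm_nonneg v
  have hη0 : 0 ≤ η := (norm_nonneg _).trans hX
  have hM0 : 0 ≤ M := (norm_nonneg _).trans hA
  have hY : ∀ w, ‖(X - U) w‖ ≤ η * ‖w‖ := fun w => (X - U).le_of_opNorm_le hX w
  have hXv : ‖X v‖ ≤ 2 * ‖v‖ := by
    have : X v = U v + (X - U) v := by rw [sub_apply]; abel
    rw [this]
    refine (norm_add_le _ _).trans ?_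
    rw [hU]
    nlinarith [hY v]
  have e : ⟪X (J v), A (X v)⟫_ℂ = ⟪U (J v), A (U v)⟫_ℂ + ⟪(X - U) (J v), A (X v)⟫_ℂ
      + ⟪U (J v), A ((X - U) v)⟫_ℂ := by
    simp only [sub_apply, map_sub, inner_sub_left, inner_sub_right]
    ring
  have hb : ∀ x y : F, -(‖x‖ * ‖y‖) ≤ (⟪x, y⟫_ℂ).re := fun x y =>
    neg_le_of_abs_le ((Complex.abs_re_le_norm _).trans (norm_inner_le_norm x y))
  have h1 : ‖(X - U) (J v)‖ * ‖A (X v)‖ ≤ (η * ‖v‖) * (M * (2 * ‖v‖)) := by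
    refine mul_le_mul ?_ (A.le_of_opNorm_le_of_le hA hXv) (norm_nonneg _) (by positivity)
    rw [← hJ v]
    exact hY _
  have h2 : ‖U (J v)‖ * ‖A ((X - U) v)‖ ≤ ‖v‖ * (M * (η * ‖v‖)) := by
    rw [hU, hJ]
    exact mul_le_mul_of_nonneg_left (A.le_of_opNorm_le_of_le hA (hY v)) h0
  rw [e, Complex.add_re, Complex.add_re]
  have h3 := hb ((X - U) (J v)) (A (X v))
  have h4 := hb (U (J v)) (A ((X - U) v))
  nlinarith

theorem IsGappedBands.exists_trivialization (hE : IsGappedBands H E) {N : ℕ}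
    (hocc : ∀ (j : Fin n) (kx ky : ℝ), j.val < N → E j kx ky < 0)
    (hunocc : ∀ (j : Fin n) (kx ky : ℝ), N ≤ j.val → 0 < E j kx ky) {c : Fin n → ℤ}
    (hc : ∀ j, IsChernNumber H (E j) (c j)) :
    ∃ (G : ℝ → lp (fun _ : ℤ => EuclideanSpace ℂ (Fin n)) 2 →L[ℂ]
        lp (fun _ : ℤ => EuclideanSpace ℂ (Fin n)) 2) (r : ℕ) (δ : ℝ), 0 < δ ∧ Continuous G ∧
      (∀ k, HasRange (G k) r) ∧ G (2 * π) = G 0 * bandShift c ∧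
      ∀ k ∈ Icc 0 (2 * π), IsUnit (G k) ∧ ∀ w, δ * ‖w‖ ^ 2 ≤ ‖G k w‖ ^ 2 ∧
        δ * ‖w‖ ^ 2 ≤ (⟪G k (fiberOp (bandSign n N) w), convOp 1 (H.hop k) (G k w)⟫_ℂ).re := by
  have h2π : (0 : ℝ) < 2 * π := by positivity
  obtain ⟨φ, hφc, hφx, hφy, hφ⟩ := hE.exists_frame hc
  obtain ⟨δ, hδ, hgap⟩ := hE.exists_gap fun j kx ky => by
    rcases lt_or_ge j.val N with h | h
    · exact (hocc j kx ky h).ne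
    · exact (hunocc j kx ky h).ne'
  obtain ⟨M, hM⟩ := H.exists_norm_blochOp_le
  have hM0 : 0 ≤ M := (norm_nonneg _).trans (hM 0 0)
  let η : ℝ := min (1 / 2) (δ / (6 * (M + 1)))
  have hη : 0 < η := lt_min (by norm_num) (by positivity)
  have hη2 : η ≤ 1 / 2 := min_le_left _ _
  have hηM : δ / 2 ≤ δ - 3 * (M * η) := by
    have h1 : η * (6 * (M + 1)) ≤ δ := by
      rw [← le_div_iff₀ (by positivity)]
      exact min_le_right _ _
    nlinarith
  obtain ⟨r, a, ha, hclose⟩ := exists_trigPoly (f := fun kx ky => columnOp (φ kx ky)) hφc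
    (fun ky hky => by rw [hφx ky hky]) (ε := η / 3) (by positivity)
  let A : ℝ → lp (fun _ : ℤ => EuclideanSpace ℂ (Fin n)) 2 →L[ℂ]
    lp (fun _ : ℤ => EuclideanSpace ℂ (Fin n)) 2 := fun k => convOp r fun d => a d k
  let α : ℝ → ℝ → EuclideanSpace ℂ (Fin n) →L[ℂ] EuclideanSpace ℂ (Fin n) :=
    fun k => convSymbol r fun d => a d k
  have hA : ∀ k, IsConv (A k) r (α k) := fun k => isConv_convOp _ _
  let s := r + ∑ j, (c j).natAbs
  let G := fun k : ℝ => A k + ((k / (2 * π) : ℝ) : ℂ) •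
    (A 0 * bandShift c + (-1 : ℂ) • A (2 * π))
  let σ := fun k t : ℝ => α k t + ((k / (2 * π) : ℝ) : ℂ) •
    (α 0 t * bandPhase c t + (-1 : ℂ) • α (2 * π) t)
  have hG : ∀ k, IsConv (G k) s (σ k) := fun k =>
    ((hA k).mono (Nat.le_add_right _ _)).add ((((hA 0).mul (isConv_bandShift c)).add
      (((hA (2 * π)).mono (Nat.le_add_right _ _)).smul (-1))).smul _)
  have hphase : ∀ t v, ‖bandPhase c t v‖ = ‖v‖ := fun t v => norm_coordMul_apply (fun j => by
    have : Complex.I * (t * (-c j : ℤ)) = Complex.I * ((t * (-c j : ℤ) : ℝ) : ℂ) := by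
      push_cast; ring
    rw [this, norm_exp_I_mul]) v
  have hphase' : ∀ t, ‖bandPhase c t‖ ≤ 1 := fun t =>
    ContinuousLinearMap.opNorm_le_bound _ zero_le_one fun v => by rw [hphase, one_mul]
  have hαU : ∀ k ∈ Icc 0 (2 * π), ∀ t ∈ Icc 0 (2 * π), ‖α k t - columnOp (φ t k)‖ ≤ η / 3 :=
    fun k hk t ht => by
      rw [norm_sub_rev]
      exact (hclose t ht k hk).le
  have hσ : ∀ k ∈ Icc 0 (2 * π), ∀ t ∈ Icc 0 (2 * π), ‖σ k t - columnOp (φ t k)‖ ≤ η := by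
    intro k hk t ht
    have e : σ k t - columnOp (φ t k) = (α k t - columnOp (φ t k)) + ((k / (2 * π) : ℝ) : ℂ) •
        ((α 0 t - columnOp (φ t 0)) * bandPhase c t - (α (2 * π) t - columnOp (φ t (2 * π)))) := by
      simp only [σ]
      rw [sub_mul, ← hφy t ht]
      module
    have hk1 : ‖((k / (2 * π) : ℝ) : ℂ)‖ ≤ 1 := by
      rw [Complex.norm_real, norm_of_nonneg (div_nonneg hk.1 h2π.le), div_le_one h2π]
      exact hk.2
    have h1 := hαU k hk t ht
    have h2 := hαU 0 ⟨le_rfl, h2π.le⟩ t ht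
    have h3 := hαU (2 * π) ⟨h2π.le, le_rfl⟩ t ht
    have h4 : ‖(α 0 t - columnOp (φ t 0)) * bandPhase c t‖ ≤ η / 3 := by
      refine (norm_mul_le _ _).trans ?_
      calc _ ≤ η / 3 * 1 := mul_le_mul h2 (hphase' t) (norm_nonneg _) (by positivity)
        _ = _ := mul_one _
    rw [e]
    refine (norm_add_le _ _).trans ?_
    rw [norm_smul]
    have h5 := norm_sub_le ((α 0 t - columnOp (φ t 0)) * bandPhase c t)
      (α (2 * π) t - columnOp (φ t (2 * π)))
    have h6 := mul_le_of_le_one_left (norm_nonneg ((α 0 t - columnOp (φ t 0)) * bandPhase c t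
      - (α (2 * π) t - columnOp (φ t (2 * π))))) hk1
    linarith
  refine ⟨G, s, min (δ / 2) (1 / 4), lt_min (by positivity) (by norm_num), ?_,
    fun k => (hG k).range, ?_, fun k hk => ?_⟩
  · have : Continuous A := continuous_convOp r ha
    fun_prop
  · simp only [G]
    rw [div_self h2π.ne', Complex.ofReal_one, one_smul, zero_div, Complex.ofReal_zero, zero_smul,
      add_zero, neg_one_smul ℂ]
    abel
  · have hre : ∀ x : EuclideanSpace ℂ (Fin n), (⟪x, x⟫_ℂ).re = ‖x‖ ^ 2 := fun x => by
      rw [inner_self_eq_norm_sq_to_K]; norm_cast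
    have hre' : ∀ x : lp (fun _ : ℤ => EuclideanSpace ℂ (Fin n)) 2, (⟪x, x⟫_ℂ).re = ‖x‖ ^ 2 :=
      fun x => by rw [inner_self_eq_norm_sq_to_K]; norm_cast
    have h1 : ∀ w, 1 / 4 * ‖w‖ ^ 2 ≤ ‖G k w‖ ^ 2 := fun w => by
      refine le_trans ((hG k).symbol.le_re_inner (hG k).symbol (fun t ht v => ?_) w)
        (hre' (G k w)).le
      rw [hre]
      exact le_norm_sq_of_close (norm_columnOp_apply (hφ t ht k hk).1)
        ((hσ k hk t ht).trans hη2) v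
    have h2 : ∀ w, 1 / 4 * ‖w‖ ^ 2 ≤ ‖(G k).adjoint w‖ ^ 2 := fun w => by
      refine le_trans ((hG k).adjoint.le_re_inner (hG k).adjoint (fun t ht v => ?_) w)
        (hre' ((G k).adjoint w)).le
      rw [hre]
      refine le_norm_sq_of_close (norm_adjoint_columnOp_apply (hφ t ht k hk).1) ?_ v
      rw [← map_sub, LinearIsometryEquiv.norm_map]
      exact (hσ k hk t ht).trans hη2
    refine ⟨isUnit_of_le_norm (by norm_num) h1 h2, fun w => ⟨le_trans ?_ (h1 w), ?_⟩⟩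
    · exact mul_le_mul_of_nonneg_right (min_le_right _ _) (sq_nonneg _)
    · refine le_trans (mul_le_mul_of_nonneg_right (min_le_left _ _) (sq_nonneg _)) ?_
      refine ((hG k).symbol.mul (hasSymbol_fiberOp (bandSign n N))).le_re_inner
        ((hasSymbol_convOp 1 (H.hop k)).mul (hG k).symbol) (fun t ht v => ?_) w
      rw [← H.blochOp_eq_convSymbol]
      refine (mul_le_mul_of_nonneg_right hηM (sq_nonneg _)).trans ?_
      obtain ⟨ho, heig⟩ := hφ t ht k hk
      refine le_re_inner_of_close (norm_columnOp_apply ho) (norm_coordMul_apply fun j => ?_)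
        (hσ k hk t ht) (hη2.trans (by norm_num)) (hM t k)
        (le_re_inner_columnOp ho heig (fun j => hgap j t ht k hk) (fun j => hocc j t k)
          (fun j => hunocc j t k) v)
      split_ifs <;> simp

end Trivialization

section EdgeOperator

open Module Topology Filter
open scoped InnerProductSpace

/-- `ℓ²(ℤ, ℂⁿ)`. -/
abbrev Line (n : ℕ) : Type := lp (fun _ : ℤ => EuclideanSpace ℂ (Fin n)) 2

variable {n : ℕ}

/-- The multiplication by a bounded real function. -/
def scalOp (a : ℤ → ℝ) : Line n →L[ℂ] Line n := diagOp fun p => (a p : ℂ) • 1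

theorem norm_ofReal_smul_one_le {a : ℤ → ℝ} {C : ℝ} (h : ∀ p, |a p| ≤ C) (p : ℤ) :
    ‖(a p : ℂ) • (1 : EuclideanSpace ℂ (Fin n) →L[ℂ] EuclideanSpace ℂ (Fin n))‖ ≤ C := by
  rw [norm_smul, Complex.norm_real, Real.norm_eq_abs]
  refine (mul_le_of_le_one_right (abs_nonneg _) ?_).trans (h p)
  exact ContinuousLinearMap.norm_id_le

theorem scalOp_apply {a : ℤ → ℝ} {C : ℝ} (h : ∀ p, |a p| ≤ C) (f : Line n) (p : ℤ) :
    scalOp a f p = (a p : ℂ) • f p := by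
  unfold scalOp
  rw [diagOp_apply (norm_ofReal_smul_one_le h), smul_apply, one_apply_eq_self]

theorem norm_scalOp_apply_le {a : ℤ → ℝ} {C : ℝ} (h : ∀ p, |a p| ≤ C) (f : Line n) :
    ‖scalOp a f‖ ≤ C * ‖f‖ :=
  (scalOp a).le_of_opNorm_le
    (norm_diagOp_le ((abs_nonneg _).trans (h 0)) (norm_ofReal_smul_one_le h)) f

theorem inner_scalOp {a : ℤ → ℝ} {C : ℝ} (h : ∀ p, |a p| ≤ C) : SymmOp (scalOp a : Line n →L[ℂ] _) :=
  fun f g => by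
    rw [lp.inner_eq_tsum, lp.inner_eq_tsum]
    refine tsum_congr fun p => ?_
    rw [scalOp_apply h, scalOp_apply h, inner_smul_left, inner_smul_right, Complex.conj_ofReal]

/-- The restriction of a sequence to the half-line. -/
def restrictOp : Line n →L[ℂ] HalfLine n :=
  LinearMap.mkContinuous
    { toFun := fun f => ⟨fun m => f (m : ℤ), memℓp_two_iff.2
        ((hasSum_norm_sq f).summable.comp_injective Nat.cast_injective)⟩
      map_add' := fun f g => rfl
      map_smul' := fun c f => rfl } 1
    fun f => norm_le_mul_of_le _ f (e := fun m : ℕ => (m : ℤ)) Nat.cast_injective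
      zero_le_one fun i => by rw [one_mul]; rfl

theorem restrictOp_apply (f : Line n) (m : ℕ) : restrictOp f m = f m := rfl

/-- The extension of a sequence by zero. -/
def extendOp : HalfLine n →L[ℂ] Line n := restrictOp.adjoint

theorem extendOp_apply (f : HalfLine n) (p : ℤ) :
    extendOp f p = if 0 ≤ p then f p.toNat else 0 := by
  refine ext_inner_left ℂ fun a => ?_
  rw [← lp.inner_single_left (G := fun _ : ℤ => EuclideanSpace ℂ (Fin n)) (𝕜 := ℂ), extendOp,
    ContinuousLinearMap.adjoint_inner_right]
  split_ifs with h
  · have : restrictOp (lp.single (E := fun _ : ℤ => EuclideanSpace ℂ (Fin n)) 2 p a)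
        = lp.single (E := fun _ : ℕ => EuclideanSpace ℂ (Fin n)) 2 p.toNat a := by
      ext1; funext m
      rw [restrictOp_apply, lp.single_apply, lp.single_apply, Pi.single_apply, Pi.single_apply]
      congr 1
      rw [eq_iff_iff]
      omega
    rw [this, lp.inner_single_left]
  · have : restrictOp (lp.single (E := fun _ : ℤ => EuclideanSpace ℂ (Fin n)) 2 p a)
        = 0 := by
      ext1; funext m
      rw [restrictOp_apply, lp.single_apply, Pi.single_apply, if_neg (by omega)]
      rfl
    rw [this, inner_zero_left, inner_zero_right]

theorem extendOp_natCast (f : HalfLine n) (m : ℕ) : extendOp f (m : ℤ) = f m := by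
  rw [extendOp_apply, if_pos (Int.natCast_nonneg m), Int.toNat_natCast]

theorem norm_extendOp_le (f : HalfLine n) : ‖extendOp f‖ ≤ ‖f‖ := by
  have : ‖(extendOp : HalfLine n →L[ℂ] Line n)‖ ≤ 1 := by
    unfold extendOp
    rw [LinearIsometryEquiv.norm_map]
    exact LinearMap.mkContinuous_norm_le _ zero_le_one _
  simpa using extendOp.le_of_opNorm_le this f

/-- `(p + 1)^(-1/2)` for `p ≥ 0`, and `0` for `p < 0`. -/
def rootWeight (p : ℤ) : ℝ := (√((p : ℝ) + 1))⁻¹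

theorem rootWeight_of_neg {p : ℤ} (h : p < 0) : rootWeight p = 0 := by
  have : (p : ℝ) + 1 ≤ 0 := by exact_mod_cast Int.add_one_le_iff.2 h
  rw [rootWeight, Real.sqrt_eq_zero_of_nonpos this, inv_zero]

theorem rootWeight_pos {p : ℤ} (h : 0 ≤ p) : 0 < rootWeight p := by
  have : (0 : ℝ) ≤ p := by exact_mod_cast h
  unfold rootWeight
  positivity

theorem rootWeight_nonneg (p : ℤ) : 0 ≤ rootWeight p := by
  unfold rootWeight
  positivity

theorem rootWeight_sq {p : ℤ} (h : 0 ≤ p) : rootWeight p ^ 2 = ((p : ℝ) + 1)⁻¹ := by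
  have : (0 : ℝ) ≤ p := by exact_mod_cast h
  rw [rootWeight, inv_pow, Real.sq_sqrt (by positivity)]

theorem abs_rootWeight_le (p : ℤ) : |rootWeight p| ≤ 1 := by
  rw [abs_of_nonneg (rootWeight_nonneg p)]
  rcases lt_or_ge p 0 with h | h
  · rw [rootWeight_of_neg h]; exact zero_le_one
  · have : (0 : ℝ) ≤ p := by exact_mod_cast h
    refine inv_le_one_of_one_le₀ ?_
    rw [Real.one_le_sqrt]
    linarith

theorem abs_rootWeight_sq_le (p : ℤ) : |rootWeight p ^ 2| ≤ 1 := by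
  rw [abs_pow]
  exact pow_le_one₀ (abs_nonneg _) (abs_rootWeight_le p)

/-- The weight of the terms between the sites `p` and `q` of the half-line, whose first site
is `0`. -/
def edgeWeight (p q : ℤ) : ℝ := ((max 0 (min p q + 1) : ℤ) : ℝ)

theorem edgeWeight_comm (p q : ℤ) : edgeWeight p q = edgeWeight q p := by
  unfold edgeWeight
  rw [min_comm]

/-- The weight `edgeWeight p q`, normalized to approach `1` far from the edge. -/
def bondWeight (p q : ℤ) : ℝ := edgeWeight p q * (rootWeight p * rootWeight q)

theorem bondWeight_comm (p q : ℤ) : bondWeight p q = bondWeight q p := by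
  unfold bondWeight
  rw [edgeWeight_comm, mul_comm (rootWeight p)]

theorem bondWeight_of_neg_left {p q : ℤ} (h : p < 0) : bondWeight p q = 0 := by
  rw [bondWeight, rootWeight_of_neg h, zero_mul, mul_zero]

theorem bondWeight_of_neg_right {p q : ℤ} (h : q < 0) : bondWeight p q = 0 := by
  rw [bondWeight_comm, bondWeight_of_neg_left h]

theorem bondWeight_bounds {p q : ℤ} (hp : 0 ≤ p) (hq : 0 ≤ q) :
    ((min p q : ℤ) + 1 : ℝ) / ((max p q : ℤ) + 1) ≤ bondWeight p q ∧ bondWeight p q ≤ 1 := by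
  wlog h : p ≤ q
  · rw [bondWeight_comm, min_comm, max_comm]
    exact this hq hp (by omega)
  have hp' : (0 : ℝ) ≤ p := by exact_mod_cast hp
  have hq' : (0 : ℝ) ≤ q := by exact_mod_cast hq
  have hpq : (p : ℝ) ≤ q := by exact_mod_cast h
  have hw : edgeWeight p q = (p : ℝ) + 1 := by
    unfold edgeWeight
    rw [min_eq_left h, max_eq_right (by omega)]
    push_cast; ring
  have e : bondWeight p q = √((p : ℝ) + 1) * (√((q : ℝ) + 1))⁻¹ := by
    have h0 : √((p : ℝ) + 1) ≠ 0 := (Real.sqrt_pos.2 (by positivity)).ne'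
    rw [bondWeight, hw, rootWeight, rootWeight, ← mul_assoc]
    congr 1
    rw [← div_eq_mul_inv, div_eq_iff h0, Real.mul_self_sqrt (by positivity)]
  have hs : √((p : ℝ) + 1) ≤ √((q : ℝ) + 1) := Real.sqrt_le_sqrt (by linarith)
  have hsq : 0 < √((q : ℝ) + 1) := Real.sqrt_pos.2 (by positivity)
  have hsp : 0 < √((p : ℝ) + 1) := Real.sqrt_pos.2 (by positivity)
  rw [e, min_eq_left h, max_eq_right h, ← div_eq_mul_inv]
  refine ⟨?_, (div_le_one hsq).2 hs⟩
  rw [div_le_div_iff₀ (by positivity) hsq]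
  have h1 : (p : ℝ) + 1 = √((p : ℝ) + 1) * √((p : ℝ) + 1) :=
    (Real.mul_self_sqrt (by positivity)).symm
  have h2 : (q : ℝ) + 1 = √((q : ℝ) + 1) * √((q : ℝ) + 1) :=
    (Real.mul_self_sqrt (by positivity)).symm
  rw [h1, h2]
  simp only [← h1, ← h2]
  nlinarith [mul_pos hsp hsq]

theorem abs_bondWeight_le (p q : ℤ) : |bondWeight p q| ≤ 1 := by
  rcases lt_or_ge p 0 with hp | hp
  · rw [bondWeight_of_neg_left hp]; simp
  rcases lt_or_ge q 0 with hq | hq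
  · rw [bondWeight_of_neg_right hq]; simp
  have h := bondWeight_bounds hp hq
  rw [abs_of_nonneg]
  · exact h.2
  · refine le_trans ?_ h.1
    have hp' : (0 : ℝ) ≤ (min p q : ℤ) := by exact_mod_cast le_min hp hq
    have hq' : (0 : ℝ) ≤ (max p q : ℤ) := by exact_mod_cast hp.trans (le_max_left _ _)
    positivity

theorem abs_bondWeight_sub_one_le {p q : ℤ} {L : ℕ} (hq : (L : ℤ) < q) (hpq : |p - q| ≤ 1) :
    |bondWeight p q - 1| ≤ 1 / ((L : ℝ) + 1) := by
  rw [abs_le] at hpq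
  have h := bondWeight_bounds (p := p) (q := q) (by omega) (by omega)
  rw [abs_of_nonpos (by linarith), neg_sub]
  have hmax : ((max p q : ℤ) : ℝ) ≤ (min p q : ℤ) + 1 := by
    have : max p q ≤ min p q + 1 := by omega
    exact_mod_cast this
  have hmin : (L : ℝ) ≤ (min p q : ℤ) := by
    have : (L : ℤ) ≤ min p q := by omega
    exact_mod_cast this
  have hmm : ((min p q : ℤ) : ℝ) ≤ (max p q : ℤ) := by exact_mod_cast min_le_max
  have hL : (0 : ℝ) ≤ L := Nat.cast_nonneg L
  have h1 : 1 - 1 / ((L : ℝ) + 1) ≤ ((min p q : ℤ) + 1 : ℝ) / ((max p q : ℤ) + 1) := by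
    rw [one_sub_div (by positivity), div_le_div_iff₀ (by positivity) (by linarith)]
    nlinarith
  linarith [h.1]

variable (H : Hamiltonian n)

/-- The edge operator at `ky`, rescaled to a bounded operator and continued by the identity to the
negative half-line. -/
def Hamiltonian.rescaled (ky : ℝ) : Line n →L[ℂ] Line n :=
  ∑ d ∈ Finset.Icc (-1 : ℤ) 1,
    scalOp (fun p => bondWeight p (p - d)) * (fiberOp (H.hop ky d) * shiftOp d)
    + scalOp fun p => if p < 0 then 1 else 0

/-- The rescaling of the identity of the half-line. -/
def massOp : Line n →L[ℂ] Line n := scalOp fun p => rootWeight p ^ 2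

/-- The rescaling of `T - z`, for the edge operator `T` at `ky`. -/
def Hamiltonian.pencil (ky : ℝ) (z : ℂ) : Line n →L[ℂ] Line n := H.rescaled ky - z • massOp

theorem abs_ite_le_one (P : ℤ → Prop) [DecidablePred P] (p : ℤ) :
    |if P p then (1 : ℝ) else 0| ≤ 1 := by
  split_ifs <;> simp

theorem Hamiltonian.rescaled_apply (ky : ℝ) (v : Line n) (p : ℤ) :
    H.rescaled ky v p = ∑ d ∈ Finset.Icc (-1 : ℤ) 1,
      (bondWeight p (p - d) : ℂ) • H.hop ky d (v (p - d)) + (if p < 0 then v p else 0) := by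
  unfold Hamiltonian.rescaled
  rw [add_apply, sum_apply, lp.coeFn_add, Pi.add_apply, lp.coeFn_sum, Finset.sum_apply]
  congr 1
  · refine Finset.sum_congr rfl fun d _ => ?_
    rw [mul_apply_eq_comp, scalOp_apply (fun p => abs_bondWeight_le p (p - d)),
      mul_apply_eq_comp, fiberOp_apply, shiftOp_apply]
  · rw [scalOp_apply (abs_ite_le_one _)]
    split_ifs <;> simp

theorem massOp_apply (v : Line n) (p : ℤ) : massOp v p = ((rootWeight p ^ 2 : ℝ) : ℂ) • v p :=
  scalOp_apply abs_rootWeight_sq_le v p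

theorem Hamiltonian.pencil_apply_of_neg (ky : ℝ) (z : ℂ) (v : Line n) {p : ℤ} (h : p < 0) :
    H.pencil ky z v p = v p := by
  unfold Hamiltonian.pencil
  rw [sub_apply, lp.coeFn_sub, Pi.sub_apply, smul_apply, lp.coeFn_smul, Pi.smul_apply,
    massOp_apply, H.rescaled_apply, if_pos h, rootWeight_of_neg h]
  rw [Finset.sum_eq_zero fun d _ => by rw [bondWeight_of_neg_left h, Complex.ofReal_zero, zero_smul]]
  simp

theorem Hamiltonian.continuous_rescaled : Continuous H.rescaled := by
  unfold Hamiltonian.rescaled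
  refine (continuous_finsetSum _ fun d _ => ?_).add continuous_const
  exact continuous_const.mul ((continuous_fiberOp.comp (H.continuous_hop d)).mul continuous_const)

theorem symmOp_massOp : SymmOp (massOp : Line n →L[ℂ] Line n) := inner_scalOp abs_rootWeight_sq_le

theorem Hamiltonian.symmOp_rescaled (ky : ℝ) : SymmOp (H.rescaled ky) := by
  intro u v
  unfold Hamiltonian.rescaled
  rw [add_apply, add_apply, sum_apply, sum_apply, inner_add_left, inner_add_right, sum_inner,
    inner_sum, inner_scalOp (abs_ite_le_one _) u v]
  congr 1
  refine Finset.sum_nbij' (fun d => -d) (fun d => -d) (by simp; omega) (by simp; omega)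
    (by simp) (by simp) fun d _ => ?_
  simp only [mul_apply_eq_comp]
  rw [inner_scalOp (fun p => abs_bondWeight_le p (p - d)), inner_fiberOp, inner_shiftOp,
    H.adjoint_hop]
  congr 1
  ext1; funext p
  rw [shiftOp_apply, fiberOp_apply, scalOp_apply (fun p => abs_bondWeight_le p (p - d)),
    scalOp_apply (fun p => abs_bondWeight_le p (p - -d)), fiberOp_apply, shiftOp_apply, map_smul,
    bondWeight_comm]
  congr 3
  ring

/-- The rescaling map to the half-line. -/
def unscale : Line n →L[ℂ] HalfLine n := restrictOp ∘L scalOp rootWeight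

theorem unscale_apply (v : Line n) (m : ℕ) : unscale v m = (rootWeight m : ℂ) • v m := by
  unfold unscale
  rw [ContinuousLinearMap.comp_apply, restrictOp_apply, scalOp_apply abs_rootWeight_le]

theorem adjoint_unscale_apply (f : HalfLine n) (p : ℤ) :
    unscale.adjoint f p = (rootWeight p : ℂ) • extendOp f p := by
  have h : (scalOp rootWeight : Line n →L[ℂ] Line n).adjoint = scalOp rootWeight := by
    symm
    rw [ContinuousLinearMap.eq_adjoint_iff]
    exact inner_scalOp abs_rootWeight_le
  unfold unscale
  rw [ContinuousLinearMap.adjoint_comp, ContinuousLinearMap.comp_apply, h,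
    scalOp_apply abs_rootWeight_le]
  rfl

/-! ### The edge operator -/

theorem Hamiltonian.edgeBlock_apply (ky : ℝ) (m j : ℕ) (u : EuclideanSpace ℂ (Fin n)) :
    Matrix.toEuclideanLin (H.edgeBlock ky m j) u
      = (edgeWeight m j : ℂ) • H.hop ky ((m : ℤ) - j) u := by
  have h1 : H.edgeBlock ky m j = (edgeWeight m j : ℂ) •
      ∑ y ∈ Finset.Icc (-1 : ℤ) 1,
        Complex.exp (Complex.I * (ky * y)) • H.kernel ((m : ℤ) - j, y) 0 := by
    unfold Hamiltonian.edgeBlock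
    rw [Finset.smul_sum]
    refine Finset.sum_congr rfl fun y _ => ?_
    have hper := H.periodic ((j : ℤ) + 1, 0) ((m : ℤ) - j, y) 0
    have e1 : (((m : ℤ) - j, y) : ℤ × ℤ) + ((j : ℤ) + 1, 0) = ((m : ℤ) + 1, y) := by
      ext <;> simp
      ring
    rw [e1, zero_add] at hper
    rw [H.modulatedKernel_eq, hper, smul_comm]
    congr 2
    simp only
    omega
  rw [h1, map_smul, LinearMap.smul_apply]
  rfl

theorem Hamiltonian.edgeAction_eq (ky : ℝ) (u : HalfLine n) (m : ℕ) :
    H.edgeAction ky u m = ∑ d ∈ Finset.Icc (-1 : ℤ) 1,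
      (edgeWeight m (m - d) : ℂ) • H.hop ky d (extendOp u (m - d)) := by
  unfold Hamiltonian.edgeAction
  have h1 : ∀ j ∈ Finset.range (m + 2), j ∉ (Finset.range (m + 2)).filter (fun j => m ≤ j + 1) →
      Matrix.toEuclideanLin (H.edgeBlock ky m j) (u j) = 0 := by
    intro j hj hj'
    simp only [Finset.mem_filter, not_and, not_le] at hj'
    rw [H.edgeBlock_eq_zero, map_zero, LinearMap.zero_apply]
    have := hj' hj
    rw [lt_abs]
    omega
  have h2 : ∀ d ∈ Finset.Icc (-1 : ℤ) 1, d ∉ (Finset.Icc (-1 : ℤ) 1).filter (fun d : ℤ => d ≤ m) →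
      (edgeWeight m (m - d) : ℂ) • H.hop ky d (extendOp u (m - d)) = 0 := by
    intro d hd hd'
    simp only [Finset.mem_filter, not_and, not_le] at hd'
    have := hd' hd
    rw [extendOp_apply, if_neg (by omega), map_zero, smul_zero]
  rw [← Finset.sum_subset (Finset.filter_subset _ _) h1,
    ← Finset.sum_subset (Finset.filter_subset _ _) h2]
  refine Finset.sum_bij' (fun j _ => (m : ℤ) - j) (fun d _ => ((m : ℤ) - d).toNat) ?_ ?_ ?_ ?_ ?_
  · intro j hj
    simp only [Finset.mem_filter, Finset.mem_range, Finset.mem_Icc] at hj ⊢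
    omega
  · intro d hd
    simp only [Finset.mem_filter, Finset.mem_range, Finset.mem_Icc] at hd ⊢
    omega
  · intro j hj
    simp
  · intro d hd
    simp only [Finset.mem_filter, Finset.mem_Icc] at hd
    omega
  · intro j hj
    rw [H.edgeBlock_apply, sub_sub_cancel, extendOp_natCast]

end EdgeOperator

section Correspondence

open Module Topology Filter
open scoped InnerProductSpace

variable {n : ℕ} {H : Hamiltonian n} {ky : ℝ}

/-- The bulk Hamiltonian at `ky` is bounded away from zero. -/
def Hamiltonian.IsGapped (H : Hamiltonian n) (ky : ℝ) : Prop :=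
  ∃ δ > 0, ∀ w : Line n, δ * ‖w‖ ^ 2 ≤ ‖convOp 1 (H.hop ky) w‖ ^ 2

theorem IsGappedBands.isGapped {E : Fin n → ℝ → ℝ → ℝ} (hE : IsGappedBands H E)
    (h : ∀ j kx ky, E j kx ky ≠ 0) (hky : ky ∈ Icc 0 (2 * π)) : H.IsGapped ky := by
  obtain ⟨δ, hδ, hgap⟩ := hE.exists_gap h
  refine ⟨δ ^ 2, by positivity, fun w => ?_⟩
  have hre : ∀ x : Line n, (⟪x, x⟫_ℂ).re = ‖x‖ ^ 2 := fun x => by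
    rw [inner_self_eq_norm_sq_to_K]; norm_cast
  rw [← hre (convOp 1 (H.hop ky) w)]
  refine (hasSymbol_convOp 1 (H.hop ky)).le_re_inner (hasSymbol_convOp 1 (H.hop ky))
    (fun kx hkx v => ?_) w
  rw [← H.blochOp_eq_convSymbol, inner_self_eq_norm_sq_to_K]
  have e : (((‖H.blochOp kx ky v‖ : ℝ) : ℂ) ^ 2).re = ‖H.blochOp kx ky v‖ ^ 2 := by norm_cast
  refine le_trans ?_ e.ge
  rw [← (hE.basis kx ky).sum_sq_norm_inner_right v,
    ← (hE.basis kx ky).sum_sq_norm_inner_right (H.blochOp kx ky v), Finset.mul_sum]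
  refine Finset.sum_le_sum fun j _ => ?_
  rw [← H.symmOp_blochOp, hE.blochOp_basis, inner_smul_left, Complex.conj_ofReal, norm_mul,
    Complex.norm_real, mul_pow]
  gcongr
  exact hgap j kx hkx ky hky

/-- A Lipschitz cutoff of the weight `p + 1` of the half-line. -/
def cutoff (L : ℕ) (p : ℤ) : ℝ := ((max 0 (min (p + 1) (2 * L - p)) : ℤ) : ℝ)

theorem abs_cutoff_le (L : ℕ) (p : ℤ) : |cutoff L p| ≤ 2 * L := by
  unfold cutoff
  rw [abs_of_nonneg (by exact_mod_cast le_max_left _ _)]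
  have : max 0 (min (p + 1) (2 * L - p)) ≤ 2 * (L : ℤ) := by omega
  exact_mod_cast this

theorem cutoff_div_bounds (L : ℕ) (p : ℤ) :
    0 ≤ cutoff L p / ((p : ℝ) + 1) ∧ cutoff L p / ((p : ℝ) + 1) ≤ 1 := by
  rcases lt_or_ge p 0 with h | h
  · have : cutoff L p = 0 := by
      unfold cutoff
      rw [max_eq_left (by omega), Int.cast_zero]
    rw [this, zero_div]
    exact ⟨le_rfl, zero_le_one⟩
  · have hp : (0 : ℝ) < (p : ℝ) + 1 := by exact_mod_cast Int.lt_add_one_iff.2 h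
    refine ⟨div_nonneg (by unfold cutoff; exact_mod_cast le_max_left _ _) hp.le,
      (div_le_one hp).2 ?_⟩
    have : max 0 (min (p + 1) (2 * L - p)) ≤ p + 1 := by omega
    unfold cutoff
    exact_mod_cast this

theorem abs_cutoff_commutator_le (L : ℕ) {d : ℤ} (hd : |d| ≤ 1) (p : ℤ) :
    |edgeWeight p (p - d) * (cutoff L p / ((p : ℝ) + 1)) - cutoff L (p - d)| ≤ 2 := by
  rw [abs_le] at hd
  obtain ⟨h0, h1⟩ := cutoff_div_bounds L p
  rcases lt_or_ge p 0 with h | h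
  · have hp : cutoff L p = 0 := by
      unfold cutoff
      rw [max_eq_left (by omega), Int.cast_zero]
    rw [hp, zero_div, mul_zero, zero_sub, abs_neg]
    unfold cutoff
    rw [abs_of_nonneg (by exact_mod_cast le_max_left _ _)]
    have : max 0 (min (p - d + 1) (2 * L - (p - d))) ≤ 2 := by omega
    exact_mod_cast this
  · have hp : (0 : ℝ) < (p : ℝ) + 1 := by exact_mod_cast Int.lt_add_one_iff.2 h
    obtain ⟨a, ha, ha0, ha1⟩ : ∃ a : ℝ, edgeWeight p (p - d) = (p : ℝ) + 1 + a ∧ -1 ≤ a ∧ a ≤ 0 := by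
      refine ⟨((max 0 (min p (p - d) + 1) - (p + 1) : ℤ) : ℝ), ?_, ?_, ?_⟩
      · unfold edgeWeight
        push_cast
        ring
      · have : -1 ≤ max 0 (min p (p - d) + 1) - (p + 1) := by omega
        exact_mod_cast this
      · have : max 0 (min p (p - d) + 1) - (p + 1) ≤ 0 := by omega
        exact_mod_cast this
    obtain ⟨b, hb, hb0, hb1⟩ : ∃ b : ℝ, cutoff L (p - d) = cutoff L p + b ∧ -1 ≤ b ∧ b ≤ 1 := by
      refine ⟨((max 0 (min (p - d + 1) (2 * L - (p - d))) - max 0 (min (p + 1) (2 * L - p)) : ℤ) : ℝ),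
        ?_, ?_, ?_⟩
      · unfold cutoff
        rw [Int.cast_sub]
        ring
      · have : -1 ≤ max 0 (min (p - d + 1) (2 * L - (p - d))) - max 0 (min (p + 1) (2 * L - p)) := by
          omega
        exact_mod_cast this
      · have : max 0 (min (p - d + 1) (2 * L - (p - d))) - max 0 (min (p + 1) (2 * L - p)) ≤ 1 := by
          omega
        exact_mod_cast this
    have e : edgeWeight p (p - d) * (cutoff L p / ((p : ℝ) + 1)) - cutoff L (p - d)
        = a * (cutoff L p / ((p : ℝ) + 1)) - b := by
      rw [ha, hb]
      field_simp
      ring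
    rw [e, abs_le]
    constructor <;> nlinarith

theorem norm_fiberOp_shiftOp_le {E : Type*} [NormedAddCommGroup E] [InnerProductSpace ℂ E]
    (M : E →L[ℂ] E) (d : ℤ) (f : lp (fun _ : ℤ => E) 2) :
    ‖fiberOp M (shiftOp d f)‖ ≤ ‖M‖ * ‖f‖ :=
  norm_le_mul_of_le _ f (e := fun p => p - d) (sub_left_injective (b := d)) (norm_nonneg M)
    fun p => by
      rw [fiberOp_apply, shiftOp_apply]
      exact M.le_opNorm _

/-- Elliptic regularity at the edge. -/
theorem Hamiltonian.IsGapped.mem_edgeDomain (hH : H.IsGapped ky) {u g : HalfLine n}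
    (h : ∀ m, H.edgeAction ky u m = g m) : u ∈ edgeDomain n := by
  obtain ⟨δ, hδ, hle⟩ := hH
  let C : ℝ := ‖g‖ + ∑ d ∈ Finset.Icc (-1 : ℤ) 1, 2 * (‖H.hop ky d‖ * ‖u‖)
  have hC : 0 ≤ C := by positivity
  refine summable_of_sum_range_le (c := C ^ 2 / δ) (fun m => by positivity) fun L => ?_
  let s : ℤ → ℝ := fun p => cutoff L p / ((p : ℝ) + 1)
  let e : ℤ → ℤ → ℝ := fun d p => edgeWeight p (p - d) * s p - cutoff L (p - d)
  have hs : ∀ p, |s p| ≤ 1 := fun p => by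
    rw [abs_of_nonneg (cutoff_div_bounds L p).1]; exact (cutoff_div_bounds L p).2
  let y : Line n := scalOp (cutoff L) (extendOp u)
  have hy : ∀ p, y p = (cutoff L p : ℂ) • extendOp u p := scalOp_apply (abs_cutoff_le L) _
  have hconv : convOp 1 (H.hop ky) y = scalOp s (extendOp g) - ∑ d ∈ Finset.Icc (-1 : ℤ) 1,
      scalOp (e d) (fiberOp (H.hop ky d) (shiftOp d (extendOp u))) := by
    ext1; funext p
    have h1 : scalOp s (extendOp g) p = ∑ d ∈ Finset.Icc (-1 : ℤ) 1,
        ((edgeWeight p (p - d) * s p : ℝ) : ℂ) • H.hop ky d (extendOp u (p - d)) := by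
      rw [scalOp_apply hs]
      rcases lt_or_ge p 0 with hp | hp
      · have : s p = 0 := by
          simp only [s, cutoff]
          rw [max_eq_left (by omega), Int.cast_zero, zero_div]
        simp [this]
      · obtain ⟨m, rfl⟩ := Int.eq_ofNat_of_zero_le hp
        rw [extendOp_natCast, ← h, H.edgeAction_eq, Finset.smul_sum]
        refine Finset.sum_congr rfl fun d _ => ?_
        rw [smul_smul, ← Complex.ofReal_mul, mul_comm (s m)]
    rw [convOp_apply, lp.coeFn_sub, Pi.sub_apply, h1, lp.coeFn_sum, Finset.sum_apply,
      ← Finset.sum_sub_distrib]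
    refine Finset.sum_congr (by norm_num) fun d hd => ?_
    have hd' : |d| ≤ 1 := abs_le.2 (Finset.mem_Icc.1 (by simpa using hd))
    rw [hy, scalOp_apply (abs_cutoff_commutator_le L hd'), fiberOp_apply, shiftOp_apply,
      map_smul, ← sub_smul, ← Complex.ofReal_sub]
    congr 2
    simp only [s]
    ring
  have hnorm : ‖convOp 1 (H.hop ky) y‖ ≤ C := by
    rw [hconv]
    refine (norm_sub_le _ _).trans (add_le_add ?_ ((norm_sum_le _ _).trans
      (Finset.sum_le_sum fun d hd => ?_)))
    · refine (norm_scalOp_apply_le hs _).trans ?_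
      rw [one_mul]
      exact norm_extendOp_le g
    · have hd' : |d| ≤ 1 := abs_le.2 (Finset.mem_Icc.1 hd)
      refine (norm_scalOp_apply_le (abs_cutoff_commutator_le L hd') _).trans ?_
      refine mul_le_mul_of_nonneg_left ?_ zero_le_two
      exact (norm_fiberOp_shiftOp_le _ _ _).trans
        (mul_le_mul_of_nonneg_left (norm_extendOp_le u) (norm_nonneg _))
  rw [le_div_iff₀ hδ]
  have h2 : ∑ m ∈ Finset.range L, ((m : ℝ) + 1) ^ 2 * ‖u m‖ ^ 2 ≤ ‖y‖ ^ 2 := by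
    have h3 := sum_le_hasSum ((Finset.range L).map Nat.castEmbedding)
      (fun p _ => by positivity) (hasSum_norm_sq y)
    rw [Finset.sum_map] at h3
    refine le_trans (Finset.sum_le_sum fun m hm => ?_) h3
    rw [Nat.castEmbedding_apply, hy, extendOp_natCast, norm_smul, mul_pow, Complex.norm_real,
      Real.norm_eq_abs, sq_abs]
    have : cutoff L m = (m : ℝ) + 1 := by
      unfold cutoff
      have := Finset.mem_range.1 hm
      rw [max_eq_right (by omega), min_eq_left (by omega)]
      push_cast; ring
    rw [this]
  calc _ ≤ ‖y‖ ^ 2 * δ := mul_le_mul_of_nonneg_right h2 hδ.le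
    _ = δ * ‖y‖ ^ 2 := mul_comm _ _
    _ ≤ _ := (hle y).trans (pow_le_pow_left₀ (norm_nonneg _) hnorm 2)

theorem extendOp_unscale (v : Line n) (p : ℤ) :
    extendOp (unscale v) p = (rootWeight p : ℂ) • v p := by
  rw [extendOp_apply]
  split_ifs with h
  · rw [unscale_apply, Int.toNat_of_nonneg h]
  · rw [rootWeight_of_neg (not_le.1 h), Complex.ofReal_zero, zero_smul]

theorem Hamiltonian.pencil_apply_natCast (H : Hamiltonian n) (ky : ℝ) (z : ℂ) (v : Line n) (m : ℕ) :
    H.pencil ky z v m = (rootWeight m : ℂ) •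
      (H.edgeAction ky (unscale v) m - z • unscale v m) := by
  unfold Hamiltonian.pencil
  rw [sub_apply, lp.coeFn_sub, Pi.sub_apply, smul_apply, lp.coeFn_smul, Pi.smul_apply,
    massOp_apply, H.rescaled_apply, if_neg (by omega), add_zero, H.edgeAction_eq, smul_sub,
    Finset.smul_sum]
  congr 1
  · refine Finset.sum_congr rfl fun d _ => ?_
    rw [extendOp_unscale, map_smul, smul_smul, smul_smul, bondWeight]
    congr 1
    push_cast
    ring
  · rw [unscale_apply, smul_smul, smul_smul, smul_smul]
    congr 1
    push_cast
    ring

theorem rootWeight_smul_cancel {m : ℕ} {x y : EuclideanSpace ℂ (Fin n)}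
    (h : (rootWeight m : ℂ) • x = (rootWeight m : ℂ) • y) : x = y := by
  refine smul_right_injective _ ?_ h
  exact_mod_cast (rootWeight_pos (Int.natCast_nonneg m)).ne'

theorem Hamiltonian.IsGapped.edgeFiber_unscale (hH : H.IsGapped ky) {z : ℂ} {v : Line n}
    {f : HalfLine n} (h : H.pencil ky z v = unscale.adjoint f) :
    ∃ hd : unscale v ∈ (H.edgeFiber ky).domain,
      H.edgeFiber ky ⟨unscale v, hd⟩ - z • unscale v = f := by
  have h1 : ∀ m, H.edgeAction ky (unscale v) m - z • unscale v m = f m := fun m => by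
    refine rootWeight_smul_cancel (m := m) ?_
    rw [← H.pencil_apply_natCast, h, adjoint_unscale_apply, extendOp_natCast]
  refine ⟨hH.mem_edgeDomain (g := f + z • unscale v) fun m => ?_, ?_⟩
  · rw [lp.coeFn_add, Pi.add_apply, ← h1 m]
    exact (sub_add_cancel _ _).symm
  · ext1; funext m
    exact h1 m

theorem Hamiltonian.exists_unscale_eq (H : Hamiltonian n) (ky : ℝ) (u : (H.edgeFiber ky).domain) :
    ∃ v : Line n, unscale v = u ∧
      ∀ z : ℂ, H.pencil ky z v = unscale.adjoint (H.edgeFiber ky u - z • (u : HalfLine n)) := by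
  have hmem : Memℓp (fun m : ℕ => ((√((m : ℝ) + 1) : ℝ) : ℂ) • (u : HalfLine n) m) 2 := by
    refine memℓp_two_iff.2 (Summable.of_nonneg_of_le (fun _ => by positivity) (fun m => ?_) u.2)
    rw [norm_smul, Complex.norm_real, Real.norm_eq_abs, mul_pow, sq_abs,
      Real.sq_sqrt (by positivity)]
    refine mul_le_mul_of_nonneg_right ?_ (by positivity)
    have : (0 : ℝ) ≤ m := Nat.cast_nonneg m
    nlinarith
  let w : HalfLine n := ⟨_, hmem⟩
  have hw : ∀ m, w m = ((√((m : ℝ) + 1) : ℝ) : ℂ) • (u : HalfLine n) m := fun m => rfl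
  have hu : unscale (extendOp w) = u := by
    ext1; funext m
    rw [unscale_apply, extendOp_natCast, hw, smul_smul, ← Complex.ofReal_mul]
    have : rootWeight m * √((m : ℝ) + 1) = 1 := by
      unfold rootWeight
      rw [Int.cast_natCast]
      exact inv_mul_cancel₀ (Real.sqrt_pos.2 (by positivity)).ne'
    rw [this, Complex.ofReal_one, one_smul]
  refine ⟨extendOp w, hu, fun z => ?_⟩
  ext1; funext p
  rcases lt_or_ge p 0 with hp | hp
  · rw [H.pencil_apply_of_neg _ _ _ hp, adjoint_unscale_apply, rootWeight_of_neg hp,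
      extendOp_apply, if_neg (not_le.2 hp), Complex.ofReal_zero, zero_smul]
  · obtain ⟨m, rfl⟩ := Int.eq_ofNat_of_zero_le hp
    rw [H.pencil_apply_natCast, hu, adjoint_unscale_apply, extendOp_natCast]
    rfl

theorem mem_eigenspace_iff {F : Type*} [NormedAddCommGroup F] [InnerProductSpace ℂ F]
    {T : F →ₗ.[ℂ] F} {z : ℂ} {u : F} :
    u ∈ eigenspace T z ↔ ∃ h : u ∈ T.domain, T ⟨u, h⟩ - z • u = 0 := by
  constructor
  · rintro ⟨⟨v, hv⟩, h, rfl⟩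
    exact ⟨hv, h⟩
  · rintro ⟨hu, h⟩
    exact ⟨⟨u, hu⟩, h, rfl⟩

theorem Hamiltonian.IsGapped.eigenspace_edgeFiber (hH : H.IsGapped ky) (z : ℂ) :
    eigenspace (H.edgeFiber ky) z
      = (LinearMap.ker (H.pencil ky z : Line n →ₗ[ℂ] Line n)).map
        ((unscale : Line n →L[ℂ] HalfLine n) : Line n →ₗ[ℂ] HalfLine n) := by
  ext u
  rw [mem_eigenspace_iff]
  constructor
  · rintro ⟨hu, h⟩
    obtain ⟨v, hv, hz⟩ := H.exists_unscale_eq ky ⟨u, hu⟩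
    refine ⟨v, ?_, hv⟩
    change H.pencil ky z v = 0
    rw [hz, h, map_zero]
  · rintro ⟨v, hv, rfl⟩
    exact hH.edgeFiber_unscale (f := 0) (by rw [map_zero]; exact hv)

theorem eq_zero_of_unscale_eq_zero {z : ℂ} {v : Line n}
    (hv : v ∈ LinearMap.ker (H.pencil ky z : Line n →ₗ[ℂ] Line n)) (h : unscale v = 0) :
    v = 0 := by
  ext1; funext p
  rcases lt_or_ge p 0 with hp | hp
  · rw [← H.pencil_apply_of_neg ky z v hp, show H.pencil ky z v = 0 from hv]
  · obtain ⟨m, rfl⟩ := Int.eq_ofNat_of_zero_le hp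
    refine rootWeight_smul_cancel (m := m) ?_
    rw [← unscale_apply, h, lp.coeFn_zero, lp.coeFn_zero, Pi.zero_apply, Pi.zero_apply, smul_zero]

theorem Hamiltonian.IsGapped.mem_resolventSet (hH : H.IsGapped ky) {z : ℂ}
    (h : IsUnit (H.pencil ky z)) : z ∈ resolventSet (H.edgeFiber ky) := by
  obtain ⟨B, hB⟩ := h.exists_right_inv
  obtain ⟨B', hB'⟩ := h.exists_left_inv
  have hBB : B = B' := by
    rw [← one_mul B, ← hB', mul_assoc, hB, mul_one]
  refine ⟨unscale ∘L (B * 1) ∘L unscale.adjoint, fun f => ?_, fun u => ?_⟩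
  · rw [mul_one]
    exact hH.edgeFiber_unscale (v := B (unscale.adjoint f))
      (by rw [← mul_apply_eq_comp, hB, one_apply_eq_self])
  · obtain ⟨v, hv, hz⟩ := H.exists_unscale_eq ky u
    rw [mul_one, ContinuousLinearMap.comp_apply, ContinuousLinearMap.comp_apply, ← hz z, hBB,
      ← mul_apply_eq_comp, hB', one_apply_eq_self, hv]

theorem Hamiltonian.IsGapped.ker_pencil_eq_bot (hH : H.IsGapped ky) {z : ℂ}
    (h : z ∈ resolventSet (H.edgeFiber ky)) :
    LinearMap.ker (H.pencil ky z : Line n →ₗ[ℂ] Line n) = ⊥ := by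
  obtain ⟨R, -, hR⟩ := h
  rw [eq_bot_iff]
  intro v hv
  obtain ⟨hd, h1⟩ := hH.edgeFiber_unscale (f := 0) (z := z) (v := v) (by rw [map_zero]; exact hv)
  have h2 := hR ⟨_, hd⟩
  simp only at h2
  rw [h1, map_zero] at h2
  exact eq_zero_of_unscale_eq_zero hv h2.symm

theorem re_inner_massOp (v : Line n) :
    HasSum (fun p => rootWeight p ^ 2 * ‖v p‖ ^ 2) (⟪v, massOp v⟫_ℂ).re := by
  have h := lp.hasSum_inner (𝕜 := ℂ) v (massOp v)
  have h2 := Complex.reCLM.hasSum h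
  rw [show (⟪v, massOp v⟫_ℂ).re = Complex.reCLM ⟪v, massOp v⟫_ℂ from rfl]
  convert h2 using 1
  funext p
  rw [massOp_apply, inner_smul_right, inner_self_eq_norm_sq_to_K,
    Complex.reCLM_apply, Complex.re_ofReal_mul]
  congr 1
  norm_cast

theorem eq_zero_of_inner_massOp_eq_zero {v : Line n} (h : (⟪v, massOp v⟫_ℂ).re = 0) (p : ℤ)
    (hp : 0 ≤ p) : v p = 0 := by
  have h1 := re_inner_massOp v
  rw [h] at h1
  have h2 := (hasSum_zero_iff_of_nonneg fun p => by positivity).1 h1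
  have h3 := congrFun h2 p
  simp only [Pi.zero_apply, mul_eq_zero, pow_eq_zero_iff two_ne_zero] at h3
  rcases h3 with h3 | h3
  · exact absurd h3 (rootWeight_pos hp).ne'
  · exact norm_eq_zero.1 h3

theorem eq_zero_of_ker_pencil {z : ℂ} {v : Line n} (hv : H.pencil ky z v = 0)
    (h : (⟪v, massOp v⟫_ℂ).re = 0) : v = 0 := by
  ext1; funext p
  rcases lt_or_ge p 0 with hp | hp
  · rw [← H.pencil_apply_of_neg ky z v hp, hv]
  · exact eq_zero_of_inner_massOp_eq_zero h p hp

theorem SymmOp.im_inner {K : Type*} [NormedAddCommGroup K] [InnerProductSpace ℂ K]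
    {B : K →L[ℂ] K} (hB : SymmOp B) (v : K) : (⟪v, B v⟫_ℂ).im = 0 := by
  have h := inner_conj_symm (𝕜 := ℂ) v (B v)
  rw [hB] at h
  exact Complex.conj_eq_iff_im.1 h

theorem ker_pencil_eq_bot_of_im_ne_zero (H : Hamiltonian n) (ky : ℝ) {z : ℂ} (hz : z.im ≠ 0) :
    LinearMap.ker (H.pencil ky z : Line n →ₗ[ℂ] Line n) = ⊥ := by
  rw [eq_bot_iff]
  intro v hv
  have hv' : H.pencil ky z v = 0 := hv
  refine eq_zero_of_ker_pencil hv' ?_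
  have h1 : ⟪v, H.pencil ky z v⟫_ℂ = 0 := by rw [hv', inner_zero_right]
  unfold Hamiltonian.pencil at h1
  rw [sub_apply, smul_apply, inner_sub_right, inner_smul_right] at h1
  have h2 := congrArg Complex.im h1
  rw [Complex.sub_im, Complex.mul_im, (H.symmOp_rescaled ky).im_inner, symmOp_massOp.im_inner,
    mul_zero, zero_add, zero_sub, Complex.zero_im, neg_eq_zero] at h2
  exact (mul_eq_zero.1 h2).resolve_left hz

theorem Hamiltonian.edgeFiber_symmetric (H : Hamiltonian n) (ky : ℝ)
    (u v : (H.edgeFiber ky).domain) :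
    ⟪H.edgeFiber ky u, (v : HalfLine n)⟫_ℂ = ⟪(u : HalfLine n), H.edgeFiber ky v⟫_ℂ := by
  obtain ⟨x, hx, hx'⟩ := H.exists_unscale_eq ky u
  obtain ⟨y, hy, hy'⟩ := H.exists_unscale_eq ky v
  have h1 := hx' 0
  have h2 := hy' 0
  simp only [Hamiltonian.pencil, zero_smul, sub_zero] at h1 h2
  have h3 : ⟪H.edgeFiber ky u, unscale y⟫_ℂ = ⟪H.rescaled ky x, y⟫_ℂ := by
    rw [h1, ContinuousLinearMap.adjoint_inner_left]
  have h4 : ⟪unscale x, H.edgeFiber ky v⟫_ℂ = ⟪x, H.rescaled ky y⟫_ℂ := by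
    rw [h2, ContinuousLinearMap.adjoint_inner_right]
  rw [← hx, ← hy, h3, h4]
  exact H.symmOp_rescaled ky x y

theorem dense_edgeDomain : Dense (edgeDomain n : Set (HalfLine n)) := by
  intro f
  refine mem_closure_of_tendsto (lp.hasSum_single (by norm_num) f)
    (Eventually.of_forall fun s => (edgeDomain n).sum_mem fun m _ => ?_)
  refine summable_of_ne_finset_zero (s := {m}) fun j hj => ?_
  rw [lp.single_apply, Pi.single_apply, if_neg (by simpa using hj), norm_zero]
  ring

theorem isSelfAdjoint_of_resolvent {F : Type*} [NormedAddCommGroup F] [InnerProductSpace ℂ F]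
    [CompleteSpace F] {T : F →ₗ.[ℂ] F} (hT : Dense (T.domain : Set F))
    (hs : ∀ u v : T.domain, ⟪T u, (v : F)⟫_ℂ = ⟪(u : F), T v⟫_ℂ)
    (h₁ : Complex.I ∈ resolventSet T) (h₂ : -Complex.I ∈ resolventSet T) : IsSelfAdjoint T := by
  rw [LinearPMap.isSelfAdjoint_def]
  have hle : T ≤ T.adjoint := LinearPMap.IsFormalAdjoint.le_adjoint hT fun u v => hs u v
  refine le_antisymm ?_ hle
  have key : T.adjoint.domain ≤ T.domain := by
    intro g hg
    obtain ⟨R, hR, -⟩ := h₁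
    obtain ⟨R', hR', -⟩ := h₂
    set f := T.adjoint ⟨g, hg⟩ - Complex.I • g with hf
    obtain ⟨u, hu, hu'⟩ : ∃ u, ∃ h : u ∈ T.domain, T ⟨u, h⟩ - Complex.I • u = f := ⟨_, hR f⟩
    obtain ⟨v, hv, hv'⟩ : ∃ v, ∃ h : v ∈ T.domain, T ⟨v, h⟩ - -Complex.I • v = g - u :=
      ⟨_, hR' (g - u)⟩
    have h3 : ⟪T.adjoint ⟨g, hg⟩, v⟫_ℂ = ⟪g, T ⟨v, hv⟩⟫_ℂ :=
      LinearPMap.adjoint_isFormalAdjoint hT ⟨g, hg⟩ ⟨v, hv⟩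
    have h4 := hs ⟨u, hu⟩ ⟨v, hv⟩
    have h5 : T.adjoint ⟨g, hg⟩ - T ⟨u, hu⟩ = Complex.I • (g - u) := by
      have : T ⟨u, hu⟩ = f + Complex.I • u := by rw [← hu']; abel
      rw [this, hf]
      module
    have h6 : ⟪g - u, g - u⟫_ℂ = 0 := by
      have h7 : ⟪g - u, T ⟨v, hv⟩⟫_ℂ = ⟪Complex.I • (g - u), v⟫_ℂ := by
        rw [← h5, inner_sub_left, inner_sub_left, h3, h4]
      have h8 : ⟪g - u, g - u⟫_ℂ = ⟪g - u, T ⟨v, hv⟩ - -Complex.I • v⟫_ℂ := by rw [hv']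
      rw [h8, inner_sub_right, h7, inner_smul_left, inner_smul_right, Complex.conj_I]
      ring
    rw [inner_self_eq_zero, sub_eq_zero] at h6
    rw [h6]
    exact hu
  refine ⟨key, fun x y hxy => ?_⟩
  rw [← hle.2 (x := y) (y := ⟨x, x.2⟩) (by exact hxy.symm)]

end Correspondence

section Coercivity

open Module Topology Filter
open scoped InnerProductSpace

variable {n : ℕ} {H : Hamiltonian n} {ky : ℝ}

theorem inner_eq_zero_of_disjoint {u v : Line n} (h : ∀ p, u p = 0 ∨ v p = 0) : ⟪u, v⟫_ℂ = 0 := by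
  rw [lp.inner_eq_tsum]
  refine (tsum_congr fun p => ?_).trans tsum_zero
  rcases h p with h | h <;> simp [h]

theorem Hamiltonian.pencil_of_neg (z : ℂ) {v : Line n} (h : ∀ p, 0 ≤ p → v p = 0) :
    H.pencil ky z v = v := by
  ext1; funext p
  rcases lt_or_ge p 0 with hp | hp
  · exact H.pencil_apply_of_neg ky z v hp
  · unfold Hamiltonian.pencil
    rw [sub_apply, lp.coeFn_sub, Pi.sub_apply, smul_apply, lp.coeFn_smul, Pi.smul_apply,
      massOp_apply, H.rescaled_apply, if_neg (not_lt.2 hp), h p hp]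
    rw [Finset.sum_eq_zero fun d _ => ?_]
    · simp
    · rcases lt_or_ge (p - d) 0 with hq | hq
      · rw [bondWeight_of_neg_right hq, Complex.ofReal_zero, zero_smul]
      · rw [h _ hq, map_zero, smul_zero]

theorem Hamiltonian.norm_pencil_sub_le (H : Hamiltonian n) (ky : ℝ) (z : ℂ) (L : ℕ) {v : Line n}
    (h : ∀ p, p ≤ (L : ℤ) → v p = 0) :
    ‖H.pencil ky z v - convOp 1 (H.hop ky) v‖
      ≤ (∑ d ∈ Finset.Icc (-1 : ℤ) 1, ‖H.hop ky d‖ + ‖z‖) / ((L : ℝ) + 1) * ‖v‖ := by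
  let e : ℤ → ℤ → ℝ := fun d p => if (L : ℤ) < p - d then bondWeight p (p - d) - 1 else 0
  let m : ℤ → ℝ := fun p => if (L : ℤ) < p then rootWeight p ^ 2 else 0
  have he : ∀ d ∈ Finset.Icc (-1 : ℤ) 1, ∀ p, |e d p| ≤ 1 / ((L : ℝ) + 1) := fun d hd p => by
    simp only [e]
    split_ifs with hp
    · refine abs_bondWeight_sub_one_le hp ?_
      rw [sub_sub_cancel]
      exact abs_le.2 (Finset.mem_Icc.1 hd)
    · rw [abs_zero]; positivity
  have hm : ∀ p, |m p| ≤ 1 / ((L : ℝ) + 1) := fun p => by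
    simp only [m]
    split_ifs with hp
    · have hp' : (L : ℝ) < p := by exact_mod_cast hp
      rw [abs_of_nonneg (sq_nonneg _), rootWeight_sq (by omega), inv_eq_one_div]
      exact one_div_le_one_div_of_le (by positivity) (by linarith)
    · rw [abs_zero]; positivity
  have key : H.pencil ky z v - convOp 1 (H.hop ky) v = ∑ d ∈ Finset.Icc (-1 : ℤ) 1,
      scalOp (e d) (fiberOp (H.hop ky d) (shiftOp d v)) - z • scalOp m v := by
    ext1; funext p
    unfold Hamiltonian.pencil
    simp only [sub_apply, smul_apply, lp.coeFn_sub, lp.coeFn_smul, Pi.sub_apply, Pi.smul_apply,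
      lp.coeFn_sum, Finset.sum_apply]
    have h1 : (if p < 0 then v p else 0) = 0 := by
      split_ifs with hp
      · exact h p (by omega)
      · rfl
    have h2 : ((rootWeight p ^ 2 : ℝ) : ℂ) • v p = scalOp m v p := by
      rw [scalOp_apply hm]
      simp only [m]
      split_ifs with hp
      · rfl
      · rw [h p (not_lt.1 hp), smul_zero, smul_zero]
    rw [massOp_apply, h2, H.rescaled_apply, h1, add_zero, convOp_apply, sub_right_comm]
    congr 1
    rw [Nat.cast_one, ← Finset.sum_sub_distrib]
    refine Finset.sum_congr rfl fun d hd => ?_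
    rw [scalOp_apply (he d hd), fiberOp_apply, shiftOp_apply]
    simp only [e]
    split_ifs with hp
    · rw [Complex.ofReal_sub, Complex.ofReal_one, sub_smul, one_smul]
    · rw [h _ (not_lt.1 hp), map_zero, smul_zero, smul_zero, sub_zero]
  rw [key]
  refine (norm_sub_le _ _).trans ?_
  have h1 : ‖∑ d ∈ Finset.Icc (-1 : ℤ) 1, scalOp (e d) (fiberOp (H.hop ky d) (shiftOp d v))‖
      ≤ ∑ d ∈ Finset.Icc (-1 : ℤ) 1, 1 / ((L : ℝ) + 1) * (‖H.hop ky d‖ * ‖v‖) :=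
    (norm_sum_le _ _).trans (Finset.sum_le_sum fun d hd =>
      (norm_scalOp_apply_le (he d hd) _).trans (mul_le_mul_of_nonneg_left
        (norm_fiberOp_shiftOp_le _ _ _) (by positivity)))
  have h2 : ‖z • scalOp m v‖ ≤ ‖z‖ * (1 / ((L : ℝ) + 1) * ‖v‖) := by
    rw [norm_smul]
    exact mul_le_mul_of_nonneg_left (norm_scalOp_apply_le hm v) (norm_nonneg z)
  refine (add_le_add h1 h2).trans (le_of_eq ?_)
  rw [← Finset.mul_sum, ← Finset.sum_mul]
  ring

/-- A family `G` that trivializes the bulk Hamiltonian: `G(ky)` is an invertible operator of finite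
range which conjugates, up to homotopy, the bulk Hamiltonian to `bandSign n N`, and its
values at the end points differ by a translation of the bands. -/
structure IsTrivialization (H : Hamiltonian n) (N : ℕ) (c : Fin n → ℤ) (G : ℝ → Line n →L[ℂ] Line n)
    (r : ℕ) (δ : ℝ) : Prop where
  pos : 0 < δ
  continuous : Continuous G
  range : ∀ k, HasRange (G k) r
  glue : G (2 * π) = G 0 * bandShift c
  isUnit : ∀ k ∈ Icc 0 (2 * π), IsUnit (G k)
  le_norm : ∀ k ∈ Icc 0 (2 * π), ∀ w, δ * ‖w‖ ^ 2 ≤ ‖G k w‖ ^ 2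
  le_inner : ∀ k ∈ Icc 0 (2 * π), ∀ w, δ * ‖w‖ ^ 2 ≤
    (⟪G k (fiberOp (bandSign n N) w), convOp 1 (H.hop k) (G k w)⟫_ℂ).re

/-- The involution which is `-1` on the occupied bands over the half-line. -/
def edgeSign (n N : ℕ) : Line n →L[ℂ] Line n :=
  diagOp fun p => if 0 ≤ p then bandSign n N else 1

variable {N : ℕ}

theorem norm_bandSign_apply (v : EuclideanSpace ℂ (Fin n)) : ‖bandSign n N v‖ = ‖v‖ :=
  norm_coordMul_apply (fun j => by split_ifs <;> simp) v

theorem norm_edgeSign_le (p : ℤ) :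
    ‖if 0 ≤ p then bandSign n N else 1‖ ≤ 1 := by
  refine ContinuousLinearMap.opNorm_le_bound _ zero_le_one fun v => ?_
  split_ifs
  · rw [norm_bandSign_apply, one_mul]
  · rw [one_apply_eq_self, one_mul]

theorem edgeSign_apply (w : Line n) (p : ℤ) (j : Fin n) :
    edgeSign n N w p j = (if 0 ≤ p ∧ j.val < N then -1 else 1) * w p j := by
  unfold edgeSign
  rw [diagOp_apply norm_edgeSign_le]
  by_cases hp : 0 ≤ p
  · simp only [hp, if_true, true_and, bandSign, coordMul_apply]
  · simp [hp]

theorem edgeSign_edgeSign (w : Line n) : edgeSign n N (edgeSign n N w) = w := by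
  ext p j
  rw [edgeSign_apply, edgeSign_apply]
  split_ifs <;> ring

theorem symmOp_edgeSign : SymmOp (edgeSign n N) := by
  intro u v
  rw [lp.inner_eq_tsum, lp.inner_eq_tsum]
  refine tsum_congr fun p => ?_
  rw [PiLp.inner_apply, PiLp.inner_apply]
  refine Finset.sum_congr rfl fun j _ => ?_
  rw [edgeSign_apply, edgeSign_apply, RCLike.inner_apply, RCLike.inner_apply]
  split_ifs <;> simp

variable {c : Fin n → ℤ} {G : ℝ → Line n →L[ℂ] Line n} {r : ℕ} {δ : ℝ}

/-- The form of the edge operator in the trivialization `G`. -/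
def Hamiltonian.trivForm (H : Hamiltonian n) (G : ℝ → Line n →L[ℂ] Line n) (ky : ℝ) (z : ℂ) :
    Line n →L[ℂ] Line n := (G ky).adjoint * (H.pencil ky z * G ky)

theorem Hamiltonian.inner_trivForm (z : ℂ) (u v : Line n) :
    ⟪u, H.trivForm G ky z v⟫_ℂ = ⟪G ky u, H.pencil ky z (G ky v)⟫_ℂ := by
  unfold Hamiltonian.trivForm
  rw [mul_apply_eq_comp, ContinuousLinearMap.adjoint_inner_right, mul_apply_eq_comp]

theorem IsTrivialization.exists_bound (hG : IsTrivialization H N c G r δ) :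
    ∃ M > 0, ∀ k ∈ Icc 0 (2 * π), ‖G k‖ ≤ M := by
  obtain ⟨M, hM⟩ := isCompact_Icc.exists_bound_of_continuousOn
    (hG.continuous.continuousOn (s := Icc 0 (2 * π)))
  exact ⟨max M 1, lt_max_of_lt_right one_pos, fun k hk => (hM k hk).trans (le_max_left _ _)⟩

theorem Hamiltonian.exists_bound_hop (H : Hamiltonian n) :
    ∃ M > 0, ∀ k ∈ Icc 0 (2 * π), ∑ d ∈ Finset.Icc (-1 : ℤ) 1, ‖H.hop k d‖ ≤ M := by
  have hc : Continuous fun k => ∑ d ∈ Finset.Icc (-1 : ℤ) 1, ‖H.hop k d‖ :=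
    continuous_finsetSum _ fun d _ => (H.continuous_hop d).norm
  obtain ⟨M, hM⟩ := isCompact_Icc.exists_bound_of_continuousOn
    (hc.continuousOn (s := Icc 0 (2 * π)))
  exact ⟨max M 1, lt_max_of_lt_right one_pos, fun k hk =>
    (le_abs_self _).trans ((hM k hk).trans (le_max_left _ _))⟩

theorem IsTrivialization.le_re_inner (hG : IsTrivialization H N c G r δ) (R : ℝ) :
    ∃ L : ℕ, ∀ k ∈ Icc 0 (2 * π), ∀ z : ℂ, ‖z‖ ≤ R → ∀ w : Line n, (∀ p, |p| ≤ (L : ℤ) → w p = 0) →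
      δ / 2 * ‖w‖ ^ 2 ≤ (⟪edgeSign n N w, H.trivForm G k z w⟫_ℂ).re := by
  obtain ⟨M, hM0, hM⟩ := hG.exists_bound
  obtain ⟨M', hM0', hM'⟩ := H.exists_bound_hop
  have hδ := hG.pos
  obtain ⟨L, hL⟩ := exists_nat_gt ((M' + |R|) * M ^ 2 / (δ / 2))
  refine ⟨L + r, fun k hk z hz w hw => ?_⟩
  have hwl : ∀ p : ℤ, |if p < 0 then (1 : ℝ) else 0| ≤ 1 := abs_ite_le_one _
  have hwr : ∀ p : ℤ, |if 0 ≤ p then (1 : ℝ) else 0| ≤ 1 := abs_ite_le_one _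
  let x : Line n := scalOp (fun p => if p < 0 then 1 else 0) w
  let y : Line n := scalOp (fun p => if 0 ≤ p then 1 else 0) w
  have hx : ∀ p, -((L + r : ℕ) : ℤ) ≤ p → x p = 0 := fun p hp => by
    simp only [x]
    rw [scalOp_apply hwl]
    split_ifs with h
    · rw [hw p (abs_le.2 ⟨hp, by omega⟩), smul_zero]
    · rw [Complex.ofReal_zero, zero_smul]
  have hy : ∀ p, p ≤ ((L + r : ℕ) : ℤ) → y p = 0 := fun p hp => by
    simp only [y]
    rw [scalOp_apply hwr]
    split_ifs with h
    · rw [hw p (abs_le.2 ⟨by omega, hp⟩), smul_zero]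
    · rw [Complex.ofReal_zero, zero_smul]
  have hxy : w = x + y := by
    ext1; funext p
    rw [lp.coeFn_add, Pi.add_apply]
    simp only [x, y]
    rw [scalOp_apply hwl, scalOp_apply hwr]
    rcases lt_or_ge p 0 with h | h
    · simp [h, not_le.2 h]
    · simp [h, not_lt.2 h]
  let y' : Line n := fiberOp (bandSign n N) y
  have hy' : ∀ p, p ≤ ((L + r : ℕ) : ℤ) → y' p = 0 := fun p hp => by
    simp only [y']
    rw [fiberOp_apply, hy p hp, map_zero]
  have hJ : edgeSign n N w = x + y' := by
    ext1; funext p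
    unfold edgeSign
    rw [hxy, map_add, lp.coeFn_add, lp.coeFn_add, Pi.add_apply, Pi.add_apply,
      diagOp_apply norm_edgeSign_le, diagOp_apply norm_edgeSign_le]
    simp only [y']
    rw [fiberOp_apply]
    split_ifs with h
    · rw [hx p (by omega), map_zero]
    · rw [hy p (by omega), map_zero, map_zero, one_apply_eq_self]
  have hGx : ∀ p, 0 ≤ p → G k x p = 0 := fun p hp => hG.range k x p fun q hq => hx q (by
    rw [abs_le] at hq; push_cast; omega)
  have hGright : ∀ y : Line n, (∀ p, p ≤ ((L + r : ℕ) : ℤ) → y p = 0) → ∀ p, p ≤ (L : ℤ) →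
      G k y p = 0 := fun y hy p hp => hG.range k y p fun q hq => hy q (by
    rw [abs_le] at hq; push_cast; omega)
  have hGy := hGright y hy
  have hGy' := hGright y' hy'
  have e1 : H.pencil k z (G k x) = G k x := Hamiltonian.pencil_of_neg z hGx
  have e2 : ⟪G k x, H.pencil k z (G k y)⟫_ℂ = 0 := inner_eq_zero_of_disjoint fun p => by
    rcases lt_or_ge p 0 with hp | hp
    · right
      rw [H.pencil_apply_of_neg _ _ _ hp, hGy p (by omega)]
    · exact Or.inl (hGx p hp)
  have e3 : ⟪G k y', G k x⟫_ℂ = 0 := inner_eq_zero_of_disjoint fun p => by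
    rcases lt_or_ge p 0 with hp | hp
    · exact Or.inl (hGy' p (by omega))
    · exact Or.inr (hGx p hp)
  have e4 : ‖w‖ ^ 2 = ‖x‖ ^ 2 + ‖y‖ ^ 2 := by
    have h0 : ⟪x, y⟫_ℂ = 0 := inner_eq_zero_of_disjoint fun p => by
      rcases lt_or_ge p 0 with hp | hp
      · exact Or.inr (hy p (by omega))
      · exact Or.inl (hx p (by omega))
    rw [hxy, sq, sq, sq]
    exact norm_add_sq_eq_norm_sq_add_norm_sq_of_inner_eq_zero x y h0
  have hny' : ‖y'‖ ≤ ‖y‖ := by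
    have h1 : ‖bandSign n N‖ ≤ 1 := ContinuousLinearMap.opNorm_le_bound _ zero_le_one fun v => by
      rw [norm_bandSign_apply, one_mul]
    simpa using (fiberOp (bandSign n N)).le_of_opNorm_le ((norm_fiberOp_le _).trans h1) y
  have e5 : (⟪G k x, G k x⟫_ℂ).re = ‖G k x‖ ^ 2 := by
    rw [inner_self_eq_norm_sq_to_K]; norm_cast
  rw [Hamiltonian.inner_trivForm, hJ]
  conv_rhs => rw [hxy]
  rw [map_add, map_add, map_add, e1, inner_add_left, inner_add_right, inner_add_right, e2, e3,
    add_zero, zero_add, Complex.add_re, e5]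
  have h1 := hG.le_norm k hk x
  have h2 := hG.le_inner k hk y
  have h3 : (⟪G k y', H.pencil k z (G k y)⟫_ℂ).re = (⟪G k y', convOp 1 (H.hop k) (G k y)⟫_ℂ).re
      + (⟪G k y', H.pencil k z (G k y) - convOp 1 (H.hop k) (G k y)⟫_ℂ).re := by
    rw [← Complex.add_re, ← inner_add_right, add_sub_cancel]
  have h4 : |(⟪G k y', H.pencil k z (G k y) - convOp 1 (H.hop k) (G k y)⟫_ℂ).re|
      ≤ δ / 2 * ‖y‖ ^ 2 := by
    refine (Complex.abs_re_le_norm _).trans ((norm_inner_le_norm _ _).trans ?_)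
    have h5 : ‖G k y'‖ ≤ M * ‖y‖ := (G k).le_of_opNorm_le_of_le (hM k hk) hny'
    have h6 : ‖G k y‖ ≤ M * ‖y‖ := (G k).le_of_opNorm_le (hM k hk) y
    have h7 := H.norm_pencil_sub_le k z L hGy
    have h8 : (∑ d ∈ Finset.Icc (-1 : ℤ) 1, ‖H.hop k d‖ + ‖z‖) / ((L : ℝ) + 1)
        ≤ (M' + |R|) / ((L : ℝ) + 1) :=
      div_le_div_of_nonneg_right (add_le_add (hM' k hk) (hz.trans (le_abs_self R)))
        (by positivity)
    have h9 : (M' + |R|) / ((L : ℝ) + 1) * M ^ 2 ≤ δ / 2 := by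
      rw [div_lt_iff₀ (by positivity)] at hL
      rw [div_mul_eq_mul_div, div_le_iff₀ (by positivity)]
      nlinarith
    calc _ ≤ (M * ‖y‖) * ((M' + |R|) / ((L : ℝ) + 1) * (M * ‖y‖)) := by
          refine mul_le_mul h5 (h7.trans ?_) (norm_nonneg _) (by positivity)
          exact mul_le_mul h8 h6 (norm_nonneg _) (by positivity)
      _ = ((M' + |R|) / ((L : ℝ) + 1) * M ^ 2) * ‖y‖ ^ 2 := by ring
      _ ≤ _ := mul_le_mul_of_nonneg_right h9 (sq_nonneg _)
  have h5 := neg_le_of_abs_le h4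
  rw [h3, e4]
  have h6 : 0 ≤ ‖x‖ ^ 2 := sq_nonneg _
  nlinarith

/-! ### The complement of finitely many coordinates -/

/-- The basis vector of `ℓ²(ℤ, ℂⁿ)` at the given site and band. -/
def siteVec (x : ℤ × Fin n) : Line n :=
  lp.single (E := fun _ : ℤ => EuclideanSpace ℂ (Fin n)) 2 x.1 (EuclideanSpace.single x.2 1)

theorem inner_siteVec (x : ℤ × Fin n) (w : Line n) : ⟪siteVec x, w⟫_ℂ = w x.1 x.2 := by
  unfold siteVec
  rw [lp.inner_single_left, EuclideanSpace.inner_single_left]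
  simp

theorem siteVec_apply (x : ℤ × Fin n) (p : ℤ) (j : Fin n) :
    siteVec x p j = if x = (p, j) then 1 else 0 := by
  unfold siteVec
  rw [lp.single_apply, Pi.single_apply]
  obtain ⟨q, i⟩ := x
  by_cases hq : p = q
  · subst hq
    rw [if_pos rfl]
    simp [PiLp.single_apply, eq_comm]
  · simp [hq, Ne.symm hq]

theorem orthonormal_siteVec : Orthonormal ℂ (siteVec : ℤ × Fin n → Line n) := by
  rw [orthonormal_iff_ite]
  intro x y
  rw [inner_siteVec, siteVec_apply]
  exact if_congr eq_comm rfl rfl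

/-- The span of finitely many basis vectors. -/
def siteSpan (Ω : Finset (ℤ × Fin n)) : Submodule ℂ (Line n) :=
  Submodule.span ℂ (siteVec '' (Ω : Set (ℤ × Fin n)))

instance (Ω : Finset (ℤ × Fin n)) : FiniteDimensional ℂ (siteSpan Ω) :=
  FiniteDimensional.span_of_finite ℂ (Ω.finite_toSet.image _)

theorem finrank_siteSpan (Ω : Finset (ℤ × Fin n)) : finrank ℂ (siteSpan Ω) = Ω.card := by
  have h : LinearIndependent ℂ (siteVec ∘ ((↑) : Ω → ℤ × Fin n)) :=
    (orthonormal_siteVec.comp _ Subtype.val_injective).linearIndependent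
  have e : siteVec '' (Ω : Set (ℤ × Fin n)) = range (siteVec ∘ ((↑) : Ω → ℤ × Fin n)) := by
    rw [Set.range_comp, Subtype.range_coe]
  unfold siteSpan
  rw [e, finrank_span_eq_card h, Fintype.card_coe]

/-- The sequences that vanish at finitely many coordinates. -/
abbrev offSites (Ω : Finset (ℤ × Fin n)) : Submodule ℂ (Line n) := (siteSpan Ω)ᗮ

theorem mem_offSites {Ω : Finset (ℤ × Fin n)} {w : Line n} :
    w ∈ offSites Ω ↔ ∀ x ∈ Ω, w x.1 x.2 = 0 := by
  unfold offSites siteSpan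
  rw [Submodule.mem_orthogonal]
  constructor
  · intro h x hx
    rw [← inner_siteVec]
    exact h _ (Submodule.subset_span ⟨x, hx, rfl⟩)
  · intro h u hu
    induction hu using Submodule.span_induction with
    | mem u hu =>
      obtain ⟨x, hx, rfl⟩ := hu
      rw [inner_siteVec]
      exact h x hx
    | zero => exact inner_zero_left _
    | add u v _ _ hu hv => rw [inner_add_left, hu, hv, add_zero]
    | smul a u _ hu => rw [inner_smul_left, hu, mul_zero]

theorem orthogonal_offSites (Ω : Finset (ℤ × Fin n)) : (offSites Ω)ᗮ = siteSpan Ω :=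
  Submodule.orthogonal_orthogonal _

instance (Ω : Finset (ℤ × Fin n)) : FiniteDimensional ℂ (offSites Ω)ᗮ := by
  rw [orthogonal_offSites]
  infer_instance

theorem edgeSign_mem_offSites {Ω : Finset (ℤ × Fin n)} {w : Line n} (hw : w ∈ offSites Ω) :
    edgeSign n N w ∈ offSites Ω := by
  rw [mem_offSites] at hw ⊢
  intro x hx
  rw [edgeSign_apply, hw x hx, mul_zero]

/-- All coordinates over the sites `|p| ≤ L`. -/
def box (n L : ℕ) : Finset (ℤ × Fin n) := Finset.Icc (-L : ℤ) L ×ˢ Finset.univ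

theorem IsTrivialization.exists_coercive (hG : IsTrivialization H N c G r δ) (R : ℝ) :
    ∃ L : ℕ, ∀ k ∈ Icc 0 (2 * π), ∀ z : ℂ, ‖z‖ ≤ R → ∀ Ω, box n L ⊆ Ω →
      Coercive (H.trivForm G k z) (edgeSign n N) (offSites Ω) (δ / 2) := by
  obtain ⟨L, hL⟩ := hG.le_re_inner R
  refine ⟨L, fun k hk z hz Ω hΩ => ⟨half_pos hG.pos, edgeSign_edgeSign, symmOp_edgeSign,
    fun v hv => edgeSign_mem_offSites hv, fun w hw => hL k hk z hz w fun p hp => ?_⟩⟩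
  ext j
  exact mem_offSites.1 hw (p, j) (hΩ (by
    simp only [box, Finset.mem_product, Finset.mem_Icc, Finset.mem_univ, and_true]
    exact abs_le.1 hp))

/-- The number of occupied coordinates of the half-line in `Ω`. -/
def occCard (N : ℕ) (Ω : Finset (ℤ × Fin n)) : ℕ := {x ∈ Ω | 0 ≤ x.1 ∧ x.2.val < N}.card

theorem siteSpan_mono {Ω Ω' : Finset (ℤ × Fin n)} (h : Ω ⊆ Ω') : siteSpan Ω ≤ siteSpan Ω' :=
  Submodule.span_mono (Set.image_mono (by exact_mod_cast h))

theorem siteSpan_le_offSites {Ω Ω' : Finset (ℤ × Fin n)} (h : Disjoint Ω Ω') :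
    siteSpan Ω' ≤ offSites Ω := by
  unfold siteSpan
  rw [Submodule.span_le]
  rintro _ ⟨x, hx, rfl⟩
  refine mem_offSites.2 fun y hy => ?_
  rw [siteVec_apply, if_neg]
  rintro rfl
  exact Finset.disjoint_left.1 h hy hx

theorem edgeSign_of_mem_siteSpan {Ω : Finset (ℤ × Fin n)} {a : ℂ}
    (h : ∀ x ∈ Ω, (if 0 ≤ x.1 ∧ x.2.val < N then -1 else 1 : ℂ) = a) {f : Line n}
    (hf : f ∈ siteSpan Ω) : edgeSign n N f = a • f := by
  unfold siteSpan at hf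
  induction hf using Submodule.span_induction with
  | mem u hu =>
    obtain ⟨x, hx, rfl⟩ := hu
    ext p j
    rw [edgeSign_apply, lp.coeFn_smul, Pi.smul_apply, PiLp.smul_apply, siteVec_apply, smul_eq_mul]
    by_cases hxp : x = (p, j)
    · rw [← h x hx, hxp]
    · rw [if_neg hxp, mul_zero, mul_zero]
  | zero => rw [map_zero, smul_zero]
  | add u v _ _ hu hv => rw [map_add, hu, hv, smul_add]
  | smul b u _ hu => rw [map_smul, hu, smul_comm]

theorem relIndex_offSites_of_subset {B : Line n →L[ℂ] Line n} {Ω Ω' : Finset (ℤ × Fin n)}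
    (h : Coercive B (edgeSign n N) (offSites Ω) δ) (hB : SymmOp B) (hΩ : Ω ⊆ Ω') :
    relIndex B (offSites Ω') + occCard N Ω = relIndex B (offSites Ω) + occCard N Ω' := by
  have hsub : offSites Ω' ≤ offSites Ω := Submodule.orthogonal_le (siteSpan_mono hΩ)
  have hdisj : ∀ P : ℤ × Fin n → Prop, ∀ [DecidablePred P],
      Disjoint Ω ((Ω' \ Ω).filter P) := fun P _ =>
    (Finset.disjoint_sdiff).mono_right (Finset.filter_subset _ _)
  have hle : ∀ P : ℤ × Fin n → Prop, ∀ [DecidablePred P],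
      siteSpan ((Ω' \ Ω).filter P) ≤ (offSites Ω')ᗮ := fun P _ => by
    rw [orthogonal_offSites]
    exact siteSpan_mono ((Finset.filter_subset _ _).trans Finset.sdiff_subset)
  let P : ℤ × Fin n → Prop := fun x => 0 ≤ x.1 ∧ x.2.val < N
  have hdec : DecidablePred P := fun x => inferInstanceAs (Decidable (0 ≤ x.1 ∧ x.2.val < N))
  have key := h.relIndex_eq_add hB hsub (fun v hv => edgeSign_mem_offSites hv)
    (siteSpan_le_offSites (hdisj P)) (hle P)
    (fun f hf => by
      rw [edgeSign_of_mem_siteSpan (a := -1) (fun x hx => if_pos (Finset.mem_filter.1 hx).2) hf,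
        neg_smul, one_smul])
    (siteSpan_le_offSites (hdisj fun x => ¬ P x)) (hle fun x => ¬ P x)
    (fun f hf => by
      rw [edgeSign_of_mem_siteSpan (a := 1) (fun x hx => if_neg (Finset.mem_filter.1 hx).2) hf,
        one_smul])
    (by
      rw [orthogonal_offSites, orthogonal_offSites, finrank_siteSpan, finrank_siteSpan,
        finrank_siteSpan, finrank_siteSpan, add_assoc, Finset.card_filter_add_card_filter_not,
        add_comm, Finset.card_sdiff_add_card_eq_card hΩ])
  rw [key, finrank_siteSpan, add_assoc]
  congr 1
  have e : {x ∈ Ω' | P x} = {x ∈ Ω' \ Ω | P x} ∪ {x ∈ Ω | P x} := by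
    rw [← Finset.filter_union, Finset.sdiff_union_of_subset hΩ]
  have e2 : occCard N Ω' = {x ∈ Ω' | P x}.card := by unfold occCard; congr
  have e3 : occCard N Ω = {x ∈ Ω | P x}.card := by unfold occCard; congr
  rw [e2, e3, e, Finset.card_union_of_disjoint]
  exact (Finset.disjoint_filter_filter Finset.sdiff_disjoint)

/-- The index relative to the complement of finitely many coordinates. -/
theorem relIndex_offSites {B : Line n →L[ℂ] Line n} {Ω₀ Ω Ω' : Finset (ℤ × Fin n)}
    (h : ∀ Ω, Ω₀ ⊆ Ω → Coercive B (edgeSign n N) (offSites Ω) δ) (hB : SymmOp B)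
    (hΩ : Ω₀ ⊆ Ω) (hΩ' : Ω₀ ⊆ Ω') :
    relIndex B (offSites Ω') + occCard N Ω = relIndex B (offSites Ω) + occCard N Ω' := by
  have h1 := relIndex_offSites_of_subset (h Ω₀ subset_rfl) hB hΩ
  have h2 := relIndex_offSites_of_subset (h Ω₀ subset_rfl) hB hΩ'
  omega

end Coercivity

section Counting

open Module Topology Filter
open scoped InnerProductSpace

section Abstract

variable {F : Type*} [NormedAddCommGroup F] [InnerProductSpace ℂ F] {T : F →ₗ.[ℂ] F}

theorem eigenspace_le_orthogonal (hs : ∀ u v : T.domain, ⟪T u, (v : F)⟫_ℂ = ⟪(u : F), T v⟫_ℂ)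
    {a b : ℝ} (hab : a ≠ b) : eigenspace T a ≤ (eigenspace T b)ᗮ := by
  intro u hu
  rw [Submodule.mem_orthogonal]
  intro v hv
  obtain ⟨hu', hu⟩ := mem_eigenspace_iff.1 hu
  obtain ⟨hv', hv⟩ := mem_eigenspace_iff.1 hv
  have h := hs ⟨v, hv'⟩ ⟨u, hu'⟩
  rw [sub_eq_zero.1 hu, sub_eq_zero.1 hv, inner_smul_left, inner_smul_right, Complex.conj_ofReal,
    ← sub_eq_zero, ← sub_mul] at h
  refine (mul_eq_zero.1 h).resolve_left fun h' => hab ?_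
  exact_mod_cast (sub_eq_zero.1 h').symm

/-- The number of eigenvalues in an interval is the increase of any function of the energy that
jumps by the multiplicity at every eigenvalue. -/
theorem eigenvalueCount_add (hs : ∀ u v : T.domain, ⟪T u, (v : F)⟫_ℂ = ⟪(u : F), T v⟫_ℂ)
    {f : ℝ → ℕ} {e a : ℝ} (hea : e ≤ a)
    (hloc : ∀ b ∈ Icc e a, ∀ᶠ b' : ℝ in 𝓝 b,
      (b < b' → f b' = f b + finrank ℂ (eigenspace T b)) ∧ (b' < b → f b' = f b) ∧
      (b' ≠ b → eigenspace T b' = ⊥))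
    (hfin : ∀ b ∈ Icc e a, FiniteDimensional ℂ (eigenspace T b)) :
    eigenvalueCount T e a + f e = f a := by
  have hZ : (Icc e a ∩ {b : ℝ | eigenspace T b ≠ ⊥}).Finite := by
    refine isCompact_Icc.induction_on (p := fun s => (s ∩ {b : ℝ | eigenspace T b ≠ ⊥}).Finite)
      (by simp) (fun s t hst ht => ht.subset (inter_subset_inter_left _ hst))
      (fun s t h h' => by rw [union_inter_distrib_right]; exact h.union h') fun b hb => ?_
    refine ⟨{b' | b' ≠ b → eigenspace T b' = ⊥}, mem_nhdsWithin_of_mem_nhds ?_,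
      (finite_singleton b).subset ?_⟩
    · filter_upwards [hloc b hb] with b' h using h.2.2
    · rintro b' ⟨h1, h2⟩
      by_contra h3
      exact h2 (h1 h3)
  let M : ℝ → Submodule ℂ F := fun b => ⨆ μ ∈ Ico e b, eigenspace T (μ : ℂ)
  have hMfin : ∀ b ∈ Icc e a, FiniteDimensional ℂ (M b) := by
    intro b hb
    have h1 : FiniteDimensional ℂ (hZ.toFinset.sup fun μ : ℝ => eigenspace T μ : Submodule ℂ F) := by
      refine Finset.sup_induction (p := fun S : Submodule ℂ F => FiniteDimensional ℂ S)
        (finiteDimensional_bot ℂ F) (fun S _ S' _ => Submodule.finiteDimensional_sup S S')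
        fun μ hμ => hfin μ ?_
      exact (hZ.mem_toFinset.1 hμ).1
    refine Submodule.finiteDimensional_of_le (S₂ := hZ.toFinset.sup fun μ : ℝ => eigenspace T μ) ?_
    refine iSup₂_le fun μ hμ => ?_
    by_cases h0 : eigenspace T μ = ⊥
    · rw [h0]; exact bot_le
    · exact Finset.le_sup (f := fun μ : ℝ => eigenspace T μ)
        (hZ.mem_toFinset.2 ⟨⟨hμ.1, hμ.2.le.trans hb.2⟩, h0⟩)
  have hconst : ∀ b ∈ Icc e a, (finrank ℂ (M b) : ℤ) - f b = (finrank ℂ (M e) : ℤ) - f e := by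
    intro b hb
    refine isPreconnected_Icc.constant (f := fun b => (finrank ℂ (M b) : ℤ) - f b)
      (fun b hb => ?_) hb (left_mem_Icc.2 hea)
    refine tendsto_nhds_of_eventually_eq ?_
    obtain ⟨ε, hε, hball⟩ := Metric.eventually_nhds_iff_ball.1 (hloc b hb)
    filter_upwards [mem_nhdsWithin_of_mem_nhds (Metric.ball_mem_nhds b hε), self_mem_nhdsWithin]
      with b' hb' hmem
    obtain ⟨h1, h2, h3⟩ := hball b' hb'
    have hbot : ∀ μ ∈ uIcc b b', μ ≠ b → eigenspace T (μ : ℂ) = ⊥ := fun μ hμ hne =>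
      (hball μ ((convex_ball b ε).ordConnected.uIcc_subset (Metric.mem_ball_self hε) hb' hμ)).2.2 hne
    rcases lt_trichotomy b' b with h | h | h
    · have hM : M b' = M b := by
        refine le_antisymm (biSup_mono fun μ hμ => ⟨hμ.1, hμ.2.trans h⟩) (iSup₂_le fun μ hμ => ?_)
        rcases lt_or_ge μ b' with h4 | h4
        · exact le_iSup₂_of_le (f := fun μ (_ : μ ∈ Ico e b') => eigenspace T (μ : ℂ)) μ
            ⟨hμ.1, h4⟩ le_rfl
        · rw [hbot μ (mem_uIcc.2 (Or.inr ⟨h4, hμ.2.le⟩)) hμ.2.ne]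
          exact bot_le
      rw [hM, h2 h]
    · rw [h]
    · have hM : M b' = M b ⊔ eigenspace T b := by
        refine le_antisymm (iSup₂_le fun μ hμ => ?_) (sup_le
          (biSup_mono fun μ hμ => ⟨hμ.1, hμ.2.trans h⟩)
          (le_iSup₂_of_le (f := fun μ (_ : μ ∈ Ico e b') => eigenspace T (μ : ℂ)) b
            ⟨hb.1, h⟩ le_rfl))
        rcases lt_trichotomy μ b with h4 | h4 | h4
        · exact le_sup_of_le_left (le_iSup₂_of_le
            (f := fun μ (_ : μ ∈ Ico e b) => eigenspace T (μ : ℂ)) μ ⟨hμ.1, h4⟩ le_rfl)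
        · rw [h4]; exact le_sup_right
        · rw [hbot μ (mem_uIcc.2 (Or.inl ⟨h4.le, hμ.2.le⟩)) h4.ne']
          exact bot_le
      have hdisj : M b ⊓ eigenspace T b = ⊥ := by
        have h4 : M b ≤ (eigenspace T b)ᗮ :=
          iSup₂_le fun μ hμ => eigenspace_le_orthogonal hs hμ.2.ne
        rw [← disjoint_iff]
        exact (Submodule.orthogonal_disjoint _).symm.mono_left h4
      have := hMfin b hb
      have := hfin b hb
      have h4 := Submodule.finrank_sup_add_finrank_inf_eq (M b) (eigenspace T b)
      rw [hdisj, finrank_bot, add_zero] at h4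
      rw [hM, h4, h1 h]
      push_cast
      ring
  have h0 : finrank ℂ (M e) = 0 := by
    have : M e = ⊥ := by simp [M]
    rw [this, finrank_bot]
  have h1 := hconst a (right_mem_Icc.2 hea)
  rw [h0] at h1
  have h2 : eigenvalueCount T e a = finrank ℂ (M a) := rfl
  omega

end Abstract

variable {n : ℕ} {H : Hamiltonian n} {ky : ℝ} {N : ℕ} {c : Fin n → ℤ}
  {G : ℝ → Line n →L[ℂ] Line n} {r : ℕ} {δ : ℝ}

theorem Hamiltonian.symmOp_trivForm (H : Hamiltonian n) (G : ℝ → Line n →L[ℂ] Line n) (ky t : ℝ) :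
    SymmOp (H.trivForm G ky t) := by
  intro u v
  rw [Hamiltonian.inner_trivForm, ← inner_conj_symm, Hamiltonian.inner_trivForm, inner_conj_symm]
  unfold Hamiltonian.pencil
  simp only [sub_apply, smul_apply, inner_sub_left, inner_sub_right, inner_smul_left,
    inner_smul_right, Complex.conj_ofReal]
  rw [H.symmOp_rescaled, symmOp_massOp]

theorem Hamiltonian.quadForm_trivForm (t : ℝ) (u : Line n) :
    quadForm (H.trivForm G ky t) u = (⟪G ky u, H.rescaled ky (G ky u)⟫_ℂ).re
      - t * (⟪G ky u, massOp (G ky u)⟫_ℂ).re := by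
  unfold quadForm
  rw [Hamiltonian.inner_trivForm]
  unfold Hamiltonian.pencil
  rw [sub_apply, smul_apply, inner_sub_right, inner_smul_right, Complex.sub_re,
    Complex.re_ofReal_mul]

theorem re_inner_massOp_nonneg (v : Line n) : 0 ≤ (⟪v, massOp v⟫_ℂ).re :=
  (re_inner_massOp v).nonneg fun _ => by positivity

theorem trivForm_eq_zero_iff (hu : IsUnit (G ky)) {z : ℂ} {v : Line n} :
    H.trivForm G ky z v = 0 ↔ H.pencil ky z (G ky v) = 0 := by
  unfold Hamiltonian.trivForm
  rw [mul_apply_eq_comp, mul_apply_eq_comp]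
  have hinj : Function.Injective (G ky).adjoint := by
    rw [← ContinuousLinearMap.star_eq_adjoint]
    exact (ContinuousLinearMap.isUnit_iff_bijective.1 hu.star).1
  exact map_eq_zero_iff _ hinj

theorem isUnit_pencil_iff (hu : IsUnit (G ky)) {z : ℂ} :
    IsUnit (H.pencil ky z) ↔ IsUnit (H.trivForm G ky z) := by
  unfold Hamiltonian.trivForm
  obtain ⟨g, hg⟩ := hu
  have h : ((star g : (Line n →L[ℂ] Line n)ˣ) : Line n →L[ℂ] Line n) = (G ky).adjoint := by
    rw [← hg]; rfl
  rw [← h, ← hg, Units.isUnit_units_mul, Units.isUnit_mul_units]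

theorem map_ker_trivForm (hu : IsUnit (G ky)) (z : ℂ) :
    (LinearMap.ker (H.trivForm G ky z : Line n →ₗ[ℂ] Line n)).map
        ((G ky : Line n →L[ℂ] Line n) : Line n →ₗ[ℂ] Line n)
      = LinearMap.ker (H.pencil ky z : Line n →ₗ[ℂ] Line n) := by
  ext v
  constructor
  · rintro ⟨w, hw, rfl⟩
    exact (trivForm_eq_zero_iff hu).1 hw
  · intro hv
    obtain ⟨w, rfl⟩ := (ContinuousLinearMap.isUnit_iff_bijective.1 hu).2 v
    exact ⟨w, (trivForm_eq_zero_iff hu).2 hv, rfl⟩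

theorem eq_zero_of_isUnit (hu : IsUnit (G ky)) {v : Line n} (hv : G ky v = 0) : v = 0 :=
  (ContinuousLinearMap.isUnit_iff_bijective.1 hu).1 (by rw [hv, map_zero])

theorem Hamiltonian.IsGapped.eigenspace_eq_map (hH : H.IsGapped ky) (hu : IsUnit (G ky)) (z : ℂ) :
    eigenspace (H.edgeFiber ky) z = (LinearMap.ker (H.trivForm G ky z : Line n →ₗ[ℂ] Line n)).map
      (((unscale ∘L G ky : Line n →L[ℂ] HalfLine n)) : Line n →ₗ[ℂ] HalfLine n) := by
  rw [hH.eigenspace_edgeFiber, ← map_ker_trivForm hu, ← Submodule.map_comp]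
  rfl

theorem eq_zero_of_unscale_comp (hu : IsUnit (G ky)) {z : ℂ} :
    ∀ v ∈ LinearMap.ker (H.trivForm G ky z : Line n →ₗ[ℂ] Line n),
      (((unscale ∘L G ky : Line n →L[ℂ] HalfLine n)) : Line n →ₗ[ℂ] HalfLine n) v = 0 → v = 0 :=
  fun _ hv h => eq_zero_of_isUnit hu
    (eq_zero_of_unscale_eq_zero ((trivForm_eq_zero_iff hu).1 hv) h)

theorem Hamiltonian.IsGapped.finrank_eigenspace (hH : H.IsGapped ky) (hu : IsUnit (G ky)) (z : ℂ) :
    finrank ℂ (eigenspace (H.edgeFiber ky) z)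
      = finrank ℂ (LinearMap.ker (H.trivForm G ky z : Line n →ₗ[ℂ] Line n)) := by
  rw [hH.eigenspace_eq_map hu]
  exact finrank_map_eq_of_forall _ _ (eq_zero_of_unscale_comp hu)

theorem Hamiltonian.IsGapped.eigenspace_eq_bot_iff (hH : H.IsGapped ky) (hu : IsUnit (G ky))
    (z : ℂ) : eigenspace (H.edgeFiber ky) z = ⊥
      ↔ LinearMap.ker (H.trivForm G ky z : Line n →ₗ[ℂ] Line n) = ⊥ := by
  rw [hH.eigenspace_eq_map hu]
  constructor
  · intro h
    rw [eq_bot_iff]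
    intro v hv
    refine eq_zero_of_unscale_comp hu v hv ?_
    have := Submodule.mem_map_of_mem (f := ((unscale ∘L G ky : Line n →L[ℂ] HalfLine n) :
      Line n →ₗ[ℂ] HalfLine n)) hv
    rw [h] at this
    exact this
  · intro h
    rw [h, Submodule.map_bot]

theorem Hamiltonian.continuous_trivForm_energy (H : Hamiltonian n)
    (G : ℝ → Line n →L[ℂ] Line n) (ky : ℝ) :
    Continuous fun t : ℝ => H.trivForm G ky t := by
  unfold Hamiltonian.trivForm Hamiltonian.pencil
  have : Continuous fun t : ℝ => (t : ℂ) • (massOp : Line n →L[ℂ] Line n) :=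
    Complex.continuous_ofReal.smul continuous_const
  exact continuous_const.mul ((continuous_const.sub this).mul continuous_const)

theorem IsTrivialization.continuous_trivForm (hG : IsTrivialization H N c G r δ) (z : ℂ) :
    Continuous fun k => H.trivForm G k z := by
  unfold Hamiltonian.trivForm Hamiltonian.pencil
  exact (ContinuousLinearMap.adjoint.continuous.comp hG.continuous).mul
    ((H.continuous_rescaled.sub continuous_const).mul hG.continuous)

/-- The behavior of the index near a given energy. -/
theorem Hamiltonian.IsGapped.eventually_relIndex (hH : H.IsGapped ky) (hu : IsUnit (G ky)) {R : ℝ}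
    {Ω : Finset (ℤ × Fin n)} (h : ∀ z : ℂ, ‖z‖ ≤ R →
      Coercive (H.trivForm G ky z) (edgeSign n N) (offSites Ω) δ) {b : ℝ} (hb : |b| < R) :
    ∀ᶠ b' : ℝ in 𝓝 b,
      (b < b' → relIndex (H.trivForm G ky b') (offSites Ω)
        = relIndex (H.trivForm G ky b) (offSites Ω)
          + finrank ℂ (eigenspace (H.edgeFiber ky) b)) ∧
      (b' < b → relIndex (H.trivForm G ky b') (offSites Ω)
        = relIndex (H.trivForm G ky b) (offSites Ω)) ∧
      (b' ≠ b → eigenspace (H.edgeFiber ky) b' = ⊥) := by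
  have key := eventually_relIndex_eq (X := fun t : ℝ => H.trivForm G ky t) (V := offSites Ω)
    (J := edgeSign n N) (δ := δ) (R := R) (H.continuous_trivForm_energy G ky)
    (fun t ht => h t (by rw [Complex.norm_real]; exact ht.le)) (fun t => H.symmOp_trivForm G ky t)
    (fun t t' htt u => by
      rw [Hamiltonian.quadForm_trivForm, Hamiltonian.quadForm_trivForm]
      have := mul_le_mul_of_nonneg_right htt (re_inner_massOp_nonneg (G ky u))
      linarith)
    (fun t t' htt u hu0 hne => by
      have h1 : H.pencil ky t (G ky u) = 0 := (trivForm_eq_zero_iff hu).1 hu0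
      have h2 : 0 < (⟪G ky u, massOp (G ky u)⟫_ℂ).re := by
        refine lt_of_le_of_ne (re_inner_massOp_nonneg _) fun h0 => hne ?_
        exact eq_zero_of_isUnit hu (eq_zero_of_ker_pencil h1 h0.symm)
      have h3 : quadForm (H.trivForm G ky t) u = 0 := by
        unfold quadForm
        rw [hu0, inner_zero_right, Complex.zero_re]
      rw [Hamiltonian.quadForm_trivForm] at h3 ⊢
      nlinarith)
    hb
  filter_upwards [key] with b' hb'
  rw [hH.finrank_eigenspace hu, hH.eigenspace_eq_bot_iff hu]
  exact hb'

theorem finiteDimensional_eigenspace (hH : H.IsGapped ky) (hu : IsUnit (G ky))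
    {Ω : Finset (ℤ × Fin n)} {z : ℂ}
    (h : Coercive (H.trivForm G ky z) (edgeSign n N) (offSites Ω) δ) :
    FiniteDimensional ℂ (eigenspace (H.edgeFiber ky) z) := by
  have := h.finiteDimensional
  have := Submodule.finiteDimensional_of_le (ker_le_formOrth (H.trivForm G ky z) (offSites Ω))
  rw [hH.eigenspace_eq_map hu]
  infer_instance

theorem eigenvalueCount_edgeFiber (hH : H.IsGapped ky) (hu : IsUnit (G ky)) {R : ℝ}
    {Ω : Finset (ℤ × Fin n)} (h : ∀ z : ℂ, ‖z‖ ≤ R →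
      Coercive (H.trivForm G ky z) (edgeSign n N) (offSites Ω) δ) {e a : ℝ} (hea : e ≤ a)
    (he : |e| < R) (ha : |a| < R) :
    eigenvalueCount (H.edgeFiber ky) e a + relIndex (H.trivForm G ky e) (offSites Ω)
      = relIndex (H.trivForm G ky a) (offSites Ω) := by
  have hR : ∀ b ∈ Icc e a, |b| < R := fun b hb => by
    rw [abs_lt] at he ha ⊢
    exact ⟨he.1.trans_le hb.1, hb.2.trans_lt ha.2⟩
  refine eigenvalueCount_add (H.edgeFiber_symmetric ky)
    (f := fun b : ℝ => relIndex (H.trivForm G ky b) (offSites Ω)) hea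
    (fun b hb => hH.eventually_relIndex hu h (hR b hb))
    fun b hb => finiteDimensional_eigenspace hH hu (h b ?_)
  rw [Complex.norm_real]
  exact (hR b hb).le

theorem mem_resolventSet_of_ker_eq_bot (hH : H.IsGapped ky) (hu : IsUnit (G ky))
    {Ω : Finset (ℤ × Fin n)} {z : ℂ}
    (h : Coercive (H.trivForm G ky z) (edgeSign n N) (offSites Ω) δ)
    (hz : eigenspace (H.edgeFiber ky) z = ⊥) : z ∈ resolventSet (H.edgeFiber ky) :=
  hH.mem_resolventSet ((isUnit_pencil_iff hu).2
    (h.isUnit ((hH.eigenspace_eq_bot_iff hu z).1 hz)))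

theorem eigenspace_eq_bot_of_im_ne_zero (hH : H.IsGapped ky) {z : ℂ} (hz : z.im ≠ 0) :
    eigenspace (H.edgeFiber ky) z = ⊥ := by
  rw [hH.eigenspace_edgeFiber, ker_pencil_eq_bot_of_im_ne_zero H ky hz, Submodule.map_bot]

theorem IsTrivialization.isSelfAdjoint (hG : IsTrivialization H N c G r δ)
    (hky : ky ∈ Icc 0 (2 * π)) (hH : H.IsGapped ky) : IsSelfAdjoint (H.edgeFiber ky) := by
  obtain ⟨L, hL⟩ := hG.exists_coercive 1
  refine isSelfAdjoint_of_resolvent dense_edgeDomain (H.edgeFiber_symmetric ky) ?_ ?_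
  · exact mem_resolventSet_of_ker_eq_bot hH (hG.isUnit ky hky)
      (hL ky hky Complex.I (by simp) (box n L) subset_rfl)
      (eigenspace_eq_bot_of_im_ne_zero hH (by simp))
  · exact mem_resolventSet_of_ker_eq_bot hH (hG.isUnit ky hky)
      (hL ky hky (-Complex.I) (by simp) (box n L) subset_rfl)
      (eigenspace_eq_bot_of_im_ne_zero hH (by simp))

theorem IsTrivialization.hasDiscreteSpectrum (hG : IsTrivialization H N c G r δ)
    (hky : ky ∈ Icc 0 (2 * π)) (hH : H.IsGapped ky) : HasDiscreteSpectrum (H.edgeFiber ky) := by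
  intro z hz
  obtain ⟨L, hL⟩ := hG.exists_coercive (‖z‖ + 1)
  have hu := hG.isUnit ky hky
  have hco := fun z' hz' => hL ky hky z' hz' (box n L) subset_rfl
  have hspec : ∀ w ∈ spectrum (H.edgeFiber ky), ‖w‖ ≤ ‖z‖ + 1 →
      eigenspace (H.edgeFiber ky) w ≠ ⊥ := fun w hw hwz h =>
    hw (mem_resolventSet_of_ker_eq_bot hH hu (hco w hwz) h)
  have hreal : ∀ w ∈ spectrum (H.edgeFiber ky), ‖w‖ ≤ ‖z‖ + 1 → ((w.re : ℝ) : ℂ) = w := by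
    intro w hw hwz
    by_contra hne
    refine hspec w hw hwz (eigenspace_eq_bot_of_im_ne_zero hH fun him => hne ?_)
    exact Complex.ext (Complex.ofReal_re _) (by rw [Complex.ofReal_im, him])
  have hz1 : ‖z‖ ≤ ‖z‖ + 1 := by linarith
  have hzre := hreal z hz hz1
  have hzR : |z.re| < ‖z‖ + 1 := (Complex.abs_re_le_norm z).trans_lt (by linarith)
  obtain ⟨ε, hε, hball⟩ := Metric.eventually_nhds_iff_ball.1
    (hH.eventually_relIndex hu hco hzR)
  refine ⟨⟨min ε 1, lt_min hε one_pos, fun w hw hwz => ?_⟩, hspec z hz hz1,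
    finiteDimensional_eigenspace hH hu (hco z hz1)⟩
  have hwn : ‖w‖ ≤ ‖z‖ + 1 := by
    have h1 : dist w z ≤ 1 := hwz.le.trans (min_le_right _ _)
    rw [dist_eq_norm] at h1
    have h2 := norm_sub_norm_le w z
    linarith
  have hwre := hreal w hw hwn
  by_contra hne
  refine hspec w hw hwn ?_
  have hmem : w.re ∈ Metric.ball z.re ε := by
    rw [Metric.mem_ball]
    refine lt_of_le_of_lt ?_ (hwz.trans_le (min_le_left _ _))
    rw [Real.dist_eq, dist_eq_norm, ← Complex.sub_re]
    exact Complex.abs_re_le_norm _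
  rw [← hwre]
  refine (hball _ hmem).2.2 fun h => hne ?_
  rw [← hwre, ← hzre, h]

theorem Hamiltonian.edgeFiber_periodic (H : Hamiltonian n) :
    Function.Periodic H.edgeFiber (2 * π) := by
  intro ky
  have : H.edgeAction (ky + 2 * π) = H.edgeAction ky := by
    funext ψ m
    unfold Hamiltonian.edgeAction Hamiltonian.edgeBlock
    simp only [exp_add_two_pi_mul_int]
  unfold Hamiltonian.edgeFiber
  simp only [this]

end Counting

section SpectralFlow

open Module Topology Filter
open scoped InnerProductSpace

variable {n : ℕ} {H : Hamiltonian n} {N : ℕ} {c : Fin n → ℤ}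
  {G : ℝ → Line n →L[ℂ] Line n} {r : ℕ} {δ : ℝ}

/-- The coordinates over the sites `p` with `|p + c j| ≤ L`, in the `j`-th band. -/
def tiltedBox (c : Fin n → ℤ) (L : ℕ) : Finset (ℤ × Fin n) :=
  (box n L).map ⟨fun x => (x.1 - c x.2, x.2), fun x y h => by
    obtain ⟨p, i⟩ := x
    obtain ⟨q, j⟩ := y
    simp only [Prod.mk.injEq] at h
    obtain ⟨h1, rfl⟩ := h
    rw [sub_left_inj] at h1
    rw [h1]⟩

theorem mem_box {L : ℕ} {x : ℤ × Fin n} : x ∈ box n L ↔ |x.1| ≤ L := by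
  simp [box, abs_le]

theorem mem_tiltedBox {L : ℕ} {x : ℤ × Fin n} : x ∈ tiltedBox c L ↔ |x.1 + c x.2| ≤ L := by
  unfold tiltedBox
  rw [Finset.mem_map]
  constructor
  · rintro ⟨y, hy, rfl⟩
    have := mem_box.1 hy
    change |y.1 - c y.2 + c y.2| ≤ (L : ℤ)
    rwa [sub_add_cancel]
  · intro h
    exact ⟨(x.1 + c x.2, x.2), mem_box.2 h, Prod.ext (add_sub_cancel_right _ _) rfl⟩

theorem tiltedBox_zero (L : ℕ) : tiltedBox (0 : Fin n → ℤ) L = box n L := by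
  ext x
  rw [mem_tiltedBox, mem_box, Pi.zero_apply, add_zero]

theorem box_subset_tiltedBox {L M : ℕ} (h : ∀ j, (L : ℤ) + |c j| ≤ M) :
    box n L ⊆ tiltedBox c M := fun x hx => by
  rw [mem_box] at hx
  rw [mem_tiltedBox]
  exact (abs_add_le _ _).trans (by linarith [h x.2])

theorem occCard_tiltedBox {L : ℕ} (h : ∀ j, |c j| ≤ (L : ℤ)) :
    (occCard N (tiltedBox c L) : ℤ) = ∑ j : Fin n with j.val < N, ((L : ℤ) + 1 - c j) := by
  unfold occCard
  rw [Finset.card_eq_sum_card_fiberwise (f := Prod.snd)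
    (t := Finset.univ.filter fun j : Fin n => j.val < N) (fun x hx => by
      simp only [Finset.coe_filter, Set.mem_ofPred_eq] at hx
      simpa using hx.2.2), Nat.cast_sum]
  refine Finset.sum_congr rfl fun j hj => ?_
  have hj' := (Finset.mem_filter.1 hj).2
  have hcj := abs_le.1 (h j)
  have e : Finset.filter (fun x => x.2 = j)
      (Finset.filter (fun x : ℤ × Fin n => 0 ≤ x.1 ∧ x.2.val < N) (tiltedBox c L))
      = (Finset.Icc (0 : ℤ) (L - c j)).map ⟨fun p => (p, j), fun p q h => (Prod.mk.inj h).1⟩ := by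
    ext ⟨p, i⟩
    simp only [Finset.mem_filter, mem_tiltedBox, Finset.mem_map, Finset.mem_Icc, abs_le]
    constructor
    · rintro ⟨⟨h1, h2, h3⟩, rfl⟩
      exact ⟨p, by omega, rfl⟩
    · rintro ⟨q, h1, h2⟩
      obtain ⟨rfl, rfl⟩ := Prod.mk.inj h2
      exact ⟨⟨by omega, by omega, hj'⟩, rfl⟩
  rw [e, Finset.card_map, Int.card_Icc]
  omega

theorem bandShift_bandShift (c c' : Fin n → ℤ) (h : ∀ j, c j + c' j = 0) (w : Line n) :
    bandShift c (bandShift c' w) = w := by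
  ext p j
  rw [bandShift_apply, bandShift_apply, add_assoc, h, add_zero]

theorem injective_bandShift (c : Fin n → ℤ) :
    Function.Injective ((bandShift c : Line n →L[ℂ] Line n) : Line n →ₗ[ℂ] Line n) :=
  Function.LeftInverse.injective (g := bandShift (-c))
    (bandShift_bandShift (-c) c fun j => by simp)

theorem bandShift_mem_offSites {L : ℕ} {w : Line n} :
    bandShift c w ∈ offSites (tiltedBox c L) ↔ w ∈ offSites (box n L) := by
  simp only [mem_offSites, bandShift_apply]
  constructor
  · intro h x hx
    have := h (x.1 - c x.2, x.2) (by rw [mem_tiltedBox]; simpa using mem_box.1 hx)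
    simpa using this
  · intro h x hx
    exact h (x.1 + c x.2, x.2) (mem_box.2 (mem_tiltedBox.1 hx))

theorem Hamiltonian.pencil_two_pi (H : Hamiltonian n) (z : ℂ) :
    H.pencil (2 * π) z = H.pencil 0 z := by
  have h : ∀ d, H.hop (2 * π) d = H.hop 0 d := fun d => by
    rw [← H.hop_add_two_pi 0 d, zero_add]
  unfold Hamiltonian.pencil Hamiltonian.rescaled
  simp only [h]

theorem IsTrivialization.inner_trivForm_two_pi (hG : IsTrivialization H N c G r δ) (z : ℂ)
    (u v : Line n) : ⟪u, H.trivForm G (2 * π) z v⟫_ℂ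
      = ⟪bandShift c u, H.trivForm G 0 z (bandShift c v)⟫_ℂ := by
  rw [Hamiltonian.inner_trivForm, Hamiltonian.inner_trivForm, H.pencil_two_pi, hG.glue,
    mul_apply_eq_comp, mul_apply_eq_comp]

theorem IsTrivialization.relIndex_two_pi (hG : IsTrivialization H N c G r δ) {z : ℂ} {L : ℕ} {ε : ℝ}
    (h : Coercive (H.trivForm G (2 * π) z) (edgeSign n N) (offSites (box n L)) ε)
    (h' : Coercive (H.trivForm G 0 z) (edgeSign n N) (offSites (tiltedBox c L)) ε) :
    relIndex (H.trivForm G (2 * π) z) (offSites (box n L))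
      = relIndex (H.trivForm G 0 z) (offSites (tiltedBox c L)) := by
  have := h.finiteDimensional
  have := h'.finiteDimensional
  have hinv : ∀ w, bandShift c (bandShift (-c) w) = w :=
    bandShift_bandShift c (-c) fun j => by simp
  have hmem : ∀ u, u ∈ formOrth (H.trivForm G (2 * π) z) (offSites (box n L)) ↔
      bandShift c u ∈ formOrth (H.trivForm G 0 z) (offSites (tiltedBox c L)) := by
    intro u
    rw [mem_formOrth, mem_formOrth]
    constructor
    · intro hu v hv
      rw [← hinv v, ← hG.inner_trivForm_two_pi]
      exact hu _ (bandShift_mem_offSites.1 (by rwa [hinv]))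
    · intro hu v hv
      rw [hG.inner_trivForm_two_pi]
      exact hu _ (bandShift_mem_offSites.2 hv)
  have hq : ∀ u, quadForm (H.trivForm G 0 z) (bandShift c u)
      = quadForm (H.trivForm G (2 * π) z) u := fun u => by
    unfold quadForm
    rw [hG.inner_trivForm_two_pi]
  refine le_antisymm ?_ ?_
  · exact negDim_le_of_equiv _ (injective_bandShift c) (fun u hu => (hmem u).1 hu) fun u _ => hq u
  · refine negDim_le_of_equiv _ (injective_bandShift (-c)) (fun u hu => ?_) fun u _ => ?_
    · refine (hmem _).2 ?_
      change bandShift c (bandShift (-c) u) ∈ _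
      rwa [hinv]
    · change quadForm _ (bandShift (-c) u) = _
      rw [← hq, hinv]

theorem zero_mem_Icc_two_pi : (0 : ℝ) ∈ Icc 0 (2 * π) := ⟨le_rfl, by positivity⟩

theorem two_pi_mem_Icc_two_pi : 2 * π ∈ Icc 0 (2 * π) := ⟨by positivity, le_rfl⟩

theorem IsTrivialization.spectralFlow_eq (hG : IsTrivialization H N c G r δ)
    (hH : ∀ k ∈ Icc 0 (2 * π), H.IsGapped k) {e : ℝ} {s : ℤ}
    (hs : HasSpectralFlow H.edgeFiber 0 (2 * π) e s) : s = ∑ j : Fin n with j.val < N, c j := by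
  obtain ⟨m, t, a, ht, ht0, htm, ha, rfl⟩ := hs
  obtain ⟨R, hR⟩ : ∃ R : ℝ, |e| < R ∧ ∀ i < m, |a i| < R := by
    refine ⟨|e| + ∑ i ∈ Finset.range m, |a i| + 1, ?_, fun i hi => ?_⟩
    · have : 0 ≤ ∑ i ∈ Finset.range m, |a i| := Finset.sum_nonneg fun _ _ => abs_nonneg _
      linarith
    · have : |a i| ≤ ∑ i ∈ Finset.range m, |a i| := Finset.single_le_sum (f := fun i => |a i|) (fun _ _ => abs_nonneg _)
        (Finset.mem_range.2 hi)
      have := abs_nonneg e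
      linarith
  obtain ⟨L₀, hL₀⟩ := hG.exists_coercive R
  let L := L₀ + ∑ j, (c j).natAbs
  have hc : ∀ j, (L₀ : ℤ) + |c j| ≤ L := fun j => by
    have : (c j).natAbs ≤ ∑ j, (c j).natAbs := Finset.single_le_sum (f := fun j => (c j).natAbs) (fun _ _ => Nat.zero_le _)
      (Finset.mem_univ j)
    simp only [L]
    rw [Int.abs_eq_natAbs]
    exact_mod_cast Nat.add_le_add_left this L₀
  have hbox : box n L₀ ⊆ box n L := fun x hx => by
    rw [mem_box] at hx ⊢
    exact hx.trans (by exact_mod_cast Nat.le_add_right _ _)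
  have hco : ∀ k ∈ Icc 0 (2 * π), ∀ z : ℂ, ‖z‖ ≤ R →
      Coercive (H.trivForm G k z) (edgeSign n N) (offSites (box n L)) (δ / 2) :=
    fun k hk z hz => hL₀ k hk z hz _ hbox
  let f : ℝ → ℝ → ℕ := fun k b => relIndex (H.trivForm G k b) (offSites (box n L))
  have htI : ∀ i ≤ m, t i ∈ Icc 0 (2 * π) := fun i hi => by
    rw [← ht0, ← htm]
    exact ⟨ht (Nat.zero_le i), ht hi⟩
  have hstep : ∀ i < m, (eigenvalueCount (H.edgeFiber (t (i + 1))) e (a i) : ℤ)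
      - eigenvalueCount (H.edgeFiber (t i)) e (a i) = f (t i) e - f (t (i + 1)) e := by
    intro i hi
    have h1 : ∀ k ∈ Icc 0 (2 * π),
        eigenvalueCount (H.edgeFiber k) e (a i) + f k e = f k (a i) := fun k hk =>
      eigenvalueCount_edgeFiber (hH k hk) (hG.isUnit k hk) (hco k hk) (ha i hi).1 hR.1 (hR.2 i hi)
    have hsub : Icc (t i) (t (i + 1)) ⊆ Icc 0 (2 * π) := fun k hk =>
      ⟨(htI i hi.le).1.trans hk.1, hk.2.trans (htI (i + 1) hi).2⟩
    have h2 : f (t i) (a i) = f (t (i + 1)) (a i) := by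
      have han : ‖((a i : ℝ) : ℂ)‖ ≤ R := by
        rw [Complex.norm_real]
        exact (hR.2 i hi).le
      refine relIndex_eq_of_injective (X := fun k => H.trivForm G k (a i : ℂ))
        (ht (Nat.le_succ i)) (hG.continuous_trivForm _).continuousOn
        (fun k hk => hco k (hsub hk) _ han) (fun k _ => H.symmOp_trivForm G k (a i)) fun k hk => ?_
      rw [← (hH k (hsub hk)).eigenspace_eq_bot_iff (hG.isUnit k (hsub hk)),
        (hH k (hsub hk)).eigenspace_edgeFiber,
        (hH k (hsub hk)).ker_pencil_eq_bot (not_not.1 ((ha i hi).2 k hk)), Submodule.map_bot]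
    have h3 := h1 _ (htI i hi.le)
    have h4 := h1 _ (htI (i + 1) hi)
    omega
  rw [Finset.sum_congr rfl fun i hi => hstep i (Finset.mem_range.1 hi),
    Finset.sum_range_sub', ht0, htm]
  have heR : ‖((e : ℝ) : ℂ)‖ ≤ R := by
    rw [Complex.norm_real]
    exact hR.1.le
  have h0 := fun Ω hΩ => hL₀ 0 zero_mem_Icc_two_pi e heR Ω hΩ
  have h1 : f (2 * π) e = relIndex (H.trivForm G 0 e) (offSites (tiltedBox c L)) :=
    hG.relIndex_two_pi (hco _ two_pi_mem_Icc_two_pi e heR) (h0 _ (box_subset_tiltedBox hc))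
  have h2 := relIndex_offSites h0 (H.symmOp_trivForm G 0 e) hbox (box_subset_tiltedBox hc)
  rw [← h1] at h2
  have h3 := occCard_tiltedBox (N := N) (c := c) (L := L) fun j =>
    le_trans (by simp) (hc j)
  have h4 := occCard_tiltedBox (N := N) (c := (0 : Fin n → ℤ)) (L := L) fun j => by simp
  rw [tiltedBox_zero] at h4
  simp only [Pi.zero_apply, sub_zero] at h4
  rw [Finset.sum_sub_distrib] at h3
  have h5 : (f (2 * π) e : ℤ) + occCard N (box n L) = f 0 e + occCard N (tiltedBox c L) := by
    exact_mod_cast h2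
  linarith

theorem IsTrivialization.exists_spectralFlow (hG : IsTrivialization H N c G r δ)
    (hH : ∀ k ∈ Icc 0 (2 * π), H.IsGapped k) (e : ℝ) :
    ∃ s, HasSpectralFlow H.edgeFiber 0 (2 * π) e s := by
  have h2π : (0 : ℝ) ≤ 2 * π := by positivity
  obtain ⟨L, hL⟩ := hG.exists_coercive (|e| + 1)
  let U : {a : ℝ // e ≤ a} → Set (Icc 0 (2 * π)) := fun a =>
    {k | IsUnit (H.trivForm G k (a.1 : ℂ))}
  have hUo : ∀ a, IsOpen (U a) := fun a =>
    Units.isOpen.preimage ((hG.continuous_trivForm _).comp continuous_subtype_val)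
  have hUc : (univ : Set (Icc 0 (2 * π))) ⊆ ⋃ a, U a := by
    rintro ⟨k, hk⟩ -
    have hu := hG.isUnit k hk
    have hco := fun z hz => hL k hk z hz (box n L) subset_rfl
    obtain ⟨ε, hε, hball⟩ := Metric.eventually_nhds_iff_ball.1
      ((hH k hk).eventually_relIndex hu hco (lt_add_one |e|))
    have hpos : 0 < min ε 1 / 2 := by positivity
    have hlt : min ε 1 / 2 < ε := by
      have := min_le_left ε 1
      linarith
    have hlt1 : min ε 1 / 2 ≤ 1 := by
      have := min_le_right ε 1
      linarith
    have h1 := (hball (e + min ε 1 / 2) (by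
      rw [Metric.mem_ball, Real.dist_eq, add_sub_cancel_left, abs_of_pos hpos]
      exact hlt)).2.2 (by linarith)
    refine mem_iUnion.2 ⟨⟨e + min ε 1 / 2, by linarith⟩, ?_⟩
    refine (hco _ ?_).isUnit (((hH k hk).eigenspace_eq_bot_iff hu _).1 h1)
    rw [Complex.norm_real]
    refine (abs_add_le _ _).trans ?_
    rw [abs_of_pos hpos]
    linarith
  obtain ⟨t, ht0, ht, ⟨m, hm⟩, hta⟩ := exists_monotone_Icc_subset_open_cover_Icc h2π hUo hUc
  choose a ha using hta
  refine ⟨_, m, fun i => t i, fun i => (a i).1, fun i j hij => ht hij, ht0, hm m le_rfl,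
    fun i _ => ⟨(a i).2, fun k hk => ?_⟩, rfl⟩
  have hkI : k ∈ Icc 0 (2 * π) := ⟨(t i).2.1.trans hk.1, hk.2.trans (t (i + 1)).2.2⟩
  have hk' : (⟨k, hkI⟩ : Icc 0 (2 * π)) ∈ U (a i) := ha i ⟨hk.1, hk.2⟩
  exact not_not.2 ((hH k hkI).mem_resolventSet ((isUnit_pencil_iff (hG.isUnit k hkI)).2 hk'))

theorem IsTrivialization.hasSpectralFlow_iff (hG : IsTrivialization H N c G r δ)
    (hH : ∀ k ∈ Icc 0 (2 * π), H.IsGapped k) (e : ℝ) (s : ℤ) :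
    HasSpectralFlow H.edgeFiber 0 (2 * π) e s ↔ s = ∑ j : Fin n with j.val < N, c j := by
  refine ⟨hG.spectralFlow_eq hH, ?_⟩
  rintro rfl
  obtain ⟨s, hs⟩ := hG.exists_spectralFlow hH e
  rwa [← hG.spectralFlow_eq hH hs]

variable {E : Fin n → ℝ → ℝ → ℝ}

theorem IsGappedBands.exists_isTrivialization (hE : IsGappedBands H E)
    (hocc : ∀ (j : Fin n) (kx ky : ℝ), j.val < N → E j kx ky < 0)
    (hunocc : ∀ (j : Fin n) (kx ky : ℝ), N ≤ j.val → 0 < E j kx ky)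
    (hc : ∀ j, IsChernNumber H (E j) (c j)) : ∃ G r δ, IsTrivialization H N c G r δ := by
  obtain ⟨G, r, δ, h1, h2, h3, h4, h5⟩ := hE.exists_trivialization hocc hunocc hc
  exact ⟨G, r, δ, h1, h2, h3, h4, fun k hk => (h5 k hk).1, fun k hk w => ((h5 k hk).2 w).1,
    fun k hk w => ((h5 k hk).2 w).2⟩

theorem IsGappedBands.isGapped_of_occ (hE : IsGappedBands H E)
    (hocc : ∀ (j : Fin n) (kx ky : ℝ), j.val < N → E j kx ky < 0)
    (hunocc : ∀ (j : Fin n) (kx ky : ℝ), N ≤ j.val → 0 < E j kx ky) {k : ℝ}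
    (hk : k ∈ Icc 0 (2 * π)) : H.IsGapped k := by
  refine hE.isGapped (fun j kx ky => ?_) hk
  rcases lt_or_ge j.val N with h | h
  · exact (hocc j kx ky h).ne
  · exact (hunocc j kx ky h).ne'

/-- The spectral flow of the edge operator is the Hall conductance, for any choice of the Chern
numbers of the bands. -/
theorem IsGappedBands.hasSpectralFlow_iff (hE : IsGappedBands H E)
    (hocc : ∀ (j : Fin n) (kx ky : ℝ), j.val < N → E j kx ky < 0)
    (hunocc : ∀ (j : Fin n) (kx ky : ℝ), N ≤ j.val → 0 < E j kx ky)
    (hc : ∀ j, IsChernNumber H (E j) (c j)) (e : ℝ) (s : ℤ) :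
    HasSpectralFlow H.edgeFiber 0 (2 * π) e s ↔ s = ∑ j : Fin n with j.val < N, c j := by
  obtain ⟨G, r, δ, hG⟩ := hE.exists_isTrivialization hocc hunocc hc
  exact hG.hasSpectralFlow_iff (fun k hk => hE.isGapped_of_occ hocc hunocc hk) e s

/-! ### Uniqueness of the Chern numbers -/

/-- The Hamiltonian `H - μ`. -/
def Hamiltonian.shift (H : Hamiltonian n) (μ : ℝ) : Hamiltonian n where
  kernel p q := H.kernel p q - if p = q then (μ : ℂ) • 1 else 0
  hermitian p q := by
    rw [Matrix.conjTranspose_sub, ← H.hermitian]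
    congr 1
    simp only [eq_comm (a := q)]
    split_ifs
    · rw [Matrix.conjTranspose_smul, Matrix.conjTranspose_one]
      simp
    · simp
  periodic v p q := by
    rw [H.periodic]
    simp only [add_left_inj]
  range_one p q h := by
    rw [H.range_one p q h, if_neg, sub_zero]
    rintro rfl
    rw [dist_self] at h
    linarith

theorem Hamiltonian.bloch_shift (H : Hamiltonian n) (μ kx ky : ℝ) :
    (H.shift μ).bloch kx ky = H.bloch kx ky - (μ : ℂ) • 1 := by
  unfold Hamiltonian.bloch Hamiltonian.shift
  simp only [smul_sub, Finset.sum_sub_distrib]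
  congr 1
  rw [Finset.sum_eq_single (0 : ℤ × ℤ)]
  · simp
  · intro r _ hr
    rw [if_neg hr, smul_zero]
  · intro h
    exact absurd (by decide) h

theorem IsGappedBands.shift (hE : IsGappedBands H E) (μ : ℝ) :
    IsGappedBands (H.shift μ) fun j kx ky => E j kx ky - μ where
  eigenvalue j kx ky := by
    obtain ⟨v, hv⟩ := (hE.eigenvalue j kx ky).exists_hasEigenvector
    refine Module.End.hasEigenvalue_of_hasEigenvector (x := v)
      ⟨Module.End.mem_eigenspace_iff.2 ?_, hv.2⟩
    have h := hv.apply_eq_smul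
    rw [Matrix.toLin'_apply] at h ⊢
    rw [H.bloch_shift, Matrix.sub_mulVec, h, Matrix.smul_mulVec, Matrix.one_mulVec, ← sub_smul]
    push_cast
    rfl
  strictMono kx ky i j hij := sub_lt_sub_right (hE.strictMono kx ky hij) μ
  gap i j hij := by
    obtain ⟨e, he⟩ := hE.gap i j hij
    exact ⟨e - μ, fun kx ky => ⟨sub_lt_sub_right (he kx ky).1 μ, sub_lt_sub_right (he kx ky).2 μ⟩⟩

theorem IsChernNumber.shift {F : ℝ → ℝ → ℝ} {d : ℤ} (h : IsChernNumber H F d) (μ : ℝ) :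
    IsChernNumber (H.shift μ) (fun kx ky => F kx ky - μ) d := by
  obtain ⟨φ, θ, h1, h2, h3⟩ := h
  refine ⟨φ, θ, h1, fun kx hkx ky hky => ⟨(h2 kx hkx ky hky).1, ?_⟩, h3⟩
  rw [H.bloch_shift, map_sub, map_smul, LinearMap.sub_apply, (h2 kx hkx ky hky).2,
    LinearMap.smul_apply, Complex.ofReal_sub, sub_smul]
  congr 2
  ext i
  simp

theorem IsGappedBands.exists_level (hE : IsGappedBands H E) (j : Fin n) :
    ∃ μ : ℝ, (∀ i kx ky, i ≤ j → E i kx ky < μ) ∧ ∀ i kx ky, j < i → μ < E i kx ky := by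
  have hmono := fun kx ky => (hE.strictMono kx ky).monotone
  by_cases hj : j.val + 1 < n
  · obtain ⟨e, he⟩ := hE.gap j ⟨j.val + 1, hj⟩ rfl
    refine ⟨e, fun i kx ky hij => (hmono kx ky hij).trans_lt (he kx ky).1,
      fun i kx ky hij => (he kx ky).2.trans_le (hmono kx ky ?_)⟩
    rw [Fin.le_def]
    exact hij
  · obtain ⟨M, hM⟩ := H.exists_norm_blochOp_le
    refine ⟨M + 1, fun i kx ky _ => ?_, fun i kx ky hij => ?_⟩
    · have := (le_abs_self _).trans ((hE.abs_energy_le i kx ky).trans (hM kx ky))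
      linarith
    · have := i.2
      rw [Fin.lt_def] at hij
      omega

theorem IsGappedBands.isChernNumber_unique (hE : IsGappedBands H E) {j : Fin n} {d d' : ℤ}
    (hd : IsChernNumber H (E j) d) (hd' : IsChernNumber H (E j) d') : d = d' := by
  choose c hc using hE.exists_isChernNumber
  obtain ⟨μ, hlt, hgt⟩ := hE.exists_level j
  have key : ∀ d, IsChernNumber H (E j) d → ∀ s,
      HasSpectralFlow (H.shift μ).edgeFiber 0 (2 * π) 0 s ↔
        s = ∑ i : Fin n with i.val < j.val + 1, Function.update c j d i := fun d hd s =>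
    (hE.shift μ).hasSpectralFlow_iff
      (fun i kx ky hi => sub_neg.2 (hlt i kx ky (Fin.le_def.2 (Nat.lt_succ_iff.1 hi))))
      (fun i kx ky hi => sub_pos.2 (hgt i kx ky (Fin.lt_def.2 hi)))
      (fun i => by
        by_cases hi : i = j
        · subst hi
          rw [Function.update_self]
          exact hd.shift μ
        · rw [Function.update_of_ne hi]
          exact (hc i).shift μ) 0 s
  have h1 := (key d' hd' _).1 ((key d hd _).2 rfl)
  have hmem : j ∈ Finset.univ.filter fun i : Fin n => i.val < j.val + 1 := by simp
  rw [Finset.sum_update_of_mem hmem, Finset.sum_update_of_mem hmem] at h1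
  exact add_right_cancel h1

end SpectralFlow

end KitaevEdge

end

theorem theorem1 (n : ℕ) (H : KitaevEdge.Hamiltonian n) (E : Fin n → ℝ → ℝ → ℝ)
    (hE : KitaevEdge.IsGappedBands H E) (N : ℕ) (hN : N ≤ n)
    (hocc : ∀ (j : Fin n) (kx ky : ℝ), j.val < N → E j kx ky < 0)
    (hunocc : ∀ (j : Fin n) (kx ky : ℝ), N ≤ j.val → 0 < E j kx ky) :
    (∀ ky : ℝ, IsSelfAdjoint (H.edgeFiber ky) ∧
      KitaevEdge.HasDiscreteSpectrum (H.edgeFiber ky)) ∧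
    ∃ c : Fin n → ℤ,
      (∀ (j : Fin n) (d : ℤ), KitaevEdge.IsChernNumber H (E j) d ↔ d = c j) ∧
      ∀ (e : ℝ) (s : ℤ), KitaevEdge.HasSpectralFlow H.edgeFiber 0 (2 * Real.pi) e s ↔
        s = ∑ j : Fin n with j.val < N, c j := by
  choose c hc using hE.exists_isChernNumber
  refine ⟨fun ky => ?_, c, fun j d => ⟨fun h => hE.isChernNumber_unique h (hc j), ?_⟩,
    hE.hasSpectralFlow_iff hocc hunocc hc⟩
  · obtain ⟨G, r, δ, hG⟩ := hE.exists_isTrivialization hocc hunocc hc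
    obtain ⟨k, hk, he⟩ := H.edgeFiber_periodic.exists_mem_Ico₀ Real.two_pi_pos ky
    have hk' : k ∈ Icc 0 (2 * Real.pi) := ⟨hk.1, hk.2.le⟩
    have hH := hE.isGapped_of_occ hocc hunocc hk'
    rw [he]
    exact ⟨hG.isSelfAdjoint hk' hH, hG.hasDiscreteSpectrum hk' hH⟩
  · rintro rfl
    exact hc j
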